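/- Let $N\ge 2$, let $\Omega\subseteq S^{N-1}$ be a nonempty connected open subset of the unit sphere of $\mathbb R^N$, let $\rho>0$, and let $$\mathcal C^\rho_\Omega=\{r\omega:\ \omega\in\Omega,\ r>\rho\}\subset\mathbb R^N .$$ Put $C_H=\frac{(N-2)^2}{4}$. For $V\in L^\infty(\Omega)$ let $\lambda_{V,1}$ denote the principal (smallest) eigenvalue of the Dirichlet operator $-\Delta_\omega-V$ on $\Omega$, where $\Delta_\omega$ is the Laplace–Beltrami operator of $S^{N-1}$; that is, the smallest $\lambda\in\mathbb R$ for which there is $0\ne\varphi\in H^1_0(\Omega)$ with $\int_\Omega\nabla_\omega\varphi\cdot\nabla_\omega\psi\,d\omega-\int_\Omega V\varphi\psi\,d\omega=\lambda\int_\Omega\varphi\psi\,d\omega$ for all $\psi\in C_c^\infty(\Omega)$. Write $\lambda_1=\lambda_{0,1}$. A positive super-solution of the equation $$-\Delta v-\frac{V(\omega)}{|x|^2}v=0\quad\text{in }\mathcal C^\rho_\Omega\qquad(\omega=x/|x|)\tag{1}$$ is a function $v\in H^1_{loc}(\mathcal C^\rho_\Omega)$ that is bounded below by a positive constant almost everywhere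 on each compact subset of $\mathcal C^\rho_\Omega$ (that is, $v>0$ and $v^{-1}\in L^\infty_{loc}$) and satisfies $$\int_{\mathcal C^\rho_\Omega}\nabla v\cdot\nabla\varphi\,dx-\int_{\mathcal C^\rho_\Omega}\frac{V(\omega)}{|x|^2}\,v\,\varphi\,dx\ \ge\ 0$$ for all bounded $0\le\varphi\in H^1(\mathcal C^\rho_\Omega)$ with compact support in $\mathcal C^\rho_\Omega$. No boundary condition is imposed. Then for every $V\in L^\infty(\Omega)$ equation (1) has a positive super-solution if and only if $C_H+\lambda_{V,1}\ge 0$. In particular, for constant $V\equiv\mu\in\mathbb R$, equation (1) has a positive super-solution if and only if $\mu\le C_H+\lambda_1$. -/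

import Mathlib

open MeasureTheory Filter Topology
open scoped ContDiff ENNReal InnerProductSpace

noncomputable section

namespace ConeHardy

/-- Euclidean space `ℝ^N`. -/
abbrev Euc (N : ℕ) : Type := EuclideanSpace ℝ (Fin N)

/-- The unit sphere `S^{N-1}` of `ℝ^N`. -/
abbrev Sph (N : ℕ) : Type := Metric.sphere (0 : Euc N) 1

/-- The surface measure `dω` on `S^{N-1}`. -/
abbrev surf (N : ℕ) : Measure (Sph N) := (volume : Measure (Euc N)).toSphere

/-- The cone-like domain of all `r ω` with `ω ∈ Ω` and `r > ρ`. -/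
def cone {N : ℕ} (Ω : Set (Sph N)) (ρ : ℝ) : Set (Euc N) :=
  {x | ∃ r : ℝ, ρ < r ∧ ∃ θ ∈ Ω, x = r • (θ : Euc N)}

/-- The extension of a function on the sphere to `ℝ^N ∖ {0}` that is constant along rays,
`x ↦ ψ (x / |x|)` (with the value `0` at the origin). -/
def radialExt {N : ℕ} (ψ : Sph N → ℝ) (x : Euc N) : ℝ :=
  if hx : x ≠ 0 then
    ψ ⟨‖x‖⁻¹ • x, by
      simp [norm_smul, inv_mul_cancel₀ (norm_ne_zero_iff.mpr hx)]⟩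
  else 0

/-! ### Sobolev functions on an open subset of `ℝ^N` -/

/-- `g` is the weak gradient of `u` in the open set `G`. -/
def HasWeakGradOn {N : ℕ} (G : Set (Euc N)) (u : Euc N → ℝ) (g : Euc N → Euc N) : Prop :=
  ∀ η : Euc N → ℝ, ContDiff ℝ ∞ η → HasCompactSupport η → tsupport η ⊆ G → ∀ e : Euc N,
    ∫ x in G, u x * fderiv ℝ η x e = -∫ x in G, ⟪g x, e⟫_ℝ * η x

/-- `u ∈ H^1_loc(G)`, with weak gradient `g`. -/
structure IsH1Loc {N : ℕ} (G : Set (Euc N)) (u : Euc N → ℝ) (g : Euc N → Euc N) : Prop where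
  memLp : ∀ K ⊆ G, IsCompact K → MemLp u 2 (volume.restrict K)
  memLp_grad : ∀ K ⊆ G, IsCompact K → MemLp g 2 (volume.restrict K)
  hasWeakGradOn : HasWeakGradOn G u g

/-- `φ ∈ H^1_c(G) ∩ L^∞_c(G)`, with weak gradient `h`: a bounded function of class `H^1(G)` that
vanishes almost everywhere outside some compact subset of `G`. -/
structure IsH1cBdd {N : ℕ} (G : Set (Euc N)) (φ : Euc N → ℝ) (h : Euc N → Euc N) : Prop where
  memLp : MemLp φ 2 (volume.restrict G)
  memLp_grad : MemLp h 2 (volume.restrict G)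
  hasWeakGradOn : HasWeakGradOn G φ h
  memLp_top : MemLp φ ∞ (volume.restrict G)
  support : ∃ K ⊆ G, IsCompact K ∧ ∀ᵐ x ∂volume.restrict G, x ∉ K → φ x = 0

/-- `u ∈ H^1_loc(G)` is a super-solution of `-Δu - W u = 0` in `G`, tested against all
nonnegative functions in `H^1_c(G) ∩ L^∞_c(G)`. -/
def IsSuperSolution {N : ℕ} (G : Set (Euc N)) (W u : Euc N → ℝ) : Prop :=
  ∃ g : Euc N → Euc N, IsH1Loc G u g ∧
    ∀ (φ : Euc N → ℝ) (h : Euc N → Euc N), IsH1cBdd G φ h →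
      (∀ᵐ x ∂volume.restrict G, 0 ≤ φ x) →
      0 ≤ (∫ x in G, ⟪g x, h x⟫_ℝ) - ∫ x in G, W x * u x * φ x

/-- Strict positivity in `G`: `u > 0` and `u⁻¹ ∈ L^∞_loc(G)`. -/
def IsPositiveOn {N : ℕ} (G : Set (Euc N)) (u : Euc N → ℝ) : Prop :=
  ∀ K ⊆ G, IsCompact K → ∃ c : ℝ, 0 < c ∧ ∀ᵐ x ∂volume.restrict K, c ≤ u x

/-- The potential `V(ω) |x|⁻²`, where `ω = x / |x|`. -/
def conePotential {N : ℕ} (V : Sph N → ℝ) (x : Euc N) : ℝ :=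
  radialExt V x / ‖x‖ ^ 2

/-- The equation `-Δv - V(ω)|x|⁻² v = 0` has a positive super-solution in the cone-like domain
over `Ω` with inner radius `ρ`. -/
def HasPositiveSuperSolution {N : ℕ} (Ω : Set (Sph N)) (ρ : ℝ) (V : Sph N → ℝ) : Prop :=
  ∃ v : Euc N → ℝ, IsSuperSolution (cone Ω ρ) (conePotential V) v ∧ IsPositiveOn (cone Ω ρ) v

/-! ### The Dirichlet problem on a subdomain of the sphere -/

/-- `ψ ∈ C_c^∞(Ω)`. (Closed subsets of the sphere are compact; a function on the sphere is smooth
exactly when its extension that is constant along rays is smooth off the origin.) -/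
def IsTestOn {N : ℕ} (Ω : Set (Sph N)) (ψ : Sph N → ℝ) : Prop :=
  ContDiffOn ℝ ∞ (radialExt ψ) {0}ᶜ ∧ tsupport ψ ⊆ Ω

/-- The tangential gradient `∇_ω ψ` on the sphere, as a vector in `ℝ^N`: it is the restriction to
the sphere of the gradient of the extension of `ψ` that is constant along rays. -/
def sphGrad {N : ℕ} (ψ : Sph N → ℝ) (θ : Sph N) : Euc N :=
  gradient (radialExt ψ) (θ : Euc N)

/-- `φ ∈ H^1_0(Ω)`, with gradient `g`: the closure of `C_c^∞(Ω)` in the `H^1` norm. -/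
def IsH10 {N : ℕ} (Ω : Set (Sph N)) (φ : Sph N → ℝ) (g : Sph N → Euc N) : Prop :=
  MemLp φ 2 ((surf N).restrict Ω) ∧ MemLp g 2 ((surf N).restrict Ω) ∧
    ∃ ψ : ℕ → Sph N → ℝ, (∀ n, IsTestOn Ω (ψ n)) ∧
      Tendsto (fun n => eLpNorm (fun θ => ψ n θ - φ θ) 2 ((surf N).restrict Ω)) atTop (𝓝 0) ∧
      Tendsto (fun n => eLpNorm (fun θ => sphGrad (ψ n) θ - g θ) 2 ((surf N).restrict Ω))
        atTop (𝓝 0)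

/-- `l` is an eigenvalue of the Dirichlet operator `-Δ_ω - V` on `Ω`: there is a nonzero weak
solution `φ ∈ H^1_0(Ω)` of `-Δ_ω φ - V φ = l φ`. -/
def IsDirichletEigenvalue {N : ℕ} (Ω : Set (Sph N)) (V : Sph N → ℝ) (l : ℝ) : Prop :=
  ∃ (φ : Sph N → ℝ) (g : Sph N → Euc N), IsH10 Ω φ g ∧
    ¬ (∀ᵐ θ ∂(surf N).restrict Ω, φ θ = 0) ∧
    ∀ ψ : Sph N → ℝ, IsTestOn Ω ψ →
      (∫ θ in Ω, ⟪g θ, sphGrad ψ θ⟫_ℝ ∂surf N) - ∫ θ in Ω, V θ * φ θ * ψ θ ∂surf N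
        = l * ∫ θ in Ω, φ θ * ψ θ ∂surf N

/-- The principal (that is, the smallest) eigenvalue of the Dirichlet operator `-Δ_ω - V`
on `Ω`. -/
def principalEigenvalue {N : ℕ} (Ω : Set (Sph N)) (V : Sph N → ℝ) : ℝ :=
  sInf {l | IsDirichletEigenvalue Ω V l}

/-- The Hardy constant `C_H = (N - 2)² / 4`. -/
def hardyConst (N : ℕ) : ℝ := (((N : ℝ) - 2) / 2) ^ 2

end ConeHardy

end

open MeasureTheory Filter Topology
open scoped ContDiff ENNReal InnerProductSpace

noncomputable section

namespace ConeHardy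

/-! ### Partial derivatives and test functions -/

/-! Both directions pass through `bottom`, the infimum of the Rayleigh quotient of `-Δ_ω - V` over
test functions on `Ω`. By `principalEigenvalue_eq_bottom` it equals the principal eigenvalue: it is
attained by a ground state, and no eigenvalue lies below it.

Necessity rests on the principle that a positive super-solution `v` makes the quadratic form
nonnegative. Formally, testing with `φ ^ 2 / v` and completing the square gives `∫ W φ ^ 2 ≤ ∫ |∇φ|
^ 2`. For smooth positive functions this is `integral_neg_lap_div_mul_sq_le`;
`integral_potential_mul_sq_le` reaches the general case by mollifying `v`. Insert `φ = f(r) ψ(ω)`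
with `f(r) = r ^ (-(N - 2) / 2) k(log r)`. In the variable `s = log r` the inequality becomes `0 ≤
(C_H + E(ψ)) ∫ k ^ 2 + ∫ k' ^ 2` for normalised `ψ` with energy `E(ψ)` (`log_hardy`). Stretching `k`
makes the last term negligible, since the cone reaches to infinity and `s` has unlimited room; hence
`C_H + E(ψ) ≥ 0` for every normalised `ψ` (`neg_hardyConst_le_energy`).

Sufficiency is by an explicit solution. Let `φ ≥ 0` be the ground state (`exists_ground_state`, by
Rellich compactness on the sphere, `exists_L2_cauchy_subseq`) and put `v = r ^ (-(N - 2) / 2) φ(ω)`.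
Separation of variables (`cone_equation`) gives `-Δv = (V + λ + C_H) r⁻² v`, which is at least `V
r⁻² v` when `λ + C_H ≥ 0`. The equation is first checked on smooth test functions and then extended
to all admissible ones by density (`IsH1Loc.integral_eq_of_isTestIn`). The ground state is only
known to be nonnegative almost everywhere; local positive lower bounds for `v` come from the strong
minimum principle on the connected cone (`ae_eq_zero_or_isPositiveOn`), proved by a mean value
argument for distributional super-solutions.

A general `V` is replaced by a bounded measurable representative, which changes neither side. A
constant potential `μ` shifts `bottom` by `-μ`. -/

/-- The `i`-th partial derivative. -/
def pd {N : ℕ} (i : Fin N) (u : Euc N → ℝ) (x : Euc N) : ℝ :=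
  fderiv ℝ u x (EuclideanSpace.single i 1)

/-- The Laplacian, as the sum of the pure second partial derivatives. -/
def lap {N : ℕ} (u : Euc N → ℝ) (x : Euc N) : ℝ := ∑ i, pd i (pd i u) x

/-- `k ∈ C_c^∞(G)`. -/
structure IsTestIn {N : ℕ} (G : Set (Euc N)) (k : Euc N → ℝ) : Prop where
  smooth : ContDiff ℝ ∞ k
  compact : HasCompactSupport k
  sub : tsupport k ⊆ G

/-- `-Δu ≥ W u` in the sense of distributions on `G`. -/
def DistSuper {N : ℕ} (G : Set (Euc N)) (W u : Euc N → ℝ) : Prop :=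
  ∀ k, IsTestIn G k → (∀ x, 0 ≤ k x) → ∫ x in G, u x * lap k x ≤ -∫ x in G, W x * u x * k x

section Calculus

variable {N : ℕ}

lemma contDiff_pd {k : Euc N → ℝ} (hk : ContDiff ℝ ∞ k) (i : Fin N) : ContDiff ℝ ∞ (pd i k) := by
  unfold pd
  exact (hk.fderiv_right (m := ∞) (by simp)).clm_apply contDiff_const

lemma contDiff_lap {k : Euc N → ℝ} (hk : ContDiff ℝ ∞ k) : ContDiff ℝ ∞ (lap k) := by
  unfold lap
  exact ContDiff.sum fun i _ => contDiff_pd (contDiff_pd hk i) i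

lemma tsupport_pd_subset (i : Fin N) (k : Euc N → ℝ) : tsupport (pd i k) ⊆ tsupport k :=
  tsupport_fderiv_apply_subset ℝ _

lemma tsupport_lap_subset (k : Euc N → ℝ) : tsupport (lap k) ⊆ tsupport k := by
  refine closure_minimal ?_ (isClosed_tsupport k)
  intro x hx
  by_contra h
  apply hx
  refine Finset.sum_eq_zero fun i _ => ?_
  exact image_eq_zero_of_notMem_tsupport
    fun h' => h (tsupport_pd_subset i k (tsupport_pd_subset i _ h'))

lemma IsTestIn.pd {G : Set (Euc N)} {k : Euc N → ℝ} (hk : IsTestIn G k) (i : Fin N) :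
    IsTestIn G (pd i k) :=
  ⟨contDiff_pd hk.smooth i, hk.compact.mono' ((subset_tsupport _).trans (tsupport_pd_subset i k)),
    (tsupport_pd_subset i k).trans hk.sub⟩

lemma IsTestIn.lap {G : Set (Euc N)} {k : Euc N → ℝ} (hk : IsTestIn G k) :
    IsTestIn G (lap k) :=
  ⟨contDiff_lap hk.smooth, hk.compact.mono' ((subset_tsupport _).trans (tsupport_lap_subset k)),
    (tsupport_lap_subset k).trans hk.sub⟩

lemma fderiv_eq_sum_pd (k : Euc N → ℝ) (x e : Euc N) : fderiv ℝ k x e = ∑ i, e i * pd i k x := by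
  have : e = ∑ i, e i • EuclideanSpace.single i (1 : ℝ) := by
    have := (EuclideanSpace.basisFun (Fin N) ℝ).sum_repr e
    simpa using this.symm
  conv_lhs => rw [this]
  simp [pd, map_sum]

lemma inner_gradient_right (k : Euc N → ℝ) (x v : Euc N) :
    ⟪v, gradient k x⟫_ℝ = fderiv ℝ k x v := by
  rw [real_inner_comm, gradient, InnerProductSpace.toDual_symm_apply]

lemma inner_gradient_eq_sum (k : Euc N → ℝ) (x v : Euc N) :
    ⟪v, gradient k x⟫_ℝ = ∑ i, v i * pd i k x := by
  rw [inner_gradient_right, fderiv_eq_sum_pd]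

lemma gradient_apply (k : Euc N → ℝ) (x : Euc N) (i : Fin N) : gradient k x i = pd i k x := by
  have := inner_gradient_right k x (EuclideanSpace.single i 1)
  rw [EuclideanSpace.inner_single_left] at this
  simpa [pd] using this

lemma norm_gradient_sq (k : Euc N → ℝ) (x : Euc N) : ‖gradient k x‖ ^ 2 = ∑ i, pd i k x ^ 2 := by
  simp [EuclideanSpace.norm_sq_eq, gradient_apply]

lemma inner_single_right' (v : Euc N) (i : Fin N) :
    ⟪v, EuclideanSpace.single i (1 : ℝ)⟫_ℝ = v i := by
  simp [EuclideanSpace.inner_single_right]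

lemma continuous_gradient {k : Euc N → ℝ} (hk : ContDiff ℝ ∞ k) : Continuous (gradient k) := by
  unfold gradient
  exact (LinearIsometryEquiv.continuous _).comp (hk.continuous_fderiv (by simp))

lemma integrable_mul_of_integrableOn_tsupport {u k : Euc N → ℝ}
    (hu : IntegrableOn u (tsupport k)) (hk : Continuous k) (hc : HasCompactSupport k) :
    Integrable (fun x => u x * k x) := by
  have h : IntegrableOn (fun x => u x * k x) (tsupport k) :=
    hu.mul_continuousOn hk.continuousOn hc
  refine (integrableOn_iff_integrable_of_support_subset ?_).1 h
  exact (Function.support_mul_subset_right _ _).trans (subset_tsupport k)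

lemma setIntegral_mul_eq_integral {u k : Euc N → ℝ} {G : Set (Euc N)} (hk : tsupport k ⊆ G) :
    ∫ x in G, u x * k x = ∫ x, u x * k x := by
  refine setIntegral_eq_integral_of_forall_compl_eq_zero fun x hx => ?_
  rw [image_eq_zero_of_notMem_tsupport fun h => hx (hk h), mul_zero]

lemma integral_pd_eq_zero {k : Euc N → ℝ} (hk : ContDiff ℝ ∞ k) (hc : HasCompactSupport k)
    (i : Fin N) : ∫ x, pd i k x = 0 := by
  have hp : Continuous (pd i k) := (contDiff_pd hk i).continuous
  have hpc : HasCompactSupport (pd i k) :=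
    hc.mono' ((subset_tsupport _).trans (tsupport_pd_subset i k))
  -- Integration by parts against the constant `1`, whose derivative vanishes.
  have := integral_mul_fderiv_eq_neg_fderiv_mul_of_integrable (μ := (volume : Measure (Euc N)))
    (f := fun _ => (1 : ℝ)) (g := k) (v := EuclideanSpace.single i 1) (by simp)
    ((hp.integrable_of_hasCompactSupport hpc).congr (Eventually.of_forall fun x => by simp [pd]))
    (by simpa using hk.continuous.integrable_of_hasCompactSupport hc)
    (fun x _ => by fun_prop) (fun x _ => (hk.differentiable (by simp)).differentiableAt)
  simpa [pd] using this

end Calculus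

/-! ### From super-solutions to distributional inequalities -/

section Distribution

variable {N : ℕ} {G : Set (Euc N)}

/-- Makes smooth test functions admissible in `IsSuperSolution`, with the classical gradient in the
role of the weak one. -/
lemma IsTestIn.isH1cBdd {k : Euc N → ℝ} (hk : IsTestIn G k) : IsH1cBdd G k (gradient k) := by
  have hgc : Continuous (gradient k) := continuous_gradient hk.smooth
  have hgs : HasCompactSupport (gradient k) := by
    refine hk.compact.mono' fun x hx => ?_
    by_contra h
    apply hx
    ext i
    rw [gradient_apply]
    exact image_eq_zero_of_notMem_tsupport fun h' => h (tsupport_pd_subset i k h')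
  refine ⟨(hk.smooth.continuous.memLp_of_hasCompactSupport hk.compact).restrict _,
    (hgc.memLp_of_hasCompactSupport hgs).restrict _, ?_,
    (hk.smooth.continuous.memLp_of_hasCompactSupport hk.compact).restrict _,
    tsupport k, hk.sub, hk.compact,
    Eventually.of_forall fun x hx => image_eq_zero_of_notMem_tsupport hx⟩
  intro η hη hηc hηG e
  have h1 : Continuous fun x => fderiv ℝ η x e :=
    (hη.continuous_fderiv (by simp)).clm_apply continuous_const
  have h2 : Continuous fun x => fderiv ℝ k x e :=
    (hk.smooth.continuous_fderiv (by simp)).clm_apply continuous_const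
  have hsub : tsupport (fun x => fderiv ℝ η x e) ⊆ tsupport η := tsupport_fderiv_apply_subset ℝ e
  rw [setIntegral_mul_eq_integral (hsub.trans hηG), setIntegral_mul_eq_integral hηG]
  simp_rw [real_inner_comm, inner_gradient_right]
  exact integral_mul_fderiv_eq_neg_fderiv_mul_of_integrable
    ((h2.mul hη.continuous).integrable_of_hasCompactSupport hηc.mul_left)
    ((hk.smooth.continuous.mul h1).integrable_of_hasCompactSupport hk.compact.mul_right)
    ((hk.smooth.continuous.mul hη.continuous).integrable_of_hasCompactSupport hηc.mul_left)
    (fun x _ => (hk.smooth.differentiable (by simp)).differentiableAt)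
    (fun x _ => (hη.differentiable (by simp)).differentiableAt)

lemma IsH1Loc.integrableOn {u : Euc N → ℝ} {g : Euc N → Euc N} (h : IsH1Loc G u g)
    {K : Set (Euc N)} (hK : IsCompact K) (hKG : K ⊆ G) : IntegrableOn u K := by
  have : IsFiniteMeasure (volume.restrict K) := ⟨by simpa using hK.measure_lt_top⟩
  exact (h.memLp K hKG hK).integrable (by norm_num)

lemma IsH1Loc.integrableOn_grad {u : Euc N → ℝ} {g : Euc N → Euc N} (h : IsH1Loc G u g)
    {K : Set (Euc N)} (hK : IsCompact K) (hKG : K ⊆ G) : IntegrableOn g K := by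
  have : IsFiniteMeasure (volume.restrict K) := ⟨by simpa using hK.measure_lt_top⟩
  exact (h.memLp_grad K hKG hK).integrable (by norm_num)

/-- Integration by parts of the weak gradient against the gradient of a test function. -/
lemma IsH1Loc.integral_inner_gradient {u : Euc N → ℝ} {g : Euc N → Euc N} (h : IsH1Loc G u g)
    {k : Euc N → ℝ} (hk : IsTestIn G k) :
    ∫ x in G, ⟪g x, gradient k x⟫_ℝ = -∫ x in G, u x * lap k x := by
  have hpi : ∀ i, Integrable (fun x => g x i * pd i k x) (volume.restrict G) := by
    intro i
    have : IntegrableOn (fun x => g x i) (tsupport (pd i k)) := by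
      have hi := h.integrableOn_grad (hk.pd i).compact (hk.pd i).sub
      exact (EuclideanSpace.proj i : Euc N →L[ℝ] ℝ).integrable_comp hi
    exact (integrable_mul_of_integrableOn_tsupport this (hk.pd i).smooth.continuous
      (hk.pd i).compact).restrict
  have hpp : ∀ i, Integrable (fun x => u x * pd i (pd i k) x) (volume.restrict G) := fun i =>
    (integrable_mul_of_integrableOn_tsupport
      (h.integrableOn ((hk.pd i).pd i).compact ((hk.pd i).pd i).sub)
      ((hk.pd i).pd i).smooth.continuous ((hk.pd i).pd i).compact).restrict
  simp_rw [inner_gradient_eq_sum, lap, Finset.mul_sum]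
  rw [integral_finsetSum _ fun i _ => hpi i, integral_finsetSum _ fun i _ => hpp i,
    ← Finset.sum_neg_distrib]
  refine Finset.sum_congr rfl fun i _ => ?_
  -- The weak gradient is tested against `pd i k` in the direction `i`; summing over `i` assembles
  -- the Laplacian of `k`.
  have := h.hasWeakGradOn (pd i k) (hk.pd i).smooth (hk.pd i).compact (hk.pd i).sub
    (EuclideanSpace.single i 1)
  simp_rw [inner_single_right'] at this
  change _ = -∫ x in G, u x * fderiv ℝ (pd i k) x (EuclideanSpace.single i 1)
  rw [this, neg_neg]

/-- With both derivatives on the test function, the weak gradient of `u` disappears. This is the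
form in which super-solutions are mollified and averaged over balls. -/
lemma IsSuperSolution.distSuper {W u : Euc N → ℝ} (h : IsSuperSolution G W u) :
    DistSuper G W u := by
  obtain ⟨g, hg, hs⟩ := h
  intro k hk hk0
  have := hs k (gradient k) hk.isH1cBdd (Eventually.of_forall hk0)
  rw [hg.integral_inner_gradient hk] at this
  linarith

end Distribution

/-! ### Mollification -/

section Mollify

open scoped Convolution
open ContinuousLinearMap

variable {N : ℕ} {F : Type*} [NormedAddCommGroup F] [NormedSpace ℝ F]

/-- Mollification of `u` with the kernel `k`. -/
def mol (k : Euc N → ℝ) (u : Euc N → F) : Euc N → F := k ⋆[lsmul ℝ ℝ, volume] u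

lemma mol_apply (k : Euc N → ℝ) (u : Euc N → F) (x : Euc N) :
    mol k u x = ∫ z, k (x - z) • u z := by
  unfold mol
  rw [convolution_lsmul_swap]

lemma mol_apply' (k : Euc N → ℝ) (u : Euc N → F) (x : Euc N) :
    mol k u x = ∫ y, k y • u (x - y) := rfl

lemma contDiff_mol {k : Euc N → ℝ} (hk : ContDiff ℝ ∞ k) (hc : HasCompactSupport k)
    {u : Euc N → F} (hu : LocallyIntegrable u) : ContDiff ℝ ∞ (mol k u) :=
  hc.contDiff_convolution_left _ hk hu

lemma fderiv_mol {k : Euc N → ℝ} (hk : ContDiff ℝ ∞ k) (hc : HasCompactSupport k)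
    {u : Euc N → F} (hu : LocallyIntegrable u) (x e : Euc N) :
    fderiv ℝ (mol k u) x e = mol (fun y => fderiv ℝ k y e) u x := by
  have h := hc.hasFDerivAt_convolution_left (lsmul ℝ ℝ) (hk.of_le (by simp)) hu x
  unfold mol
  rw [h.fderiv, convolution_eq_swap, convolution_eq_swap]
  have hi : Integrable fun t => (precompL (Euc N) (lsmul ℝ ℝ) : (Euc N →L[ℝ] ℝ) →L[ℝ] F →L[ℝ] Euc N →L[ℝ] F)
      (fderiv ℝ k (x - t)) (u t) := by
    have := (hc.fderiv ℝ).convolutionExists_left (precompL (Euc N) (lsmul ℝ ℝ : ℝ →L[ℝ] F →L[ℝ] F))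
      (hk.continuous_fderiv (by simp)) hu x
    exact this.integrable_swap
  rw [ContinuousLinearMap.integral_apply hi]
  simp [precompL_apply]

lemma pd_mol {k : Euc N → ℝ} (hk : ContDiff ℝ ∞ k) (hc : HasCompactSupport k)
    {u : Euc N → ℝ} (hu : LocallyIntegrable u) (i : Fin N) :
    pd i (mol k u) = mol (pd i k) u := by
  ext x
  exact fderiv_mol hk hc hu x _

lemma integrable_mol {k : Euc N → ℝ} (hk : Continuous k) (hc : HasCompactSupport k)
    {u : Euc N → F} (hu : LocallyIntegrable u) (x : Euc N) :
    Integrable fun z => k (x - z) • u z :=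
  (hc.convolutionExists_left (lsmul ℝ ℝ) hk hu x).integrable_swap

lemma integrable_mol' {k : Euc N → ℝ} (hk : Continuous k) (hc : HasCompactSupport k)
    {u : Euc N → F} (hu : LocallyIntegrable u) (x : Euc N) :
    Integrable fun y => k y • u (x - y) :=
  (hc.convolutionExists_left (lsmul ℝ ℝ) hk hu x).integrable

lemma lap_mol {k : Euc N → ℝ} (hk : ContDiff ℝ ∞ k) (hc : HasCompactSupport k)
    {u : Euc N → ℝ} (hu : LocallyIntegrable u) : lap (mol k u) = mol (lap k) u := by
  have hT : IsTestIn Set.univ k := ⟨hk, hc, Set.subset_univ _⟩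
  ext x
  simp_rw [lap, pd_mol hk hc hu, fun i => pd_mol (hT.pd i).smooth (hT.pd i).compact hu i,
    mol_apply, lap, Finset.sum_smul]
  rw [integral_finsetSum]
  intro i _
  exact integrable_mol ((hT.pd i).pd i).smooth.continuous ((hT.pd i).pd i).compact hu x

lemma pd_comp_sub {k : Euc N → ℝ} (hk : ContDiff ℝ ∞ k) (x : Euc N) (i : Fin N) :
    pd i (fun z => k (x - z)) = fun z => -pd i k (x - z) := by
  ext z
  simp only [pd]
  have h := ((hk.differentiable (by simp)) (x - z)).hasFDerivAt.comp z
    ((hasFDerivAt_id z).const_sub x)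
  rw [show (fun z => k (x - z)) = k ∘ fun z => x - z from rfl]
  erw [h.fderiv]
  simp

/-- Each of the two derivatives contributes a sign under the reflection `z ↦ x - z`, and the signs
cancel. Hence the Laplacian of a mollification at `x` is a pairing of `u` with the Laplacian of a
test function. -/
lemma lap_comp_sub {k : Euc N → ℝ} (hk : ContDiff ℝ ∞ k) (x : Euc N) :
    lap (fun z => k (x - z)) = fun z => lap k (x - z) := by
  ext z
  simp only [lap]
  refine Finset.sum_congr rfl fun i _ => ?_
  rw [pd_comp_sub hk]
  have : pd i (fun z => -pd i k (x - z)) z = -pd i (fun z => pd i k (x - z)) z := by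
    simp only [pd]
    rw [fderiv_fun_neg]; simp
  rw [this, pd_comp_sub (contDiff_pd hk i), neg_neg]

lemma tsupport_comp_sub_subset {k : Euc N → ℝ} {r : ℝ} (hr : tsupport k ⊆ Metric.closedBall 0 r)
    (x : Euc N) : tsupport (fun z => k (x - z)) ⊆ Metric.closedBall x r := by
  refine closure_minimal (fun z hz => ?_) Metric.isClosed_closedBall
  have := hr (subset_tsupport _ hz)
  simpa [dist_eq_norm, norm_sub_rev] using this

/-- The reflected and translated kernel is the test function that evaluates a distributional
inequality at the point `x` of a mollification. -/
lemma IsTestIn.comp_sub {G : Set (Euc N)} {k : Euc N → ℝ} {r : ℝ} (hk : ContDiff ℝ ∞ k)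
    (hr : tsupport k ⊆ Metric.closedBall 0 r) {x : Euc N} (hx : Metric.closedBall x r ⊆ G) :
    IsTestIn G (fun z => k (x - z)) :=
  ⟨hk.comp (contDiff_const.sub contDiff_id),
    HasCompactSupport.of_support_subset_isCompact (isCompact_closedBall x r)
      ((subset_tsupport _).trans (tsupport_comp_sub_subset hr x)),
    (tsupport_comp_sub_subset hr x).trans hx⟩

end Mollify
-- Convergence of mollifications, almost everywhere and in `L²`
section MollifyL2

open ContinuousLinearMap

variable {N : ℕ} {F : Type*} [NormedAddCommGroup F] [NormedSpace ℝ F]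

/-- A smooth nonnegative kernel of integral one supported in the ball of radius `r`. -/
structure IsMollifier {N : ℕ} (k : Euc N → ℝ) (r : ℝ) : Prop where
  smooth : ContDiff ℝ ∞ k
  nonneg : ∀ x, 0 ≤ k x
  integral_eq_one : ∫ x, k x = 1
  supp : tsupport k ⊆ Metric.closedBall 0 r

/-- Cauchy–Schwarz against the constant `1`, which has norm one for a probability measure. -/
lemma sq_lintegral_le {α : Type*} [MeasurableSpace α] (ν : Measure α) [IsProbabilityMeasure ν]
    {f : α → ℝ≥0∞} (hf : AEMeasurable f ν) : (∫⁻ y, f y ∂ν) ^ 2 ≤ ∫⁻ y, f y ^ 2 ∂ν := by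
  have h2 := ENNReal.lintegral_mul_le_Lp_mul_Lq ν Real.HolderConjugate.two_two hf
    (aemeasurable_const (b := (1 : ℝ≥0∞)))
  simp only [Pi.mul_apply, mul_one, ENNReal.one_rpow, lintegral_const, measure_univ] at h2
  calc (∫⁻ y, f y ∂ν) ^ 2 ≤ ((∫⁻ y, f y ^ (2 : ℝ) ∂ν) ^ (1 / 2 : ℝ)) ^ 2 := by gcongr
    _ = ∫⁻ y, f y ^ 2 ∂ν := by
      rw [← ENNReal.rpow_natCast, ← ENNReal.rpow_mul]
      norm_num

namespace IsMollifier

variable {k : Euc N → ℝ} {r : ℝ}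

lemma compact (hk : IsMollifier k r) : HasCompactSupport k :=
  HasCompactSupport.of_support_subset_isCompact (isCompact_closedBall 0 r)
    ((subset_tsupport _).trans hk.supp)

lemma integrable (hk : IsMollifier k r) : Integrable k :=
  hk.smooth.continuous.integrable_of_hasCompactSupport hk.compact

lemma lintegral_eq_one (hk : IsMollifier k r) : ∫⁻ x, ENNReal.ofReal (k x) = 1 := by
  rw [← ofReal_integral_eq_lintegral_ofReal hk.integrable (Eventually.of_forall hk.nonneg),
    hk.integral_eq_one, ENNReal.ofReal_one]

lemma eq_zero (hk : IsMollifier k r) {x : Euc N} (hx : r < ‖x‖) : k x = 0 := by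
  refine image_eq_zero_of_notMem_tsupport fun h => ?_
  have := hk.supp h
  rw [mem_closedBall_zero_iff] at this
  linarith

/-- A mollifier is the density of a probability measure, so this is Jensen's inequality for the
square. -/
lemma norm_integral_smul_sq_le (hk : IsMollifier k r) {f : Euc N → F}
    (hf : AEStronglyMeasurable f) :
    ‖∫ y, k y • f y‖ₑ ^ 2 ≤ ∫⁻ y, ENNReal.ofReal (k y) * ‖f y‖ₑ ^ 2 := by
  have hkm : Measurable fun y => ENNReal.ofReal (k y) := hk.smooth.continuous.measurable.ennreal_ofReal
  set ν := (volume : Measure (Euc N)).withDensity fun y => ENNReal.ofReal (k y)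
  have hν : ν Set.univ = 1 := by simp [ν, hk.lintegral_eq_one]
  have hfm : AEMeasurable (fun y => ‖f y‖ₑ) := hf.enorm
  have hfν : AEMeasurable (fun y => ‖f y‖ₑ) ν := hfm.mono_ac (withDensity_absolutelyContinuous _ _)
  have h1 : ‖∫ y, k y • f y‖ₑ ≤ ∫⁻ y, ‖f y‖ₑ ∂ν := by
    refine (enorm_integral_le_lintegral_enorm _).trans (le_of_eq ?_)
    rw [lintegral_withDensity_eq_lintegral_mul₀ hkm.aemeasurable hfm]
    refine lintegral_congr fun y => ?_
    rw [enorm_smul, Pi.mul_apply, Real.enorm_of_nonneg (hk.nonneg y)]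
  have : IsProbabilityMeasure ν := ⟨hν⟩
  have h3 := sq_lintegral_le ν hfν
  calc ‖∫ y, k y • f y‖ₑ ^ 2 ≤ (∫⁻ y, ‖f y‖ₑ ∂ν) ^ 2 := by gcongr
    _ ≤ _ := h3
    _ = _ := by
      rw [lintegral_withDensity_eq_lintegral_mul₀ hkm.aemeasurable (hfm.pow_const 2)]
      rfl

lemma mol_sub_eq [CompleteSpace F] (hk : IsMollifier k r) {u : Euc N → F}
    (hu : LocallyIntegrable u) (x : Euc N) :
    mol k u x - u x = ∫ y, k y • (u (x - y) - u x) := by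
  simp_rw [smul_sub]
  rw [integral_sub (integrable_mol' hk.smooth.continuous hk.compact hu x)
    (hk.integrable.smul_const _), integral_smul_const, hk.integral_eq_one, one_smul, mol_apply']

/-- Jensen at each point, then Tonelli: the `L²` error of mollification is an average of translation
errors, weighted by the kernel. -/
lemma lintegral_mol_sub_sq_le [CompleteSpace F] (hk : IsMollifier k r) {u : Euc N → F}
    (hu : LocallyIntegrable u) (A : Set (Euc N)) :
    ∫⁻ x in A, ‖mol k u x - u x‖ₑ ^ 2 ≤
      ∫⁻ y, ENNReal.ofReal (k y) * ∫⁻ x in A, ‖u (x - y) - u x‖ₑ ^ 2 := by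
  have hum := hu.aestronglyMeasurable
  have hkm : Measurable fun y => ENNReal.ofReal (k y) := hk.smooth.continuous.measurable.ennreal_ofReal
  have hm : AEStronglyMeasurable (fun p : Euc N × Euc N => u (p.1 - p.2) - u p.1)
      ((volume.restrict A).prod volume) := by
    have h1 : AEStronglyMeasurable (fun p : Euc N × Euc N => u (p.1 - p.2))
        ((volume : Measure (Euc N)).prod volume) :=
      hum.comp_quasiMeasurePreserving (quasiMeasurePreserving_sub_of_right_invariant volume volume)
    have h2 : AEStronglyMeasurable (fun p : Euc N × Euc N => u p.1)
        ((volume : Measure (Euc N)).prod volume) := hum.comp_fst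
    exact (h1.sub h2).mono_ac (Measure.AbsolutelyContinuous.prod
      Measure.restrict_le_self.absolutelyContinuous Measure.AbsolutelyContinuous.rfl)
  calc ∫⁻ x in A, ‖mol k u x - u x‖ₑ ^ 2
      ≤ ∫⁻ x in A, ∫⁻ y, ENNReal.ofReal (k y) * ‖u (x - y) - u x‖ₑ ^ 2 := by
        refine lintegral_mono fun x => ?_
        rw [hk.mol_sub_eq hu]
        refine hk.norm_integral_smul_sq_le ?_
        exact (hum.comp_quasiMeasurePreserving
          (quasiMeasurePreserving_sub_left_of_right_invariant volume x)).sub aestronglyMeasurable_const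
    _ = ∫⁻ y, ∫⁻ x in A, ENNReal.ofReal (k y) * ‖u (x - y) - u x‖ₑ ^ 2 := by
        refine lintegral_lintegral_swap ?_
        exact (hkm.comp measurable_snd).aemeasurable.mul (hm.enorm.pow_const 2)
    _ = _ := by
        refine lintegral_congr fun y => ?_
        rw [lintegral_const_mul' _ _ ENNReal.ofReal_ne_top]

/-- If the translates by vectors of length at most `r` are `ε`-close, so is the mollification. -/
lemma lintegral_mol_sub_sq_le_of_translate [CompleteSpace F] (hk : IsMollifier k r)
    {u : Euc N → F} (hu : LocallyIntegrable u) {A : Set (Euc N)} {ε : ℝ≥0∞}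
    (h : ∀ y : Euc N, ‖y‖ ≤ r → ∫⁻ x in A, ‖u (x - y) - u x‖ₑ ^ 2 ≤ ε) :
    ∫⁻ x in A, ‖mol k u x - u x‖ₑ ^ 2 ≤ ε := by
  refine (hk.lintegral_mol_sub_sq_le hu A).trans ?_
  calc _ ≤ ∫⁻ y, ENNReal.ofReal (k y) * ε := by
        refine lintegral_mono fun y => ?_
        rcases le_or_gt ‖y‖ r with hy | hy
        · dsimp only
          gcongr
          exact h y hy
        · simp [hk.eq_zero hy]
    _ = ε := by
        rw [lintegral_mul_const _ hk.smooth.continuous.measurable.ennreal_ofReal,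
          hk.lintegral_eq_one, one_mul]

end IsMollifier

/-- Translations depend continuously on the shift in the compact-open topology and preserve the
measure, so composing a fixed `L²` function with them is continuous in the shift. -/
lemma tendsto_translate_L2 {F : Type*} [NormedAddCommGroup F] {u : Euc N → F} (hu : MemLp u 2) :
    Tendsto (fun y : Euc N => ∫⁻ x, ‖u (x - y) - u x‖ₑ ^ 2) (𝓝 0) (𝓝 0) := by
  set f : Lp F 2 (volume : Measure (Euc N)) := hu.toLp u
  let T : Euc N → C(Euc N, Euc N) := fun y => ⟨fun x => x - y, by fun_prop⟩
  have hT : Continuous T := ContinuousMap.continuous_of_continuous_uncurry _ (by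
    simp only [Function.uncurry_def, T, ContinuousMap.coe_mk]; fun_prop)
  have hmp : ∀ y, MeasurePreserving (T y) (volume : Measure (Euc N)) volume :=
    fun y => measurePreserving_sub_right _ y
  have h1 := Filter.Tendsto.compMeasurePreservingLp (tendsto_const_nhds (x := f))
    (hT.tendsto 0) hmp (hmp 0) (by norm_num)
  have h2 : Lp.compMeasurePreserving (T 0) (hmp 0) f = f := by
    rw [Lp.toLp_compMeasurePreserving]
    congr 1
    ext x
    simp [T]
  rw [h2] at h1
  have h3 := (tendsto_iff_edist_tendsto_0.1 h1)
  have h4 : ∀ y, edist (Lp.compMeasurePreserving (T y) (hmp y) f) f ^ 2 =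
      ∫⁻ x, ‖u (x - y) - u x‖ₑ ^ 2 := by
    intro y
    rw [Lp.toLp_compMeasurePreserving, Lp.edist_toLp_toLp,
      eLpNorm_eq_lintegral_rpow_enorm_toReal (by norm_num) (by norm_num),
      ← ENNReal.rpow_natCast, ← ENNReal.rpow_mul]
    norm_num
    rfl
  simp_rw [← h4]
  have := ENNReal.Tendsto.pow (n := 2) h3
  simpa using this

/-- A fixed sequence of bump functions concentrating at the origin. -/
def bumpSeq (N : ℕ) (δ : ℝ) (hδ : 0 < δ) (n : ℕ) : ContDiffBump (0 : Euc N) where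
  rIn := δ / (n + 1) / 2
  rOut := δ / (n + 1)
  rIn_pos := by positivity
  rIn_lt_rOut := half_lt_self (by positivity)

/-- A sequence of mollifiers of radius `δ / (n + 1)`. -/
def molSeq (N : ℕ) (δ : ℝ) (hδ : 0 < δ) (n : ℕ) : Euc N → ℝ := (bumpSeq N δ hδ n).normed volume

lemma isMollifier_molSeq (N : ℕ) (δ : ℝ) (hδ : 0 < δ) (n : ℕ) :
    IsMollifier (molSeq N δ hδ n) (δ / (n + 1)) where
  smooth := (bumpSeq N δ hδ n).contDiff_normed
  nonneg := (bumpSeq N δ hδ n).nonneg_normed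
  integral_eq_one := (bumpSeq N δ hδ n).integral_normed
  supp := ((bumpSeq N δ hδ n).tsupport_normed_eq).le

lemma tendsto_radius (δ : ℝ) : Tendsto (fun n : ℕ => δ / ((n : ℝ) + 1)) atTop (𝓝 0) := by
  have := tendsto_one_div_add_atTop_nhds_zero_nat (𝕜 := ℝ)
  simpa [div_eq_mul_inv] using this.const_mul δ

lemma radius_le {δ : ℝ} (hδ : 0 < δ) (n : ℕ) : δ / ((n : ℝ) + 1) ≤ δ :=
  div_le_self hδ.le (by linarith [n.cast_nonneg (α := ℝ)])

/-- A common radius for the whole sequence, so that all mollifications live in one fixed thickening.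
-/
lemma isMollifier_molSeq' (N : ℕ) (δ : ℝ) (hδ : 0 < δ) (n : ℕ) :
    IsMollifier (molSeq N δ hδ n) δ :=
  let h := isMollifier_molSeq N δ hδ n
  ⟨h.smooth, h.nonneg, h.integral_eq_one,
    h.supp.trans (Metric.closedBall_subset_closedBall (radius_le hδ n))⟩

lemma ae_tendsto_mol [CompleteSpace F] {δ : ℝ} (hδ : 0 < δ) {u : Euc N → F}
    (hu : LocallyIntegrable u) :
    ∀ᵐ x, Tendsto (fun n => mol (molSeq N δ hδ n) u x) atTop (𝓝 (u x)) := by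
  -- Here `K = 2` bounds the ratio of the outer to the inner radius of the bumps, as Lebesgue
  -- differentiation requires.
  refine ContDiffBump.ae_convolution_tendsto_right_of_locallyIntegrable (K := 2)
    (φ := bumpSeq N δ hδ) (tendsto_radius δ) (Eventually.of_forall fun n => ?_) hu
  simp only [bumpSeq]
  linarith

lemma tendsto_mol_L2 [CompleteSpace F] {δ : ℝ} (hδ : 0 < δ) {u : Euc N → F} (hu : MemLp u 2) :
    Tendsto (fun n => ∫⁻ x, ‖mol (molSeq N δ hδ n) u x - u x‖ₑ ^ 2) atTop (𝓝 0) := by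
  have hul : LocallyIntegrable u := hu.locallyIntegrable (by norm_num)
  rw [ENNReal.tendsto_nhds_zero]
  intro ε hε
  obtain ⟨d, hd, h⟩ := Metric.eventually_nhds_iff.1
    ((ENNReal.tendsto_nhds_zero.1 (tendsto_translate_L2 hu)) ε hε)
  filter_upwards [(tendsto_radius δ).eventually_lt_const hd] with n hn
  have := (isMollifier_molSeq N δ hδ n).lintegral_mol_sub_sq_le_of_translate hul
    (A := Set.univ) (ε := ε) fun y hy => by
      simpa using h (y := y) (by simpa using hy.trans_lt hn)
  simpa using this

end MollifyL2
-- Positive super-solutions and nonnegativity of the quadratic form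
section PositiveSuperSolution

variable {N : ℕ}

lemma pd_mul {u v : Euc N → ℝ} (hu : ContDiff ℝ ∞ u) (hv : ContDiff ℝ ∞ v) (i : Fin N)
    (x : Euc N) : pd i (fun y => u y * v y) x = u x * pd i v x + v x * pd i u x := by
  simp only [pd]
  rw [fderiv_fun_mul ((hu.differentiable (by simp)) x) ((hv.differentiable (by simp)) x)]
  simp

lemma pd_inv {w : Euc N → ℝ} (hw : ContDiff ℝ ∞ w) (i : Fin N) {x : Euc N} (h0 : w x ≠ 0) :
    pd i (fun y => (w y)⁻¹) x = -pd i w x / w x ^ 2 := by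
  have h := ((hw.differentiable (by simp)) x).hasFDerivAt
  have h2 := (hasDerivAt_inv h0).comp_hasFDerivAt x h
  have h3 : HasFDerivAt (fun y => (w y)⁻¹) _ x := h2
  simp only [pd]
  rw [h3.fderiv]
  simp
  ring

/-- The divergence of `φ ^ 2 ∇w / w` integrates to zero, and expanding it leaves `|∇φ| ^ 2 + φ ^ 2
Δw / w` minus the square `|∇φ - φ ∇w / w| ^ 2`. -/
lemma integral_neg_lap_div_mul_sq_le {w φ : Euc N → ℝ} (hw : ContDiff ℝ ∞ w)
    (hpos : ∀ x, 0 < w x) (hφ : ContDiff ℝ ∞ φ) (hc : HasCompactSupport φ) :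
    ∫ x, -lap w x / w x * φ x ^ 2 ≤ ∫ x, ‖gradient φ x‖ ^ 2 := by
  have hT : IsTestIn Set.univ φ := ⟨hφ, hc, Set.subset_univ _⟩
  have hinv : ContDiff ℝ ∞ fun y => (w y)⁻¹ := hw.inv fun x => (hpos x).ne'
  have hpw : ∀ i, ContDiff ℝ ∞ (pd i w) := contDiff_pd hw
  -- The components of the vector field `φ ^ 2 ∇w / w`.
  let A : Fin N → Euc N → ℝ := fun i y => (φ y * φ y) * (pd i w y * (w y)⁻¹)
  have hA : ∀ i, ContDiff ℝ ∞ (A i) := fun i => (hφ.mul hφ).mul ((hpw i).mul hinv)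
  have hAc : ∀ i, HasCompactSupport (A i) := fun i => (hc.mul_left).mul_right
  have hpA : ∀ i x, pd i (A i) x = 2 * φ x * pd i φ x * (pd i w x * (w x)⁻¹)
      + φ x ^ 2 * pd i (pd i w) x * (w x)⁻¹ - φ x ^ 2 * (pd i w x * (w x)⁻¹) ^ 2 := by
    intro i x
    simp only [A]
    rw [pd_mul (hφ.mul hφ) ((hpw i).mul hinv), pd_mul hφ hφ, pd_mul (hpw i) hinv,
      pd_inv hw i (hpos x).ne']
    field_simp
    ring
  have hpt : ∀ x, ∑ i, pd i (A i) x ≤ ‖gradient φ x‖ ^ 2 + lap w x / w x * φ x ^ 2 := by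
    intro x
    rw [norm_gradient_sq, lap, Finset.sum_div, Finset.sum_mul, ← Finset.sum_add_distrib]
    refine Finset.sum_le_sum fun i _ => ?_
    rw [hpA, div_eq_mul_inv]
    nlinarith [sq_nonneg (pd i φ x - φ x * (pd i w x * (w x)⁻¹))]
  have hpAi : ∀ i, Integrable (pd i (A i)) := fun i =>
    (contDiff_pd (hA i) i).continuous.integrable_of_hasCompactSupport
      ((hAc i).mono' ((subset_tsupport _).trans (tsupport_pd_subset i _)))
  have hgi : Integrable fun x => ‖gradient φ x‖ ^ 2 := by
    simp_rw [norm_gradient_sq]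
    refine integrable_finsetSum _ fun i _ => ?_
    simp_rw [pow_two]
    exact ((hT.pd i).smooth.continuous.mul (hT.pd i).smooth.continuous).integrable_of_hasCompactSupport
      (hT.pd i).compact.mul_left
  have hli : Integrable fun x => lap w x / w x * φ x ^ 2 := by
    simp_rw [pow_two, div_eq_mul_inv]
    exact (((contDiff_lap hw).mul hinv).mul (hφ.mul hφ)).continuous.integrable_of_hasCompactSupport
      (hc.mul_left).mul_left
  have h0 : ∫ x, ∑ i, pd i (A i) x = 0 := by
    rw [integral_finsetSum _ fun i _ => hpAi i]
    exact Finset.sum_eq_zero fun i _ => integral_pd_eq_zero (hA i) (hAc i) i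
  have h1 := integral_mono (integrable_finsetSum _ fun i _ => hpAi i) (hgi.add hli) hpt
  simp only [Pi.add_apply] at h1
  rw [h0, integral_add hgi hli] at h1
  simp_rw [neg_div, neg_mul, integral_neg]
  linarith

/-- A positive super-solution forces the quadratic form to be nonnegative. -/
theorem integral_potential_mul_sq_le {G : Set (Euc N)} (hG : IsOpen G) {W u : Euc N → ℝ}
    (hu : ∀ K ⊆ G, IsCompact K → IntegrableOn u K) (hpos : IsPositiveOn G u)
    (hW : AEStronglyMeasurable W (volume.restrict G)) {M : ℝ} (hM0 : 0 ≤ M)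
    (hWM : ∀ x ∈ G, |W x| ≤ M)
    (hs : DistSuper G W u) {φ : Euc N → ℝ} (hφ : IsTestIn G φ) :
    ∫ x in G, W x * φ x ^ 2 ≤ ∫ x, ‖gradient φ x‖ ^ 2 := by
  -- All mollifications use radii at most `δ`, so near the support of `φ` only the values of `u` on
  -- the thickening `K` enter.
  obtain ⟨δ, hδ, hδG⟩ := hφ.compact.exists_cthickening_subset_open hG hφ.sub
  set K := Metric.cthickening δ (tsupport φ) with hKdef
  have hK : IsCompact K := hφ.compact.isCompact.cthickening
  have hKm : MeasurableSet K := hK.isClosed.measurableSet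
  have hball : ∀ x ∈ tsupport φ, Metric.closedBall x δ ⊆ K := fun x hx =>
    Metric.closedBall_subset_cthickening hx δ
  obtain ⟨c, hc, huc⟩ := hpos K hδG hK
  have huK := hu K hδG hK
  -- Outside `K` the function is replaced by its lower bound `c`. The result is locally integrable
  -- and at least `c` almost everywhere, so its mollifications are at least `c` at every point;
  -- nothing changes at points of the support of `φ`.
  set v : Euc N → ℝ := fun x => K.indicator u x + Kᶜ.indicator (fun _ => c) x
  have hvK : ∀ x ∈ K, v x = u x := fun x hx => by simp [v, hx]
  have hvK' : ∀ x ∉ K, v x = c := fun x hx => by simp [v, hx]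
  have hv : LocallyIntegrable v :=
    ((integrable_indicator_iff hKm).2 huK).locallyIntegrable.add
      ((locallyIntegrable_const c).indicator hKm.compl)
  have hvc : ∀ᵐ x, c ≤ v x := by
    filter_upwards [(ae_restrict_iff' hKm).1 huc] with x hx
    by_cases h : x ∈ K
    · rw [hvK x h]; exact hx h
    · rw [hvK' x h]
  have hWu : IntegrableOn (fun x => W x * u x) K := by
    refine huK.bdd_mul (c := M) (hW.mono_measure (Measure.restrict_mono hδG le_rfl)) ?_
    filter_upwards [ae_restrict_mem hKm] with x hx using hWM x (hδG hx)
  set f : Euc N → ℝ := K.indicator fun x => W x * u x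
  have hf : Integrable f := (integrable_indicator_iff hKm).2 hWu
  -- This bound survives mollification and keeps the quotient of the two mollifications below `M`
  -- uniformly in `n`, which is the domination needed in the limit.
  have hM : ∀ᵐ x, ‖f x‖ ≤ M * v x := by
    filter_upwards [hvc] with x hx
    by_cases h : x ∈ K
    · have := hWM x (hδG h)
      rw [hvK x h] at hx ⊢
      simp only [f, Set.indicator_of_mem h, Real.norm_eq_abs, abs_mul]
      rw [abs_of_pos (hc.trans_le hx)]
      exact mul_le_mul_of_nonneg_right this (hc.le.trans hx)
    · simp only [f, Set.indicator_of_notMem h, norm_zero]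
      exact mul_nonneg hM0 (hc.le.trans hx)
  let k := molSeq N δ hδ
  have hk : ∀ n, IsMollifier (k n) δ := isMollifier_molSeq' N δ hδ
  let w : ℕ → Euc N → ℝ := fun n => mol (k n) v
  have hw : ∀ n, ContDiff ℝ ∞ (w n) := fun n => contDiff_mol (hk n).smooth (hk n).compact hv
  have hi : ∀ n x, Integrable fun z => k n (x - z) := fun n x => (hk n).integrable.comp_sub_left x
  have hi1 : ∀ n x, ∫ z, k n (x - z) = 1 := fun n x => by
    rw [integral_sub_left_eq_self (k n) volume x, (hk n).integral_eq_one]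
  have hvi : ∀ n x, Integrable fun z => k n (x - z) • v z := fun n x =>
    integrable_mol (hk n).smooth.continuous (hk n).compact hv x
  have hwc : ∀ n x, c ≤ w n x := by
    intro n x
    have : ∫ z, k n (x - z) * c ≤ ∫ z, k n (x - z) • v z := by
      refine integral_mono_ae ((hi n x).mul_const c) (hvi n x) ?_
      filter_upwards [hvc] with z hz using mul_le_mul_of_nonneg_left hz ((hk n).nonneg _)
    rw [integral_mul_const, hi1, one_mul] at this
    simpa only [w, mol_apply] using this
  have hfw : ∀ n x, |mol (k n) f x| ≤ M * w n x := by
    intro n x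
    simp only [w, mol_apply]
    rw [← integral_const_mul, ← Real.norm_eq_abs]
    refine (norm_integral_le_integral_norm _).trans ?_
    refine integral_mono_ae
      (integrable_mol (hk n).smooth.continuous (hk n).compact hf.locallyIntegrable x).norm
      ((hvi n x).const_mul M) ?_
    filter_upwards [hM] with z hz
    simp only [smul_eq_mul, norm_mul] at hz ⊢
    rw [Real.norm_of_nonneg ((hk n).nonneg _)]
    nlinarith [(hk n).nonneg (x - z)]
  -- The distributional inequality tested with the kernel centred at `x`. It becomes a pointwise
  -- inequality for the smooth function `w n`.
  have hlap : ∀ n, ∀ x ∈ tsupport φ, mol (k n) f x ≤ -lap (w n) x := by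
    intro n x hx
    have hT : IsTestIn K (fun z => k n (x - z)) :=
      IsTestIn.comp_sub (hk n).smooth (hk n).supp (hball x hx)
    have hTG : IsTestIn G (fun z => k n (x - z)) := ⟨hT.smooth, hT.compact, hT.sub.trans hδG⟩
    have h := hs _ hTG fun z => (hk n).nonneg _
    rw [setIntegral_mul_eq_integral hTG.lap.sub, setIntegral_mul_eq_integral hTG.sub] at h
    have e1 : lap (w n) x = ∫ z, u z * lap (fun z => k n (x - z)) z := by
      simp only [w]
      rw [lap_mol (hk n).smooth (hk n).compact hv, mol_apply, lap_comp_sub (hk n).smooth]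
      refine integral_congr_ae (Eventually.of_forall fun z => ?_)
      dsimp only
      by_cases hz : z ∈ K
      · rw [hvK z hz, smul_eq_mul, mul_comm]
      · have : lap (k n) (x - z) = 0 := by
          have h0 : lap (fun z => k n (x - z)) z = 0 :=
            image_eq_zero_of_notMem_tsupport fun h => hz (hT.lap.sub h)
          rwa [lap_comp_sub (hk n).smooth] at h0
        rw [this, zero_smul, mul_zero]
    have e2 : mol (k n) f x = ∫ z, W z * u z * k n (x - z) := by
      rw [mol_apply]
      refine integral_congr_ae (Eventually.of_forall fun z => ?_)
      dsimp only
      by_cases hz : z ∈ K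
      · simp only [f, Set.indicator_of_mem hz, smul_eq_mul]; ring
      · have : k n (x - z) = 0 :=
          image_eq_zero_of_notMem_tsupport (f := fun z => k n (x - z)) fun h => hz (hT.sub h)
        rw [this, zero_smul, mul_zero]
    rw [e1, e2]
    linarith
  have hwp : ∀ n x, 0 < w n x := fun n x => hc.trans_le (hwc n x)
  have hφ2 : Integrable fun x => φ x ^ 2 := by
    simp_rw [pow_two]
    exact (hφ.smooth.continuous.mul hφ.smooth.continuous).integrable_of_hasCompactSupport
      hφ.compact.mul_left
  have hfc : ∀ n, Continuous fun x => mol (k n) f x / w n x := fun n =>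
    (contDiff_mol (hk n).smooth (hk n).compact hf.locallyIntegrable).continuous.div
      (hw n).continuous fun x => (hwp n x).ne'
  have hbd : ∀ n x, |mol (k n) f x / w n x| ≤ M := by
    intro n x
    rw [abs_div, abs_of_pos (hwp n x), div_le_iff₀ (hwp n x)]
    exact hfw n x
  have hn : ∀ n, ∫ x, mol (k n) f x / w n x * φ x ^ 2 ≤ ∫ x, ‖gradient φ x‖ ^ 2 := by
    intro n
    refine le_trans ?_ (integral_neg_lap_div_mul_sq_le (hw n) (hwp n) hφ.smooth hφ.compact)
    refine integral_mono (hφ2.bdd_mul (c := M) (hfc n).aestronglyMeasurable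
      (Eventually.of_forall (hbd n))) ?_ fun x => ?_
    · simp_rw [pow_two]
      exact ((((contDiff_lap (hw n)).neg.continuous).div (hw n).continuous
        fun x => (hwp n x).ne').mul (hφ.smooth.continuous.mul
          hφ.smooth.continuous)).integrable_of_hasCompactSupport (hφ.compact.mul_left).mul_left
    · by_cases hx : x ∈ tsupport φ
      · have := hlap n x hx
        have h0 := hwp n x
        dsimp only
        gcongr
      · simp [image_eq_zero_of_notMem_tsupport hx]
  -- Numerator and denominator converge almost everywhere, the latter to a value at least `c`; the
  -- integrands are dominated by `M * φ x ^ 2`.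
  have hlim : Tendsto (fun n => ∫ x, mol (k n) f x / w n x * φ x ^ 2) atTop
      (𝓝 (∫ x, f x / v x * φ x ^ 2)) := by
    refine tendsto_integral_of_dominated_convergence (fun x => M * φ x ^ 2)
      (fun n => ((hfc n).mul (hφ.smooth.continuous.pow 2)).aestronglyMeasurable)
      (hφ2.const_mul M) (fun n => Eventually.of_forall fun x => ?_) ?_
    · rw [norm_mul, Real.norm_eq_abs, Real.norm_of_nonneg (sq_nonneg _)]
      exact mul_le_mul_of_nonneg_right (hbd n x) (sq_nonneg _)
    · filter_upwards [ae_tendsto_mol hδ hf.locallyIntegrable, ae_tendsto_mol hδ hv, hvc]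
        with x h1 h2 h3
      exact (h1.div h2 (hc.trans_le h3).ne').mul_const _
  have hfin : ∫ x in G, W x * φ x ^ 2 = ∫ x, f x / v x * φ x ^ 2 := by
    rw [setIntegral_eq_integral_of_forall_compl_eq_zero]
    · refine integral_congr_ae ?_
      filter_upwards [hvc] with x hx
      by_cases hxφ : x ∈ tsupport φ
      · have hxK : x ∈ K := hball x hxφ (Metric.mem_closedBall_self hδ.le)
        rw [hvK x hxK] at hx ⊢
        have : u x ≠ 0 := (hc.trans_le hx).ne'
        simp only [f, Set.indicator_of_mem hxK]
        field_simp
      · simp [image_eq_zero_of_notMem_tsupport hxφ]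
    · intro x hx
      simp [image_eq_zero_of_notMem_tsupport fun h => hx (hφ.sub h)]
  rw [hfin]
  exact le_of_tendsto' hlim hn

end PositiveSuperSolution
-- Weighted means over balls and the strong minimum principle
section MinimumPrinciple

variable {N : ℕ}

/-- The profile `t ↦ exp (-1 / (1 - t))`, extended by zero for `1 ≤ t`. -/
def prof (t : ℝ) : ℝ := expNegInvGlue (1 - t)

/-- Minus the derivative of `prof`. -/
def profD (t : ℝ) : ℝ := (1 - t)⁻¹ ^ 2 * expNegInvGlue (1 - t)

lemma hasDerivAt_prof (t : ℝ) : HasDerivAt prof (-profD t) t := by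
  have h := expNegInvGlue.hasDerivAt_polynomial_eval_inv_mul 1 (1 - t)
  have h2 := h.comp t ((hasDerivAt_id t).const_sub 1)
  refine (h2.congr_deriv ?_).congr_of_eventuallyEq (Eventually.of_forall fun x => ?_)
  · simp [profD]
  · simp [prof]

lemma contDiff_prof : ContDiff ℝ ∞ prof :=
  expNegInvGlue.contDiff.comp (contDiff_const.sub contDiff_id)

lemma contDiff_profD : ContDiff ℝ ∞ profD := by
  have h := (expNegInvGlue.contDiff_polynomial_eval_inv_mul (n := ⊤) (Polynomial.X ^ 2)).comp
    ((contDiff_const (c := (1 : ℝ))).sub contDiff_id)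
  have e : profD = (fun x => Polynomial.eval x⁻¹ (Polynomial.X ^ 2) * expNegInvGlue x) ∘
      fun x => 1 - id x := by
    ext x
    simp [profD]
  rw [e]
  exact h

lemma prof_nonneg (t : ℝ) : 0 ≤ prof t := expNegInvGlue.nonneg _

lemma prof_eq_zero {t : ℝ} (ht : 1 ≤ t) : prof t = 0 :=
  expNegInvGlue.zero_of_nonpos (by linarith)

lemma profD_eq_zero {t : ℝ} (ht : 1 ≤ t) : profD t = 0 := by
  rw [profD, expNegInvGlue.zero_of_nonpos (by linarith), mul_zero]

lemma profD_nonneg (t : ℝ) : 0 ≤ profD t := mul_nonneg (sq_nonneg _) (expNegInvGlue.nonneg _)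

/-- The extra factor `(1 - t)⁻²` is at least one on `[0, 1)`. This comparison absorbs the zero-order
term of the equation into the derivative of the weighted mean. -/
lemma prof_le_profD {t : ℝ} (ht : 0 ≤ t) : prof t ≤ profD t := by
  rcases le_or_gt 1 t with h | h
  · rw [prof_eq_zero h, profD_eq_zero h]
  · refine le_mul_of_one_le_left (expNegInvGlue.nonneg _) ?_
    exact one_le_pow₀ ((one_le_inv₀ (by linarith)).2 (by linarith))

lemma hasDerivAt_profD (t : ℝ) : HasDerivAt profD (deriv profD t) t :=
  ((contDiff_profD.differentiable (by simp)) t).hasDerivAt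

lemma deriv_profD_eq_zero {t : ℝ} (ht : 1 < t) : deriv profD t = 0 := by
  have : profD =ᶠ[𝓝 t] fun _ => 0 := by
    filter_upwards [lt_mem_nhds ht] with x hx using profD_eq_zero hx.le
  rw [this.deriv_eq, deriv_const]

lemma exists_bound_profD : ∃ C, 0 ≤ C ∧ ∀ t, 0 ≤ t → |profD t| ≤ C ∧ |t * deriv profD t| ≤ C := by
  have h1 : Continuous profD := contDiff_profD.continuous
  have h2 : Continuous fun t => t * deriv profD t :=
    continuous_id.mul (contDiff_profD.continuous_deriv (by simp))
  obtain ⟨C1, hC1⟩ := isCompact_Icc.exists_bound_of_continuousOn (s := Set.Icc (0 : ℝ) 1) h1.continuousOn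
  obtain ⟨C2, hC2⟩ := isCompact_Icc.exists_bound_of_continuousOn (s := Set.Icc (0 : ℝ) 1) h2.continuousOn
  have h0 : (0 : ℝ) ≤ max C1 C2 :=
    (norm_nonneg _).trans ((hC1 0 (by simp)).trans (le_max_left _ _))
  refine ⟨max C1 C2, h0, fun t ht => ?_⟩
  rcases le_or_gt t 1 with h | h
  · exact ⟨(hC1 t ⟨ht, h⟩).trans (le_max_left _ _), (hC2 t ⟨ht, h⟩).trans (le_max_right _ _)⟩
  · rw [profD_eq_zero h.le, deriv_profD_eq_zero h]
    simpa using h0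

/-- The radial bump `z ↦ prof (|z - y|² / s²)`. -/
def rad (y : Euc N) (s : ℝ) (z : Euc N) : ℝ := prof (‖z - y‖ ^ 2 / s ^ 2)

lemma contDiff_normSq_sub (y : Euc N) (s : ℝ) :
    ContDiff ℝ ∞ fun z : Euc N => ‖z - y‖ ^ 2 / s ^ 2 :=
  ((contDiff_id.sub contDiff_const).norm_sq ℝ).div_const _

lemma contDiff_rad (y : Euc N) (s : ℝ) : ContDiff ℝ ∞ (rad y s) :=
  contDiff_prof.comp (contDiff_normSq_sub y s)

lemma pd_comp_normSq {f : ℝ → ℝ} {f' : ℝ} (y : Euc N) (s : ℝ) (z : Euc N)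
    (hf : HasDerivAt f f' (‖z - y‖ ^ 2 / s ^ 2)) (i : Fin N) :
    pd i (fun z => f (‖z - y‖ ^ 2 / s ^ 2)) z = f' * (2 * (z i - y i) / s ^ 2) := by
  have h1 : HasFDerivAt (fun z : Euc N => ‖z - y‖ ^ 2) _ z :=
    ((hasFDerivAt_id z).sub_const y).norm_sq
  rw [div_eq_mul_inv] at hf
  have h2 := hf.comp_hasFDerivAt z (h1.mul_const (s ^ 2)⁻¹)
  have e : (fun z : Euc N => f (‖z - y‖ ^ 2 / s ^ 2)) =
      f ∘ fun z : Euc N => ‖z - y‖ ^ 2 * (s ^ 2)⁻¹ := by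
    ext z
    rw [Function.comp_apply, div_eq_mul_inv]
  rw [pd, e, h2.fderiv]
  simp [inner_single_right']
  left
  ring

lemma pd_coord (y : Euc N) (s : ℝ) (z : Euc N) (i : Fin N) :
    pd i (fun z : Euc N => 2 * (z i - y i) / s ^ 2) z = 2 / s ^ 2 := by
  have h0 : HasFDerivAt (fun z : Euc N => z i) (EuclideanSpace.proj i : Euc N →L[ℝ] ℝ) z :=
    (EuclideanSpace.proj i : Euc N →L[ℝ] ℝ).hasFDerivAt
  have h1 := ((h0.sub_const (y i)).const_mul (2 : ℝ)).mul_const (s ^ 2)⁻¹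
  have e : (fun z : Euc N => 2 * (z i - y i) / s ^ 2) =
      fun z : Euc N => 2 * (z i - y i) * (s ^ 2)⁻¹ := by
    ext z
    rw [div_eq_mul_inv]
  rw [pd, e, h1.fderiv]
  simp
  ring

/-- In the variable `q = |z - y|² / s²` the Laplacian of `f(q)` is `(4 q f'' + 2 N f') / s²`, and
here `f' = -profD`. -/
lemma lap_rad (y : Euc N) (s : ℝ) (z : Euc N) :
    lap (rad y s) z = -(4 * (‖z - y‖ ^ 2 / s ^ 2 * deriv profD (‖z - y‖ ^ 2 / s ^ 2)) / s ^ 2)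
      - 2 * N * profD (‖z - y‖ ^ 2 / s ^ 2) / s ^ 2 := by
  have h1 : ∀ i, pd i (rad y s) =
      fun z => -profD (‖z - y‖ ^ 2 / s ^ 2) * (2 * (z i - y i) / s ^ 2) := fun i => by
    ext z
    exact pd_comp_normSq y s z (hasDerivAt_prof _) i
  have h2 : ∀ i, pd i (pd i (rad y s)) z =
      -profD (‖z - y‖ ^ 2 / s ^ 2) * (2 / s ^ 2) + (2 * (z i - y i) / s ^ 2) *
        (-deriv profD (‖z - y‖ ^ 2 / s ^ 2) * (2 * (z i - y i) / s ^ 2)) := fun i => by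
    rw [h1, pd_mul, pd_coord]
    · congr 2
      exact pd_comp_normSq (f := fun t => -profD t) y s z (hasDerivAt_profD _).neg i
    · exact (contDiff_profD.comp (contDiff_normSq_sub y s)).neg
    · have : ContDiff ℝ ∞ fun z : Euc N => z i := (EuclideanSpace.proj i : Euc N →L[ℝ] ℝ).contDiff
      exact ((contDiff_const.mul (this.sub contDiff_const)).div_const _)
  simp only [lap, h2]
  rw [Finset.sum_add_distrib, Finset.sum_const, EuclideanSpace.norm_sq_eq]
  have h3 : ∑ i, 2 * (z i - y i) / s ^ 2 * (-deriv profD (‖z - y‖ ^ 2 / s ^ 2) *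
      (2 * (z i - y i) / s ^ 2)) = -deriv profD (‖z - y‖ ^ 2 / s ^ 2) * 4 / (s ^ 2) / s ^ 2 *
        ∑ i, ‖(z - y) i‖ ^ 2 := by
    rw [Finset.mul_sum]
    refine Finset.sum_congr rfl fun i _ => ?_
    simp only [PiLp.sub_apply, Real.norm_eq_abs, sq_abs]
    ring
  rw [EuclideanSpace.norm_sq_eq] at h3
  rw [h3]
  simp only [Finset.card_univ, Fintype.card_fin, nsmul_eq_mul]
  ring

lemma tsupport_rad_subset (y : Euc N) {s : ℝ} (hs : 0 < s) :
    tsupport (rad y s) ⊆ Metric.closedBall y s := by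
  refine closure_minimal (fun z hz => ?_) Metric.isClosed_closedBall
  by_contra h
  apply hz
  rw [Metric.mem_closedBall, dist_eq_norm, not_le] at h
  refine prof_eq_zero ?_
  rw [one_le_div (by positivity)]
  gcongr

lemma isTestIn_rad {G : Set (Euc N)} (y : Euc N) {s : ℝ} (hs : 0 < s)
    (hG : Metric.closedBall y s ⊆ G) : IsTestIn G (rad y s) :=
  ⟨contDiff_rad y s, HasCompactSupport.of_support_subset_isCompact (isCompact_closedBall y s)
    ((subset_tsupport _).trans (tsupport_rad_subset y hs)), (tsupport_rad_subset y hs).trans hG⟩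

/-- The weighted mean of `v` over the ball of radius `s` around `y` (up to a constant factor). -/
def wmean (v : Euc N → ℝ) (y : Euc N) (s : ℝ) : ℝ :=
  ∫ z, (s ^ N)⁻¹ * profD (‖z - y‖ ^ 2 / s ^ 2) * v z

lemma continuous_profD_normSq (y : Euc N) (s : ℝ) :
    Continuous fun z : Euc N => profD (‖z - y‖ ^ 2 / s ^ 2) :=
  contDiff_profD.continuous.comp (contDiff_normSq_sub y s).continuous

lemma integrable_profD_mul {v : Euc N → ℝ} (hv : Integrable v) (y : Euc N) (s : ℝ) :
    Integrable fun z => profD (‖z - y‖ ^ 2 / s ^ 2) * v z := by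
  obtain ⟨C, _, hC⟩ := exists_bound_profD
  exact hv.bdd_mul (c := C) (continuous_profD_normSq y s).aestronglyMeasurable
    (Eventually.of_forall fun z => (hC _ (by positivity)).1)

/-- The weight is chosen so that the `s`-derivative of `s⁻ᴺ profD(|z - y|² / s²)` is `s / (2 sᴺ)`
times the Laplacian in `z` of `rad y s`. This is the mechanism of the mean value property: changing
the radius tests the Laplacian of `v`. -/
lemma hasDerivAt_wmean {v : Euc N → ℝ} (hv : Integrable v) (y : Euc N) {s : ℝ} (hs : 0 < s) :
    HasDerivAt (wmean v y) (s / (2 * s ^ N) * ∫ z, v z * lap (rad y s) z) s := by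
  obtain ⟨C, hC0, hC⟩ := exists_bound_profD
  have key : ∀ z, ∀ t, 0 < t → HasDerivAt
      (fun t : ℝ => (t ^ N)⁻¹ * profD (‖z - y‖ ^ 2 / t ^ 2) * v z)
      (t / (2 * t ^ N) * (v z * lap (rad y t) z)) t := by
    intro z t ht
    have h1 : HasDerivAt (fun t : ℝ => ‖z - y‖ ^ 2 / t ^ 2)
        (-(2 * (‖z - y‖ ^ 2 / t ^ 2) / t)) t := by
      have := ((hasDerivAt_pow 2 t).inv (by positivity)).const_mul (‖z - y‖ ^ 2)
      simp only [div_eq_mul_inv] at this ⊢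
      refine this.congr_deriv ?_
      field_simp
      norm_num
      ring
    have h2 : HasDerivAt (fun t : ℝ => (t ^ N)⁻¹) (-(N * (t ^ N)⁻¹ / t)) t := by
      have := (hasDerivAt_pow N t).inv (by positivity)
      refine this.congr_deriv ?_
      -- The derivative of a power involves the truncated exponent `N - 1`, so the exponent zero is
      -- separate.
      rcases Nat.eq_zero_or_pos N with h | h
      · simp [h]
      · obtain ⟨n, rfl⟩ : ∃ n, N = n + 1 := ⟨N - 1, by omega⟩
        simp only [Nat.add_sub_cancel]
        field_simp
        ring
    have h3 := ((h2.mul ((hasDerivAt_profD _).comp t h1)).mul_const (v z))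
    refine h3.congr_deriv ?_
    rw [lap_rad]
    simp only [Function.comp]
    field_simp
    ring
  have hmeas : ∀ t, AEStronglyMeasurable
      (fun z => (t ^ N)⁻¹ * profD (‖z - y‖ ^ 2 / t ^ 2) * v z) volume := fun t => by
    simp_rw [mul_assoc]
    exact ((integrable_profD_mul hv y t).const_mul _).aestronglyMeasurable
  -- Radii in this neighbourhood exceed `s / 2`, which gives a bound on the differentiated kernel
  -- that is uniform in the radius.
  have hball : Metric.ball s (s / 2) ∈ 𝓝 s := Metric.ball_mem_nhds s (by positivity)
  have main := hasDerivAt_integral_of_dominated_loc_of_deriv_le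
    (μ := (volume : Measure (Euc N))) (𝕜 := ℝ)
    (F := fun t z => (t ^ N)⁻¹ * profD (‖z - y‖ ^ 2 / t ^ 2) * v z)
    (F' := fun t z => t / (2 * t ^ N) * (v z * lap (rad y t) z)) (x₀ := s)
    (bound := fun z => (4 * C + 2 * N * C) / (2 * (s / 2) * (s / 2) ^ N) * |v z|)
    hball (Eventually.of_forall hmeas) ?_ ?_ ?_ ?_ ?_
  · rw [← integral_const_mul]
    exact main.2
  · simp_rw [mul_assoc]
    exact (integrable_profD_mul hv y s).const_mul _
  · exact ((hv.aestronglyMeasurable.mul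
      (contDiff_lap (contDiff_rad y s)).continuous.aestronglyMeasurable).const_mul _)
  · refine Eventually.of_forall fun z t ht => ?_
    rw [Metric.mem_ball, Real.dist_eq, abs_lt] at ht
    have ht0 : s / 2 < t := by linarith
    have htp : 0 < t := by linarith
    have hq := hC (‖z - y‖ ^ 2 / t ^ 2) (by positivity)
    have hl : |lap (rad y t) z| ≤ (4 * C + 2 * N * C) / t ^ 2 := by
      rw [lap_rad, sub_eq_add_neg]
      refine (abs_add_le _ _).trans ?_
      rw [abs_neg, abs_neg, abs_div, abs_div, abs_of_pos (show 0 < t ^ 2 by positivity), ← add_div]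
      gcongr
      · rw [abs_mul]
        simpa using hq.2
      · rw [abs_mul, abs_of_nonneg (show (0 : ℝ) ≤ 2 * N by positivity)]
        gcongr
        exact hq.1
    have : (4 * C + 2 * N * C) / (2 * t * t ^ N) ≤
        (4 * C + 2 * N * C) / (2 * (s / 2) * (s / 2) ^ N) := by
      gcongr
    calc ‖t / (2 * t ^ N) * (v z * lap (rad y t) z)‖
        = t / (2 * t ^ N) * |lap (rad y t) z| * |v z| := by
          rw [Real.norm_eq_abs, abs_mul, abs_mul, abs_of_pos (by positivity)]; ring
      _ ≤ t / (2 * t ^ N) * ((4 * C + 2 * N * C) / t ^ 2) * |v z| := by gcongr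
      _ = (4 * C + 2 * N * C) / (2 * t * t ^ N) * |v z| := by field_simp
      _ ≤ _ := by gcongr
  · exact (hv.abs).const_mul _
  · refine Eventually.of_forall fun z t ht => key z t ?_
    rw [Metric.mem_ball, Real.dist_eq, abs_lt] at ht
    linarith

/-- The differential inequality tested with `rad y r`, together with `prof ≤ profD`, bounds the
derivative of the mean by `c r / 2` times the mean. The factor `exp (-c r² / 4)` is the
corresponding Gronwall factor. -/
lemma wmean_mono {v : Euc N → ℝ} (hv : Integrable v) (hv0 : ∀ᵐ x, 0 ≤ v x) {B : Set (Euc N)}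
    {c : ℝ} (hc : 0 ≤ c) (hs : DistSuper B (fun _ => -c) v) {y : Euc N} {R s t : ℝ}
    (hR : Metric.closedBall y R ⊆ B) (hs0 : 0 < s) (hst : s ≤ t) (htR : t < R) :
    Real.exp (-(c * t ^ 2 / 4)) * wmean v y t ≤ Real.exp (-(c * s ^ 2 / 4)) * wmean v y s := by
  have hd : ∀ r, 0 < r → HasDerivAt (fun r => Real.exp (-(c * r ^ 2 / 4)) * wmean v y r)
      (Real.exp (-(c * r ^ 2 / 4)) * (r / (2 * r ^ N) * ∫ z, v z * lap (rad y r) z)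
        - Real.exp (-(c * r ^ 2 / 4)) * (c * r / 2) * wmean v y r) r := by
    intro r hr
    have h1 : HasDerivAt (fun r : ℝ => Real.exp (-(c * r ^ 2 / 4)))
        (Real.exp (-(c * r ^ 2 / 4)) * (-(c * r / 2))) r := by
      have h0 : HasDerivAt (fun r : ℝ => -(c * r ^ 2 / 4)) _ r :=
        (((hasDerivAt_pow 2 r).const_mul c).div_const 4).neg
      have := h0.exp
      refine this.congr_deriv ?_
      simp only [Nat.cast_ofNat]
      ring
    exact (h1.mul (hasDerivAt_wmean hv y hr)).congr_deriv (by ring)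
  have hnp : ∀ r ∈ Set.Ioo 0 R, Real.exp (-(c * r ^ 2 / 4)) *
      (r / (2 * r ^ N) * ∫ z, v z * lap (rad y r) z)
        - Real.exp (-(c * r ^ 2 / 4)) * (c * r / 2) * wmean v y r ≤ 0 := by
    intro r hr
    have hr0 : 0 < r := hr.1
    have hT : IsTestIn B (rad y r) :=
      isTestIn_rad y hr0 ((Metric.closedBall_subset_closedBall hr.2.le).trans hR)
    have h := hs _ hT fun x => prof_nonneg _
    rw [setIntegral_mul_eq_integral hT.lap.sub, setIntegral_mul_eq_integral hT.sub] at h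
    have h2 : ∫ z, v z * rad y r z ≤ ∫ z, profD (‖z - y‖ ^ 2 / r ^ 2) * v z := by
      refine integral_mono_ae (integrable_mul_of_integrableOn_tsupport hv.integrableOn
        hT.smooth.continuous hT.compact) (integrable_profD_mul hv y r) ?_
      filter_upwards [hv0] with z hz
      rw [mul_comm]
      exact mul_le_mul_of_nonneg_right (prof_le_profD (by positivity)) hz
    have h3 : wmean v y r = (r ^ N)⁻¹ * ∫ z, profD (‖z - y‖ ^ 2 / r ^ 2) * v z := by
      rw [wmean, ← integral_const_mul]
      simp_rw [mul_assoc]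
    have h4 : ∫ z, v z * lap (rad y r) z ≤ c * ∫ z, profD (‖z - y‖ ^ 2 / r ^ 2) * v z := by
      calc _ ≤ _ := h
        _ = c * ∫ z, v z * rad y r z := by
          rw [← integral_const_mul, ← integral_neg]
          refine integral_congr_ae (Eventually.of_forall fun z => ?_)
          dsimp only
          ring
        _ ≤ _ := mul_le_mul_of_nonneg_left h2 hc
    rw [h3]
    have h5 := mul_le_mul_of_nonneg_left h4
      (show 0 ≤ Real.exp (-(c * r ^ 2 / 4)) * (r / (2 * r ^ N)) by positivity)
    refine sub_nonpos.2 ((le_of_eq (by ring)).trans (h5.trans (le_of_eq ?_)))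
    field_simp
  have hanti : AntitoneOn (fun r => Real.exp (-(c * r ^ 2 / 4)) * wmean v y r) (Set.Ioo 0 R) := by
    refine antitoneOn_of_deriv_nonpos (convex_Ioo 0 R)
      (fun r hr => (hd r hr.1).continuousAt.continuousWithinAt)
      (fun r hr => ?_) (fun r hr => ?_)
    · rw [interior_Ioo] at hr
      exact (hd r hr.1).differentiableAt.differentiableWithinAt
    · rw [interior_Ioo] at hr
      rw [(hd r hr.1).deriv]
      exact hnp r hr
  exact hanti ⟨hs0, hst.trans_lt htR⟩ ⟨hs0.trans_le hst, htR⟩ hst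

lemma integral_profD_pos : 0 < ∫ z : Euc N, profD (‖z‖ ^ 2) := by
  have hc : Continuous fun z : Euc N => profD (‖z‖ ^ 2) :=
    contDiff_profD.continuous.comp (continuous_norm.pow 2)
  have hs : HasCompactSupport fun z : Euc N => profD (‖z‖ ^ 2) := by
    refine HasCompactSupport.of_support_subset_isCompact (isCompact_closedBall 0 1) fun z hz => ?_
    by_contra h
    apply hz
    rw [mem_closedBall_zero_iff, not_le] at h
    exact profD_eq_zero (one_le_pow₀ h.le)
  refine hc.integral_pos_of_hasCompactSupport_nonneg_nonzero hs (fun z => profD_nonneg _)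
    (x := 0) ?_
  have : 0 < prof 0 := by simp [prof, expNegInvGlue.pos_of_pos]
  simpa using (this.trans_le (prof_le_profD le_rfl)).ne'

/-- Lebesgue differentiation: the kernels are a constant multiple of an approximate identity
supported in shrinking balls and bounded by a multiple of the inverse volume. -/
lemma ae_tendsto_wmean {v : Euc N → ℝ} (hv : Integrable v) :
    ∀ᵐ y, Tendsto (wmean v y) (𝓝[>] 0) (𝓝 ((∫ z : Euc N, profD (‖z‖ ^ 2)) * v y)) := by
  obtain ⟨C, hC0, hC⟩ := exists_bound_profD
  set κ := ∫ z : Euc N, profD (‖z‖ ^ 2)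
  have hκ : 0 < κ := integral_profD_pos
  filter_upwards [(Besicovitch.vitaliFamily (volume : Measure (Euc N))).ae_tendsto_average_norm_sub
    hv.locallyIntegrable] with y hy
  have h1 := hy.comp (Besicovitch.tendsto_filterAt (volume : Measure (Euc N)) y)
  have hpos : ∀ᶠ s : ℝ in 𝓝[>] 0, 0 < s := eventually_mem_nhdsWithin
  have hint : ∀ s : ℝ, 0 < s → ∫ z : Euc N, profD (‖z - y‖ ^ 2 / s ^ 2) = s ^ N * κ := by
    intro s hs
    rw [integral_sub_right_eq_self (fun z : Euc N => profD (‖z‖ ^ 2 / s ^ 2)) y]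
    have := Measure.integral_comp_inv_smul (volume : Measure (Euc N))
      (fun z : Euc N => profD (‖z‖ ^ 2)) s
    rw [finrank_euclideanSpace_fin, abs_of_pos (by positivity), smul_eq_mul] at this
    rw [← this]
    refine integral_congr_ae (Eventually.of_forall fun z => ?_)
    dsimp only
    rw [norm_smul, norm_inv, Real.norm_of_nonneg hs.le]
    congr 1
    field_simp
  set w := (volume : Measure (Euc N)).real (Metric.closedBall (0 : Euc N) 1)
  have hw : 0 < w := by
    have := Metric.measure_closedBall_pos (volume : Measure (Euc N)) (0 : Euc N) one_pos
    exact ENNReal.toReal_pos this.ne' (measure_closedBall_lt_top).ne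
  -- Dividing by `κ` gives the kernel integral one; `K` compares its supremum with the inverse
  -- volume of the ball.
  have h2 := tendsto_integral_smul_of_tendsto_average_norm_sub (μ := (volume : Measure (Euc N)))
    (a := fun s : ℝ => Metric.closedBall y s) (l := 𝓝[>] 0) (f := v) (c := v y)
    (g := fun s z => κ⁻¹ * ((s ^ N)⁻¹ * profD (‖z - y‖ ^ 2 / s ^ 2))) (K := κ⁻¹ * C * w) h1
    (Eventually.of_forall fun s => hv.integrableOn) ?_ ?_ ?_
  · have h3 := h2.const_mul κ
    refine h3.congr fun s => ?_
    rw [← integral_const_mul, wmean]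
    refine integral_congr_ae (Eventually.of_forall fun z => ?_)
    simp only [smul_eq_mul]
    field_simp
  · refine tendsto_const_nhds.congr' ?_
    filter_upwards [hpos] with s hs
    simp_rw [← mul_assoc]
    rw [integral_const_mul, hint s hs]
    field_simp
  · filter_upwards [hpos] with s hs
    intro z hz
    by_contra h
    apply hz
    rw [Metric.mem_closedBall, dist_eq_norm, not_le] at h
    dsimp only
    rw [profD_eq_zero, mul_zero, mul_zero]
    rw [one_le_div (by positivity)]
    gcongr
  · filter_upwards [hpos] with s hs z
    have hb : (volume : Measure (Euc N)).real (Metric.closedBall y s) = s ^ N * w := by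
      rw [Measure.addHaar_real_closedBall' _ _ hs.le, finrank_euclideanSpace_fin]
    rw [hb, abs_mul, abs_mul, abs_of_pos (inv_pos.2 hκ),
      abs_of_pos (show 0 < (s ^ N)⁻¹ by positivity)]
    have := (hC (‖z - y‖ ^ 2 / s ^ 2) (by positivity)).1
    calc κ⁻¹ * ((s ^ N)⁻¹ * |profD (‖z - y‖ ^ 2 / s ^ 2)|) ≤ κ⁻¹ * ((s ^ N)⁻¹ * C) := by gcongr
      _ = _ := by field_simp

/-- A local weak Harnack inequality for nonnegative super-solutions. -/
lemma exists_ae_mul_integral_le {G : Set (Euc N)} {u : Euc N → ℝ}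
    (hu : ∀ K ⊆ G, IsCompact K → IntegrableOn u K) (hu0 : ∀ᵐ x ∂volume.restrict G, 0 ≤ u x)
    {c : ℝ} (hc : 0 ≤ c) (hs : DistSuper G (fun _ => -c) u) {x₀ : Euc N} {R : ℝ} (hR : 0 < R)
    (hRG : Metric.closedBall x₀ (3 * R) ⊆ G) :
    ∃ b, 0 < b ∧ ∀ᵐ y ∂volume.restrict (Metric.ball x₀ (R / 4)),
      b * ∫ x in Metric.ball x₀ (R / 4), u x ≤ u y := by
  set B := Metric.closedBall x₀ (3 * R)
  have hBm : MeasurableSet B := Metric.isClosed_closedBall.measurableSet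
  set v := B.indicator u
  have hv : Integrable v := (integrable_indicator_iff hBm).2 (hu B hRG (isCompact_closedBall _ _))
  have hv0 : ∀ᵐ x, 0 ≤ v x := by
    filter_upwards [(ae_restrict_iff' hBm).1 (ae_restrict_of_ae_restrict_of_subset hRG hu0)]
      with x hx
    exact Set.indicator_apply_nonneg hx
  have hsv : DistSuper B (fun _ => -c) v := by
    intro k hk hk0
    have hkG : IsTestIn G k := ⟨hk.smooth, hk.compact, hk.sub.trans hRG⟩
    have h := hs k hkG hk0
    rw [setIntegral_mul_eq_integral hkG.lap.sub, setIntegral_mul_eq_integral hkG.sub] at h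
    rw [setIntegral_mul_eq_integral hk.lap.sub, setIntegral_mul_eq_integral hk.sub]
    have e : ∀ l : Euc N → ℝ, tsupport l ⊆ B → ∀ z, v z * l z = u z * l z := by
      intro l hl z
      by_cases hz : z ∈ B
      · simp only [v, Set.indicator_of_mem hz]
      · rw [image_eq_zero_of_notMem_tsupport fun h => hz (hl h), mul_zero, mul_zero]
    simp_rw [mul_assoc] at h ⊢
    simp_rw [e k hk.sub, e _ hk.lap.sub]
    exact h
  set κ := ∫ z : Euc N, profD (‖z‖ ^ 2)
  have hκ : 0 < κ := integral_profD_pos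
  have hq : 0 < prof (1 / 4) := expNegInvGlue.pos_of_pos (by norm_num)
  -- The factor `κ⁻¹` comes from the limit of the means, the exponential from their monotonicity up
  -- to radius `R`, and `prof (1 / 4)` bounds the weight below because two points of the small ball
  -- are at distance at most `R / 2`.
  refine ⟨κ⁻¹ * (Real.exp (-(c * R ^ 2 / 4)) * ((R ^ N)⁻¹ * prof (1 / 4))), by positivity, ?_⟩
  have hsub : Metric.ball x₀ (R / 4) ⊆ B := Metric.ball_subset_closedBall.trans
    (Metric.closedBall_subset_closedBall (by linarith))
  rw [ae_restrict_iff' measurableSet_ball]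
  filter_upwards [ae_tendsto_wmean hv] with y hy hyB
  -- Room `2 * R` around `y` lets the mean be taken at radius `R`, strictly inside.
  have hyR : Metric.closedBall y (2 * R) ⊆ B := by
    refine Metric.closedBall_subset_closedBall' ?_
    rw [Metric.mem_ball] at hyB
    linarith
  -- Compare the mean at radius `R` with means at small radii `s`, then let `s` tend to zero.
  have h1 : Real.exp (-(c * R ^ 2 / 4)) * wmean v y R ≤ κ * v y := by
    refine ge_of_tendsto hy ?_
    filter_upwards [Ioo_mem_nhdsGT hR] with s hsR
    refine (wmean_mono hv hv0 hc hsv hyR hsR.1 hsR.2.le (by linarith)).trans ?_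
    have hw0 : 0 ≤ wmean v y s := by
      refine integral_nonneg_of_ae ?_
      filter_upwards [hv0] with z hz
      have := hsR.1
      exact mul_nonneg (mul_nonneg (by positivity) (profD_nonneg _)) hz
    refine mul_le_of_le_one_left hw0 (Real.exp_le_one_iff.2 ?_)
    have : 0 ≤ c * s ^ 2 / 4 := by positivity
    linarith
  have h2 : (R ^ N)⁻¹ * prof (1 / 4) * ∫ x in Metric.ball x₀ (R / 4), u x ≤ wmean v y R := by
    rw [← integral_const_mul, wmean, ← integral_indicator measurableSet_ball]
    have hi : IntegrableOn u (Metric.ball x₀ (R / 4)) :=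
      (hu B hRG (isCompact_closedBall _ _)).mono_set hsub
    refine integral_mono_ae ((integrable_indicator_iff measurableSet_ball).2 (hi.const_mul _)) ?_ ?_
    · simp_rw [mul_assoc]
      exact (integrable_profD_mul hv y R).const_mul _
    · filter_upwards [hv0] with z hz
      by_cases hzB : z ∈ Metric.ball x₀ (R / 4)
      · rw [Set.indicator_of_mem hzB]
        have hvz : v z = u z := by simp only [v, Set.indicator_of_mem (hsub hzB)]
        rw [hvz] at hz ⊢
        have hd : ‖z - y‖ ≤ R / 2 := by
          rw [← dist_eq_norm]
          rw [Metric.mem_ball] at hzB hyB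
          have := dist_triangle_right z y x₀
          linarith
        have hq4 : ‖z - y‖ ^ 2 / R ^ 2 ≤ 1 / 4 := by
          rw [div_le_iff₀ (by positivity)]
          calc ‖z - y‖ ^ 2 ≤ (R / 2) ^ 2 := by gcongr
            _ = _ := by ring
        have : prof (1 / 4) ≤ profD (‖z - y‖ ^ 2 / R ^ 2) :=
          (expNegInvGlue.monotone (by linarith)).trans (prof_le_profD (by positivity))
        gcongr
      · rw [Set.indicator_of_notMem hzB]
        exact mul_nonneg (mul_nonneg (by positivity) (profD_nonneg _)) hz
  have hvy : v y = u y := by simp only [v, Set.indicator_of_mem (hsub hyB)]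
  rw [← hvy]
  calc _ = κ⁻¹ * (Real.exp (-(c * R ^ 2 / 4)) *
        ((R ^ N)⁻¹ * prof (1 / 4) * ∫ x in Metric.ball x₀ (R / 4), u x)) := by ring
    _ ≤ κ⁻¹ * (Real.exp (-(c * R ^ 2 / 4)) * wmean v y R) := by gcongr
    _ ≤ κ⁻¹ * (κ * v y) := by gcongr
    _ = v y := by field_simp

/-- The strong minimum principle. -/
theorem ae_eq_zero_or_isPositiveOn {G : Set (Euc N)} (hG : IsOpen G) (hGc : IsPreconnected G)
    {u : Euc N → ℝ} (hu : ∀ K ⊆ G, IsCompact K → IntegrableOn u K)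
    (hu0 : ∀ᵐ x ∂volume.restrict G, 0 ≤ u x) {c : ℝ} (hc : 0 ≤ c)
    (hs : DistSuper G (fun _ => -c) u) :
    (∀ᵐ x ∂volume.restrict G, u x = 0) ∨ IsPositiveOn G u := by
  let Z : Set (Euc N) := {x | ∃ r > 0, ∀ᵐ z ∂volume.restrict (Metric.ball x r), u z = 0}
  let P : Set (Euc N) := {x | ∃ r > 0, ∃ b > 0, ∀ᵐ z ∂volume.restrict (Metric.ball x r), b ≤ u z}
  have hsm : ∀ x r (y : Euc N), y ∈ Metric.ball x r → ∃ r' > 0, Metric.ball y r' ⊆ Metric.ball x r :=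
    fun x r y hy => Metric.isOpen_iff.1 Metric.isOpen_ball y hy
  have hZ : IsOpen Z := by
    refine Metric.isOpen_iff.2 fun x ⟨r, hr, h⟩ => ⟨r, hr, fun y hy => ?_⟩
    obtain ⟨r', hr', hsub⟩ := hsm x r y hy
    exact ⟨r', hr', ae_restrict_of_ae_restrict_of_subset hsub h⟩
  have hP : IsOpen P := by
    refine Metric.isOpen_iff.2 fun x ⟨r, hr, b, hb, h⟩ => ⟨r, hr, fun y hy => ?_⟩
    obtain ⟨r', hr', hsub⟩ := hsm x r y hy
    exact ⟨r', hr', b, hb, ae_restrict_of_ae_restrict_of_subset hsub h⟩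
  -- The dichotomy at each point: either the integral of `u` over a small ball vanishes, and `u`
  -- vanishes almost everywhere there, or it is positive and the weak Harnack inequality bounds `u`
  -- below.
  have hcov : G ⊆ Z ∪ P := by
    intro x hx
    obtain ⟨R, hR, hRG⟩ := Metric.nhds_basis_closedBall.mem_iff.1 (hG.mem_nhds hx)
    have hR3 : Metric.closedBall x (3 * (R / 3)) ⊆ G := by
      rwa [show 3 * (R / 3) = R by ring]
    obtain ⟨b, hb, h⟩ := exists_ae_mul_integral_le hu hu0 hc hs (by positivity) hR3
    have hsub : Metric.ball x (R / 3 / 4) ⊆ Metric.closedBall x R :=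
      Metric.ball_subset_closedBall.trans (Metric.closedBall_subset_closedBall (by linarith))
    have h0 := ae_restrict_of_ae_restrict_of_subset (hsub.trans hRG) hu0
    have hi := (hu _ hRG (isCompact_closedBall _ _)).mono_set hsub
    rcases (integral_nonneg_of_ae h0).eq_or_lt with he | hlt
    · left
      exact ⟨_, by positivity, (integral_eq_zero_iff_of_nonneg_ae h0 hi).1 he.symm⟩
    · right
      exact ⟨_, by positivity, _, mul_pos hb hlt, h⟩
  -- Otherwise a ball, which has positive measure, would carry both `u = 0` and `u ≥ b > 0` almost
  -- everywhere.
  have hdisj : G ∩ (Z ∩ P) = ∅ := by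
    refine Set.eq_empty_of_forall_notMem fun x ⟨_, ⟨r, hr, h⟩, ⟨r', hr', b, hb, h'⟩⟩ => ?_
    have h1 : ∀ᵐ z ∂volume.restrict (Metric.ball x (min r r')), False := by
      filter_upwards [ae_restrict_of_ae_restrict_of_subset
        (Metric.ball_subset_ball (min_le_left r r')) h, ae_restrict_of_ae_restrict_of_subset
        (Metric.ball_subset_ball (min_le_right r r')) h'] with z h1 h2
      linarith
    have h2 := Metric.measure_ball_pos (volume : Measure (Euc N)) x (lt_min hr hr')
    rw [eventually_false_iff_eq_bot, ae_eq_bot, Measure.restrict_eq_zero] at h1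
    exact h2.ne' h1
  rcases isPreconnected_iff_subset_of_disjoint.1 hGc Z P hZ hP hcov hdisj with h | h
  · left
    rw [ae_restrict_iff' hG.measurableSet]
    have : (volume : Measure (Euc N)) {x | x ∈ G ∧ u x ≠ 0} = 0 := by
      refine measure_null_of_locally_null _ fun x hx => ?_
      obtain ⟨r, hr, hr0⟩ := h hx.1
      refine ⟨{x | x ∈ G ∧ u x ≠ 0} ∩ Metric.ball x r,
        inter_mem self_mem_nhdsWithin (mem_nhdsWithin_of_mem_nhds (Metric.ball_mem_nhds x hr)), ?_⟩
      rw [ae_restrict_iff' measurableSet_ball] at hr0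
      refine measure_mono_null (fun z hz => ?_) hr0
      simp only [Set.mem_ofPred_eq, Set.mem_compl_iff]
      exact fun h' => hz.1.2 (h' hz.2)
    refine measure_mono_null (fun z hz => ?_) this
    simpa using hz
  · right
    intro K hKG hK
    -- Local lower bounds become a bound on a compact set through a finite subcover and the smallest
    -- of its constants.
    choose! r hr b hb hrb using fun x (hx : x ∈ P) => hx
    obtain ⟨t, htK, hcover⟩ := hK.elim_nhds_subcover (fun x => Metric.ball x (r x))
      fun x hx => Metric.ball_mem_nhds x (hr x (h (hKG hx)))
    have hmem : ∀ x ∈ t, x ∈ P := fun x hx => h (hKG (htK x hx))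
    obtain ⟨c₀, hc₀, hle⟩ : ∃ c₀ > 0, ∀ x ∈ t, c₀ ≤ b x := by
      rcases t.eq_empty_or_nonempty with rfl | hne
      · exact ⟨1, one_pos, by simp⟩
      · obtain ⟨x, hx, hmin⟩ := t.exists_min_image b hne
        exact ⟨b x, hb x (hmem x hx), hmin⟩
    refine ⟨c₀, hc₀, ae_restrict_of_ae_restrict_of_subset hcover ?_⟩
    rw [ae_restrict_biUnion_finset_iff]
    intro x hx
    filter_upwards [hrb x (hmem x hx)] with z hz using (hle x hx).trans hz

end MinimumPrinciple
-- Polar coordinates on the space and on cones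
section Polar

variable {N : ℕ}

/-- The density `r^{N-1} dr` on the half-line. -/
def radMeas (N : ℕ) : Measure ℝ :=
  (volume.restrict (Set.Ioi 0)).withDensity fun r => ENNReal.ofReal (r ^ (N - 1))

/-- Polar coordinates. -/
def pol (p : Sph N × ℝ) : Euc N := p.2 • (p.1 : Euc N)

lemma continuous_pol : Continuous (pol (N := N)) := by
  unfold pol; fun_prop

lemma measurable_pol : Measurable (pol (N := N)) := continuous_pol.measurable

instance : SFinite (radMeas N) := by unfold radMeas; infer_instance

lemma measurable_ofReal_pow (n : ℕ) : Measurable fun r : ℝ => ENNReal.ofReal (r ^ n) :=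
  (measurable_id.pow_const n).ennreal_ofReal

lemma map_volumeIoiPow :
    MeasurePreserving (Subtype.val : Set.Ioi (0 : ℝ) → ℝ) (Measure.volumeIoiPow (N - 1))
      (radMeas N) := by
  refine ⟨measurable_subtype_coe, ?_⟩
  ext s hs
  rw [Measure.map_apply measurable_subtype_coe hs, Measure.volumeIoiPow, radMeas,
    withDensity_apply _ (measurable_subtype_coe hs), withDensity_apply _ hs,
    Measure.restrict_restrict hs]
  rw [setLIntegral_subtype measurableSet_Ioi _ fun a : ℝ => ENNReal.ofReal (a ^ (N - 1)),
    Subtype.image_preimage_coe, Set.inter_comm]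

/-- The polar homeomorphism reaches everything but the origin, a null set because the dimension is
positive. -/
lemma measurePreserving_pol (hN : 0 < N) :
    MeasurePreserving (pol (N := N)) ((surf N).prod (radMeas N)) volume := by
  have : Nonempty (Fin N) := ⟨⟨0, hN⟩⟩
  have : Nontrivial (Euc N) := inferInstance
  have h1 := (Measure.measurePreserving_homeomorphUnitSphereProd (volume : Measure (Euc N)))
  rw [finrank_euclideanSpace_fin] at h1
  have h2 := MeasurePreserving.symm (homeomorphUnitSphereProd (Euc N)).toMeasurableEquiv h1
  have h3 : MeasurePreserving (Subtype.val : ({0}ᶜ : Set (Euc N)) → Euc N)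
      ((volume : Measure (Euc N)).comap Subtype.val) volume := by
    refine ⟨measurable_subtype_coe, ?_⟩
    rw [map_comap_subtype_coe (measurableSet_singleton _).compl, restrict_compl_singleton]
  have h4 := h3.comp h2
  have h5 := (MeasurePreserving.id (surf N)).prod (map_volumeIoiPow (N := N))
  refine ⟨measurable_pol, ?_⟩
  rw [← h5.map_eq, Measure.map_map measurable_pol h5.measurable, ← h4.map_eq]
  rfl

lemma ae_radMeas_pos : ∀ᵐ r ∂radMeas N, 0 < r := by
  have : ∀ᵐ r ∂(volume.restrict (Set.Ioi (0 : ℝ))), 0 < r := ae_restrict_mem measurableSet_Ioi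
  exact (withDensity_absolutelyContinuous _ _).ae_le this

lemma norm_sph (θ : Sph N) : ‖(θ : Euc N)‖ = 1 := by simp

/-- The radius is recovered as the norm and the direction by cancelling it; `0 ≤ ρ` excludes
representations with a negative radius. -/
lemma pol_mem_cone {Ω : Set (Sph N)} {ρ : ℝ} (hρ : 0 ≤ ρ) {θ : Sph N} {r : ℝ} (hr : 0 < r) :
    r • (θ : Euc N) ∈ cone Ω ρ ↔ θ ∈ Ω ∧ ρ < r := by
  constructor
  · rintro ⟨r', hr', θ', hθ', h⟩
    have hr0 : 0 < r' := hρ.trans_lt hr'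
    have hn : r = r' := by
      have := congrArg norm h
      rwa [norm_smul, norm_smul, norm_sph, norm_sph, mul_one, mul_one, Real.norm_of_nonneg hr.le,
        Real.norm_of_nonneg hr0.le] at this
    subst hn
    have : (θ : Euc N) = θ' := smul_right_injective _ hr.ne' h
    rw [Subtype.ext this]
    exact ⟨hθ', hr'⟩
  · rintro ⟨hθ, h⟩
    exact ⟨r, h, θ, hθ, rfl⟩

lemma isOpen_cone {Ω : Set (Sph N)} (hΩ : IsOpen Ω) {ρ : ℝ} (hρ : 0 ≤ ρ) :
    IsOpen (cone Ω ρ) := by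
  have h := (isOpen_Ioi (a := ρ)).smul_sphere one_ne_zero (by simpa using hρ) hΩ
  convert! h using 1
  ext x
  simp only [cone, Set.mem_smul, Set.mem_ofPred_eq, Set.mem_Ioi, Set.mem_image]
  constructor
  · rintro ⟨r, hr, θ, hθ, rfl⟩
    exact ⟨r, hr, θ, ⟨θ, hθ, rfl⟩, rfl⟩
  · rintro ⟨r, hr, _, ⟨θ, hθ, rfl⟩, rfl⟩
    exact ⟨r, hr, θ, hθ, rfl⟩

lemma isPreconnected_cone {Ω : Set (Sph N)} (hΩ : IsPreconnected Ω) (ρ : ℝ) :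
    IsPreconnected (cone Ω ρ) := by
  have h := (hΩ.prod (isPreconnected_Ioi (a := ρ))).image (pol (N := N))
    continuous_pol.continuousOn
  convert! h using 1
  ext x
  simp only [cone, pol, Set.mem_ofPred_eq, Set.mem_image, Set.mem_prod, Prod.exists, Set.mem_Ioi]
  constructor
  · rintro ⟨r, hr, θ, hθ, rfl⟩
    exact ⟨θ, r, ⟨hθ, hr⟩, rfl⟩
  · rintro ⟨θ, r, ⟨hθ, hr⟩, rfl⟩
    exact ⟨r, hr, θ, hθ, rfl⟩

lemma norm_lt_of_mem_cone {Ω : Set (Sph N)} {ρ : ℝ} (hρ : 0 ≤ ρ) {x : Euc N}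
    (hx : x ∈ cone Ω ρ) : ρ < ‖x‖ := by
  obtain ⟨r, hr, θ, -, rfl⟩ := hx
  rwa [norm_smul, norm_sph, mul_one, Real.norm_of_nonneg (hρ.trans hr.le)]

/-- Polar coordinates on a cone. -/
lemma measurePreserving_pol_cone (hN : 0 < N) {Ω : Set (Sph N)} (hΩ : IsOpen Ω) {ρ : ℝ}
    (hρ : 0 ≤ ρ) :
    MeasurePreserving (pol (N := N)) (((surf N).restrict Ω).prod ((radMeas N).restrict (Set.Ioi ρ)))
      (volume.restrict (cone Ω ρ)) := by
  have h := (measurePreserving_pol hN).restrict_preimage (isOpen_cone hΩ hρ).measurableSet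
  -- The two sets agree only at positive radii, and `radMeas` is concentrated there.
  have he : (pol (N := N)) ⁻¹' cone Ω ρ =ᵐ[(surf N).prod (radMeas N)] Ω ×ˢ Set.Ioi ρ := by
    have hpos : ∀ᵐ p ∂(surf N).prod (radMeas N), 0 < p.2 :=
      Measure.quasiMeasurePreserving_snd.ae ae_radMeas_pos
    filter_upwards [hpos] with p hp
    exact propext (pol_mem_cone hρ hp)
  rw [Measure.restrict_congr_set he] at h
  rwa [Measure.prod_restrict]

lemma integral_radMeas (f : ℝ → ℝ) {ρ : ℝ} (hρ : 0 ≤ ρ) :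
    ∫ r in Set.Ioi ρ, f r ∂radMeas N = ∫ r in Set.Ioi ρ, r ^ (N - 1) * f r := by
  rw [radMeas, setIntegral_withDensity_eq_setIntegral_toReal_smul (measurable_ofReal_pow _)
    (Eventually.of_forall fun _ => ENNReal.ofReal_lt_top) _ measurableSet_Ioi,
    Measure.restrict_restrict measurableSet_Ioi, Set.inter_eq_left.2 (Set.Ioi_subset_Ioi hρ)]
  refine setIntegral_congr_fun measurableSet_Ioi fun r hr => ?_
  have : 0 ≤ r := hρ.trans (le_of_lt hr)
  rw [ENNReal.toReal_ofReal (by positivity), smul_eq_mul]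

lemma integrableOn_radMeas_iff {f : ℝ → ℝ} {ρ : ℝ} (hρ : 0 ≤ ρ) :
    IntegrableOn f (Set.Ioi ρ) (radMeas N) ↔
      IntegrableOn (fun r => r ^ (N - 1) * f r) (Set.Ioi ρ) := by
  rw [IntegrableOn, radMeas, restrict_withDensity measurableSet_Ioi,
    Measure.restrict_restrict measurableSet_Ioi, Set.inter_eq_left.2 (Set.Ioi_subset_Ioi hρ),
    integrable_withDensity_iff_integrable_smul' (measurable_ofReal_pow _)
      (Eventually.of_forall fun _ => ENNReal.ofReal_lt_top)]
  refine integrable_congr ?_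
  filter_upwards [ae_restrict_mem measurableSet_Ioi] with r hr
  have : 0 ≤ r := hρ.trans (le_of_lt hr)
  rw [ENNReal.toReal_ofReal (by positivity), smul_eq_mul]

end Polar

/-! ### Extensions constant along rays and the tangential gradient -/

section Radial

variable {N : ℕ}

lemma sph_smul_ne_zero (θ : Sph N) {r : ℝ} (hr : 0 < r) : r • (θ : Euc N) ≠ 0 := by
  intro h
  have := congrArg norm h
  rw [norm_smul, norm_sph, norm_zero, mul_one, norm_eq_zero] at this
  exact hr.ne' this

lemma sph_ne_zero (θ : Sph N) : (θ : Euc N) ≠ 0 := by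
  simpa using sph_smul_ne_zero θ one_pos

lemma radialExt_smul (ψ : Sph N → ℝ) (θ : Sph N) {r : ℝ} (hr : 0 < r) :
    radialExt ψ (r • (θ : Euc N)) = ψ θ := by
  rw [radialExt, dif_pos (sph_smul_ne_zero θ hr)]
  congr 1
  ext1
  simp only [norm_smul, norm_sph, mul_one, Real.norm_of_nonneg hr.le, smul_smul,
    inv_mul_cancel₀ hr.ne', one_smul]

lemma radialExt_sph (ψ : Sph N → ℝ) (θ : Sph N) : radialExt ψ (θ : Euc N) = ψ θ := by
  simpa using radialExt_smul ψ θ one_pos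

lemma exists_eq_smul {x : Euc N} (hx : x ≠ 0) : ∃ θ : Sph N, x = ‖x‖ • (θ : Euc N) :=
  ⟨⟨‖x‖⁻¹ • x, by simp [norm_smul, inv_mul_cancel₀ (norm_ne_zero_iff.2 hx)]⟩, by
    simp [smul_smul, mul_inv_cancel₀ (norm_ne_zero_iff.2 hx)]⟩

lemma radialExt_smul' (ψ : Sph N → ℝ) (x : Euc N) {t : ℝ} (ht : 0 < t) :
    radialExt ψ (t • x) = radialExt ψ x := by
  rcases eq_or_ne x 0 with rfl | hx
  · simp
  · obtain ⟨θ, hθ⟩ := exists_eq_smul hx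
    have hn : 0 < ‖x‖ := norm_pos_iff.2 hx
    rw [hθ, smul_smul, radialExt_smul _ _ (by positivity), radialExt_smul _ _ hn]

lemma measurable_radialExt {ψ : Sph N → ℝ} (hψ : Measurable ψ) : Measurable (radialExt ψ) := by
  refine measurable_of_measurable_on_compl_singleton 0 ?_
  have e : ({x : Euc N | x ≠ 0} : Set (Euc N)).domRestrict (radialExt ψ) =
      fun x : {x : Euc N | x ≠ 0} => ψ ⟨‖(x : Euc N)‖⁻¹ • (x : Euc N), by
        simp [norm_smul, inv_mul_cancel₀ (norm_ne_zero_iff.mpr x.2)]⟩ := by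
    ext x
    rw [Set.domRestrict_apply, radialExt, dif_pos (show (x : Euc N) ≠ 0 from x.2)]
  rw [e]
  refine hψ.comp (Measurable.subtype_mk ?_)
  exact (measurable_subtype_coe.norm.inv).smul measurable_subtype_coe

lemma conePotential_smul (V : Sph N → ℝ) (θ : Sph N) {r : ℝ} (hr : 0 < r) :
    conePotential V (r • (θ : Euc N)) = V θ / r ^ 2 := by
  rw [conePotential, radialExt_smul V θ hr, norm_smul, norm_sph, mul_one, Real.norm_of_nonneg hr.le]

variable {ψ : Sph N → ℝ}

lemma contDiffAt_radialExt (hψ : ContDiffOn ℝ ∞ (radialExt ψ) {0}ᶜ) {x : Euc N} (hx : x ≠ 0) :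
    ContDiffAt ℝ ∞ (radialExt ψ) x :=
  hψ.contDiffAt (isOpen_compl_singleton.mem_nhds hx)

lemma hasFDerivAt_radialExt (hψ : ContDiffOn ℝ ∞ (radialExt ψ) {0}ᶜ) {x : Euc N} (hx : x ≠ 0) :
    HasFDerivAt (radialExt ψ) (fderiv ℝ (radialExt ψ) x) x :=
  ((contDiffAt_radialExt hψ hx).differentiableAt (by simp)).hasFDerivAt

/-- The derivative of a function homogeneous of degree zero is homogeneous of degree `-1`. -/
lemma fderiv_radialExt_smul (hψ : ContDiffOn ℝ ∞ (radialExt ψ) {0}ᶜ) {x : Euc N} (hx : x ≠ 0)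
    {t : ℝ} (ht : 0 < t) :
    fderiv ℝ (radialExt ψ) (t • x) = t⁻¹ • fderiv ℝ (radialExt ψ) x := by
  have hx' : t • x ≠ 0 := smul_ne_zero ht.ne' hx
  have h1 := (hasFDerivAt_radialExt hψ hx').comp x ((hasFDerivAt_id x).const_smul t)
  have e : (radialExt ψ ∘ fun y : Euc N => t • id y) = radialExt ψ := by
    ext y
    exact radialExt_smul' ψ y ht
  have h2 : HasFDerivAt (radialExt ψ)
    ((fderiv ℝ (radialExt ψ) (t • x)).comp (t • ContinuousLinearMap.id ℝ (Euc N))) x := by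
    have h1' : HasFDerivAt (radialExt ψ ∘ fun y : Euc N => t • id y) _ x := h1
    rwa [e] at h1'
  rw [h2.fderiv]
  ext v
  simp [inv_mul_cancel_left₀ ht.ne']

/-- Euler's identity in degree zero. -/
lemma fderiv_radialExt_self (hψ : ContDiffOn ℝ ∞ (radialExt ψ) {0}ᶜ) {x : Euc N} (hx : x ≠ 0) :
    fderiv ℝ (radialExt ψ) x x = 0 := by
  have h1 : HasDerivAt (fun t : ℝ => t • x) x 1 := by
    simpa using (hasDerivAt_id (1 : ℝ)).smul_const x
  have h2 := (hasFDerivAt_radialExt hψ (x := (1 : ℝ) • x) (by simpa using hx)).comp_hasDerivAt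
    (1 : ℝ) h1
  have h3 : HasDerivAt (radialExt ψ ∘ fun t : ℝ => t • x) 0 1 := by
    refine (hasDerivAt_const (1 : ℝ) (radialExt ψ x)).congr_of_eventuallyEq ?_
    filter_upwards [lt_mem_nhds one_pos] with t ht using radialExt_smul' ψ x ht
  simpa using h2.unique h3

/-- Tangency of the spherical gradient: it removes the cross terms between radial and angular
derivatives. -/
lemma inner_sphGrad_self (hψ : ContDiffOn ℝ ∞ (radialExt ψ) {0}ᶜ) (θ : Sph N) :
    ⟪sphGrad ψ θ, (θ : Euc N)⟫_ℝ = 0 := by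
  rw [sphGrad, real_inner_comm, inner_gradient_right, fderiv_radialExt_self hψ (sph_ne_zero θ)]

lemma IsTestOn.continuous {Ω : Set (Sph N)} (hψ : IsTestOn Ω ψ) : Continuous ψ := by
  have : ψ = fun θ : Sph N => radialExt ψ (θ : Euc N) := by
    ext θ; rw [radialExt_sph]
  rw [this]
  exact hψ.1.continuousOn.comp_continuous continuous_subtype_val fun θ => sph_ne_zero θ

lemma IsTestOn.continuous_sphGrad {Ω : Set (Sph N)} (hψ : IsTestOn Ω ψ) :
    Continuous (sphGrad ψ) := by
  have h : ContinuousOn (gradient (radialExt ψ)) {0}ᶜ := by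
    unfold gradient
    exact (LinearIsometryEquiv.continuous _).comp_continuousOn
      (hψ.1.continuousOn_fderiv_of_isOpen isOpen_compl_singleton (by simp))
  exact h.comp_continuous continuous_subtype_val fun θ => sph_ne_zero θ

lemma sphGrad_eq_zero {θ : Sph N} (hθ : θ ∉ tsupport ψ) : sphGrad ψ θ = 0 := by
  have h : radialExt ψ =ᶠ[𝓝 (θ : Euc N)] fun _ => 0 := by
    have h1 : (tsupport ψ)ᶜ ∈ 𝓝 θ := (isClosed_tsupport ψ).isOpen_compl.mem_nhds hθ
    obtain ⟨ε, hε, hb⟩ := Metric.mem_nhds_iff.1 h1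
    have hc : ContinuousAt (fun x : Euc N => ‖x‖⁻¹ • x) (θ : Euc N) :=
      (continuousAt_id.norm.inv₀ (by simp)).smul continuousAt_id
    have hc' := hc.eventually (Metric.ball_mem_nhds _ hε)
    filter_upwards [hc', isOpen_compl_singleton.mem_nhds (sph_ne_zero θ)] with x hx hx0
    rw [radialExt, dif_pos (show x ≠ 0 from hx0)]
    refine image_eq_zero_of_notMem_tsupport (hb ?_)
    simpa [Metric.mem_ball, Subtype.dist_eq] using hx
  rw [sphGrad, gradient, h.fderiv_eq]
  simp

end Radial
-- Test functions on the sphere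
section SphereTest

variable {N : ℕ} {Ω : Set (Sph N)}

lemma IsTestOn.mono {ψ : Sph N → ℝ} {Ω' : Set (Sph N)} (hψ : IsTestOn Ω ψ) (h : Ω ⊆ Ω') :
    IsTestOn Ω' ψ := ⟨hψ.1, hψ.2.trans h⟩

lemma sphGrad_eq_of_hasFDerivAt {ψ : Sph N → ℝ} {θ : Sph N} {v : Euc N}
    (h : HasFDerivAt (radialExt ψ) (innerSL ℝ v) (θ : Euc N)) : sphGrad ψ θ = v := by
  rw [sphGrad, gradient, h.fderiv]
  exact (InnerProductSpace.toDual ℝ (Euc N)).symm_apply_apply v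

lemma fderiv_radialExt_eq (ψ : Sph N → ℝ) (θ : Sph N) :
    fderiv ℝ (radialExt ψ) (θ : Euc N) = innerSL ℝ (sphGrad ψ θ) := by
  ext v
  rw [innerSL_apply_apply, sphGrad, real_inner_comm, inner_gradient_right]

lemma hasFDerivAt_radialExt_sph {ψ : Sph N → ℝ} (hψ : IsTestOn Ω ψ) (θ : Sph N) :
    HasFDerivAt (radialExt ψ) (innerSL ℝ (sphGrad ψ θ)) (θ : Euc N) := by
  rw [← fderiv_radialExt_eq]
  exact hasFDerivAt_radialExt hψ.1 (sph_ne_zero θ)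

lemma radialExt_linear (ψ χ : Sph N → ℝ) (a b : ℝ) :
    radialExt (fun θ => a * ψ θ + b * χ θ) = fun x => a * radialExt ψ x + b * radialExt χ x := by
  ext x
  unfold radialExt
  split_ifs <;> simp

lemma IsTestOn.linear {ψ χ : Sph N → ℝ} (hψ : IsTestOn Ω ψ) (hχ : IsTestOn Ω χ) (a b : ℝ) :
    IsTestOn Ω (fun θ => a * ψ θ + b * χ θ) := by
  refine ⟨?_, ?_⟩
  · rw [radialExt_linear]
    exact (contDiffOn_const.mul hψ.1).add (contDiffOn_const.mul hχ.1)
  · refine (tsupport_add _ _).trans (Set.union_subset ?_ ?_)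
    · exact (tsupport_mul_subset_right).trans hψ.2
    · exact (tsupport_mul_subset_right).trans hχ.2

lemma IsTestOn.sphGrad_linear {ψ χ : Sph N → ℝ} (hψ : IsTestOn Ω ψ) (hχ : IsTestOn Ω χ) (a b : ℝ)
    (θ : Sph N) :
    sphGrad (fun θ => a * ψ θ + b * χ θ) θ = a • sphGrad ψ θ + b • sphGrad χ θ := by
  refine sphGrad_eq_of_hasFDerivAt ?_
  rw [radialExt_linear]
  refine (((hasFDerivAt_radialExt_sph hψ θ).const_mul a).add
    ((hasFDerivAt_radialExt_sph hχ θ).const_mul b)).congr_fderiv ?_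
  rw [map_add, map_smul, map_smul]

lemma radialExt_comp (ψ : Sph N → ℝ) {f : ℝ → ℝ} (hf0 : f 0 = 0) :
    radialExt (fun θ => f (ψ θ)) = fun x => f (radialExt ψ x) := by
  ext x
  unfold radialExt
  split_ifs <;> simp [hf0]

/-- The condition `f 0 = 0` prevents the support from growing. It is used with the smoothed absolute
value `sabs`. -/
lemma IsTestOn.comp {ψ : Sph N → ℝ} (hψ : IsTestOn Ω ψ) {f : ℝ → ℝ} (hf : ContDiff ℝ ∞ f)
    (hf0 : f 0 = 0) : IsTestOn Ω (fun θ => f (ψ θ)) := by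
  refine ⟨?_, (tsupport_comp_subset hf0 ψ).trans hψ.2⟩
  rw [radialExt_comp ψ hf0]
  exact hf.comp_contDiffOn hψ.1

lemma IsTestOn.sphGrad_comp {ψ : Sph N → ℝ} (hψ : IsTestOn Ω ψ) {f : ℝ → ℝ}
    (hf : ContDiff ℝ ∞ f) (hf0 : f 0 = 0) (θ : Sph N) :
    sphGrad (fun θ => f (ψ θ)) θ = deriv f (ψ θ) • sphGrad ψ θ := by
  refine sphGrad_eq_of_hasFDerivAt ?_
  rw [radialExt_comp ψ hf0]
  have h := ((hf.differentiable (by simp)) (radialExt ψ (θ : Euc N))).hasDerivAt.comp_hasFDerivAt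
    (θ : Euc N) (hasFDerivAt_radialExt_sph hψ θ)
  rw [radialExt_sph] at h
  refine h.congr_fderiv ?_
  rw [map_smul]

/-- The restriction of a smooth function to a sphere of positive radius. -/
lemma contDiffOn_radialExt_restrict {η : Euc N → ℝ} (hη : ContDiff ℝ ∞ η) (r : ℝ) :
    ContDiffOn ℝ ∞ (radialExt fun θ : Sph N => η (r • (θ : Euc N))) {0}ᶜ := by
  have h : ContDiffOn ℝ ∞ (fun x : Euc N => η (r • (‖x‖⁻¹ • x))) {0}ᶜ := by
    have hi : ContDiffOn ℝ ∞ (fun x : Euc N => ‖x‖⁻¹) {0}ᶜ := by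
      refine ContDiffOn.inv (fun x hx => (contDiffAt_norm ℝ hx).contDiffWithinAt) fun x hx => ?_
      simpa using hx
    have h0 : ContDiffOn ℝ ∞ (fun x : Euc N => r • (‖x‖⁻¹ • x)) {0}ᶜ :=
      by
      have h1 := (contDiffOn_const (c := r)).smul (hi.smul contDiffOn_id)
      exact h1
    exact hη.comp_contDiffOn h0
  refine h.congr fun x hx => ?_
  rw [radialExt, dif_pos (show x ≠ 0 from hx)]

/-- Differentiate along `θ + t v` with `v` tangent. Since `|θ + t v|² = 1 + t² |v|²`, projecting
back to the sphere has no first-order effect at `t = 0`. -/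
lemma sphGrad_restrict {η : Euc N → ℝ} (hη : ContDiff ℝ ∞ η) (r : ℝ) (θ : Sph N) (v : Euc N)
    (hv : ⟪v, (θ : Euc N)⟫_ℝ = 0) :
    ⟪v, sphGrad (fun θ : Sph N => η (r • (θ : Euc N))) θ⟫_ℝ =
      r * ⟪v, gradient η (r • (θ : Euc N))⟫_ℝ := by
  have hc := contDiffOn_radialExt_restrict hη r
  rw [sphGrad, inner_gradient_right, inner_gradient_right]
  have h1 := hasFDerivAt_radialExt hc (sph_ne_zero θ)
  have hg : HasDerivAt (fun t : ℝ => (θ : Euc N) + t • v) v 0 := by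
    simpa using ((hasDerivAt_id (0 : ℝ)).smul_const v).const_add (θ : Euc N)
  have h2 := (show HasFDerivAt (radialExt fun θ : Sph N => η (r • (θ : Euc N))) _
    ((θ : Euc N) + (0 : ℝ) • v) by simpa using h1).comp_hasDerivAt (0 : ℝ) hg
  have hns : ∀ t : ℝ, ‖(θ : Euc N) + t • v‖ ^ 2 = 1 + t ^ 2 * ‖v‖ ^ 2 := fun t => by
    rw [norm_add_sq_real, inner_smul_right, real_inner_comm, hv, norm_sph, norm_smul, mul_pow,
      Real.norm_eq_abs, sq_abs]
    ring
  have hne : ∀ t : ℝ, (θ : Euc N) + t • v ≠ 0 := fun t h0 => by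
    have := hns t
    rw [h0, norm_zero] at this
    nlinarith [sq_nonneg (t * ‖v‖)]
  have hn : HasDerivAt (fun t : ℝ => ‖(θ : Euc N) + t • v‖⁻¹) 0 0 := by
    have e : (fun t : ℝ => ‖(θ : Euc N) + t • v‖⁻¹) = fun t => (√(1 + t ^ 2 * ‖v‖ ^ 2))⁻¹ := by
      ext t
      rw [← hns t, Real.sqrt_sq (norm_nonneg _)]
    rw [e]
    have h3 : HasDerivAt (fun t : ℝ => 1 + t ^ 2 * ‖v‖ ^ 2) 0 0 := by
      simpa using ((hasDerivAt_pow 2 (0 : ℝ)).mul_const (‖v‖ ^ 2)).const_add 1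
    have h4 := (h3.sqrt (by simp)).inv (by simp)
    refine h4.congr_deriv ?_
    simp
  have h5 : HasDerivAt (fun t : ℝ => r • (‖(θ : Euc N) + t • v‖⁻¹ • ((θ : Euc N) + t • v)))
      (r • v) 0 := by
    refine (((hn.smul hg)).const_smul r).congr_deriv ?_
    simp
  have h6 := (show HasFDerivAt η (fderiv ℝ η (r • (θ : Euc N)))
    (r • (‖(θ : Euc N) + (0 : ℝ) • v‖⁻¹ • ((θ : Euc N) + (0 : ℝ) • v))) by
      simpa using ((hη.differentiable (by simp)) _).hasFDerivAt).comp_hasDerivAt (0 : ℝ) h5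
  have e2 : (radialExt fun θ : Sph N => η (r • (θ : Euc N))) ∘ (fun t : ℝ => (θ : Euc N) + t • v) =
      η ∘ fun t : ℝ => r • (‖(θ : Euc N) + t • v‖⁻¹ • ((θ : Euc N) + t • v)) := by
    ext t
    simp only [Function.comp]
    rw [radialExt, dif_pos (hne t)]
  rw [e2] at h2
  rw [h2.unique h6, map_smul, smul_eq_mul]

lemma exists_isTestOn_ne_zero (hΩ : IsOpen Ω) {θ₀ : Sph N} (hθ₀ : θ₀ ∈ Ω) :
    ∃ ψ, IsTestOn Ω ψ ∧ ψ θ₀ ≠ 0 := by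
  obtain ⟨ε, hε, hb⟩ := Metric.nhds_basis_closedBall.mem_iff.1 (hΩ.mem_nhds hθ₀)
  let η : ContDiffBump (θ₀ : Euc N) := ⟨ε / 2, ε, by positivity, by linarith⟩
  refine ⟨fun θ => η ((1 : ℝ) • (θ : Euc N)),
    ⟨contDiffOn_radialExt_restrict η.contDiff 1, ?_⟩, ?_⟩
  · refine Set.Subset.trans (closure_minimal (fun θ hθ => ?_) Metric.isClosed_closedBall) hb
    have : (θ : Euc N) ∈ Function.support η := by simpa using hθ
    rw [η.support_eq] at this
    exact Metric.ball_subset_closedBall this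
  · simp [η.one_of_mem_closedBall (Metric.mem_closedBall_self η.rIn_pos.le)]

/-- Slices of a test function on the cone are test functions on `Ω`; this lets the spherical
equation be applied at each fixed radius. -/
lemma isTestOn_restrict {ρ : ℝ} (hρ : 0 ≤ ρ) {η : Euc N → ℝ} (hη : IsTestIn (cone Ω ρ) η) {r : ℝ}
    (hr : 0 < r) : IsTestOn Ω (fun θ : Sph N => η (r • (θ : Euc N))) := by
  refine ⟨contDiffOn_radialExt_restrict hη.smooth r, ?_⟩
  have hc : IsClosed {θ : Sph N | r • (θ : Euc N) ∈ tsupport η} :=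
    (isClosed_tsupport η).preimage (by fun_prop)
  refine (closure_minimal (fun θ hθ => ?_) hc).trans fun θ hθ => ?_
  · exact subset_tsupport _ hθ
  · exact ((pol_mem_cone hρ hr).1 (hη.sub hθ)).1

lemma IsTestOn.memLp {ψ : Sph N → ℝ} (hψ : IsTestOn Ω ψ) (p : ℝ≥0∞) (S : Set (Sph N)) :
    MemLp ψ p ((surf N).restrict S) := by
  obtain ⟨C, hC⟩ := isCompact_univ.exists_bound_of_continuousOn hψ.continuous.continuousOn
  exact MemLp.of_bound hψ.continuous.aestronglyMeasurable C
    (Eventually.of_forall fun θ => hC θ (Set.mem_univ _))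

lemma IsTestOn.memLp_sphGrad {ψ : Sph N → ℝ} (hψ : IsTestOn Ω ψ) (p : ℝ≥0∞) (S : Set (Sph N)) :
    MemLp (sphGrad ψ) p ((surf N).restrict S) := by
  obtain ⟨C, hC⟩ := isCompact_univ.exists_bound_of_continuousOn hψ.continuous_sphGrad.continuousOn
  exact MemLp.of_bound hψ.continuous_sphGrad.aestronglyMeasurable C
    (Eventually.of_forall fun θ => hC θ (Set.mem_univ _))

end SphereTest
-- Rellich compactness on the sphere
section Rellich

variable {N : ℕ}

/-- The open annulus `a < |x| < b`. -/
def annulus (N : ℕ) (a b : ℝ) : Set (Euc N) := {x | ‖x‖ ∈ Set.Ioo a b}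

lemma isOpen_annulus (a b : ℝ) : IsOpen (annulus N a b) :=
  isOpen_Ioo.preimage continuous_norm

lemma lintegral_annulus (hN : 0 < N) {a b : ℝ} {G : Euc N → ℝ≥0∞} (hG : Measurable G) :
    ∫⁻ x in annulus N a b, G x =
      ∫⁻ p : Sph N × ℝ, (Set.Ioo a b).indicator (fun r => G (r • (p.1 : Euc N))) p.2
        ∂(surf N).prod (radMeas N) := by
  rw [← lintegral_indicator (isOpen_annulus a b).measurableSet,
    ← (measurePreserving_pol hN).lintegral_comp (hG.indicator (isOpen_annulus a b).measurableSet)]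
  refine lintegral_congr_ae ?_
  filter_upwards [Measure.quasiMeasurePreserving_snd.ae ae_radMeas_pos] with p hp
  have hn : ‖pol p‖ = p.2 := by rw [pol, norm_smul, norm_sph, mul_one, Real.norm_of_nonneg hp.le]
  have hiff : pol p ∈ annulus N a b ↔ p.2 ∈ Set.Ioo a b := by
    rw [annulus, Set.mem_ofPred_eq, hn]
  by_cases h : p.2 ∈ Set.Ioo a b
  · rw [Set.indicator_of_mem (hiff.2 h), Set.indicator_of_mem h]; rfl
  · rw [Set.indicator_of_notMem (fun h' => h (hiff.1 h')), Set.indicator_of_notMem h]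

lemma lintegral_prod_indicator {a b : ℝ} {g : Sph N → ℝ≥0∞} (hg : Measurable g) (K : ℝ≥0∞) :
    ∫⁻ p : Sph N × ℝ, g p.1 * (Set.Ioo a b).indicator (fun _ => K) p.2 ∂(surf N).prod (radMeas N) =
      (∫⁻ θ, g θ ∂surf N) * (K * radMeas N (Set.Ioo a b)) := by
  rw [lintegral_prod_mul hg.aemeasurable
    ((measurable_const.indicator measurableSet_Ioo).aemeasurable),
    lintegral_indicator_const measurableSet_Ioo]

/-- With its counterpart `le_lintegral_annulus`, this exchanges `L²` bounds between the sphere and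
an annulus, where translations and mollifiers are available. -/
lemma lintegral_annulus_le (hN : 0 < N) {a b : ℝ} {G : Euc N → ℝ≥0∞}
    (hG : Measurable G) {g : Sph N → ℝ≥0∞} (hg : Measurable g) {K : ℝ≥0∞}
    (h : ∀ (θ : Sph N) (r : ℝ), a < r → G (r • (θ : Euc N)) ≤ g θ * K) :
    ∫⁻ x in annulus N a b, G x ≤ (∫⁻ θ, g θ ∂surf N) * (K * radMeas N (Set.Ioo a b)) := by
  rw [lintegral_annulus hN hG, ← lintegral_prod_indicator hg]
  refine lintegral_mono fun p => ?_
  by_cases hp : p.2 ∈ Set.Ioo a b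
  · simp only [Set.indicator_of_mem hp]
    exact h _ _ hp.1
  · simp [Set.indicator_of_notMem hp]

lemma le_lintegral_annulus (hN : 0 < N) {a b : ℝ} {G : Euc N → ℝ≥0∞}
    (hG : Measurable G) {g : Sph N → ℝ≥0∞} (hg : Measurable g)
    (h : ∀ (θ : Sph N) (r : ℝ), a < r → g θ ≤ G (r • (θ : Euc N))) :
    (∫⁻ θ, g θ ∂surf N) * radMeas N (Set.Ioo a b) ≤ ∫⁻ x in annulus N a b, G x := by
  rw [lintegral_annulus hN hG]
  have := lintegral_prod_indicator (a := a) (b := b) hg 1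
  rw [one_mul] at this
  rw [← this]
  refine lintegral_mono fun p => ?_
  by_cases hp : p.2 ∈ Set.Ioo a b
  · simp only [Set.indicator_of_mem hp, mul_one]
    exact h _ _ hp.1
  · simp [Set.indicator_of_notMem hp]

lemma radMeas_Ioo_lt_top (a b : ℝ) : radMeas N (Set.Ioo a b) < ⊤ := by
  rw [radMeas, withDensity_apply _ measurableSet_Ioo, Measure.restrict_restrict measurableSet_Ioo]
  calc _ ≤ ∫⁻ r in Set.Ioo a b ∩ Set.Ioi 0, ENNReal.ofReal (b ^ (N - 1)) := by
        refine setLIntegral_mono measurable_const fun r hr => ?_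
        have h0 : 0 ≤ r := le_of_lt hr.2
        have h1 : r ≤ b := hr.1.2.le
        gcongr
    _ < ⊤ := by
        rw [setLIntegral_const]
        refine ENNReal.mul_lt_top ENNReal.ofReal_lt_top ?_
        exact (measure_mono Set.inter_subset_left).trans_lt measure_Ioo_lt_top

/-- The density `r ^ (N - 1)` is at least one on this interval, so returning from the annulus to the
sphere costs no constant. -/
lemma one_le_radMeas_Ioo : 1 ≤ radMeas N (Set.Ioo 1 2) := by
  rw [radMeas, withDensity_apply _ measurableSet_Ioo, Measure.restrict_restrict measurableSet_Ioo]
  have hsub : Set.Ioo (1 : ℝ) 2 ∩ Set.Ioi 0 = Set.Ioo 1 2 :=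
    Set.inter_eq_left.2 fun r hr => zero_lt_one.trans hr.1
  rw [hsub]
  calc (1 : ℝ≥0∞) = ∫⁻ r in Set.Ioo (1 : ℝ) 2, 1 := by
        rw [setLIntegral_const, Real.volume_Ioo]; norm_num
    _ ≤ _ := by
        refine setLIntegral_mono (measurable_ofReal_pow _) fun r hr => ?_
        rw [ENNReal.one_le_ofReal]
        exact one_le_pow₀ hr.1.le

/-- Write the difference as an integral of the derivative along the segment, apply Jensen in the
parameter, and use Tonelli and translation invariance. -/
lemma lintegral_translate_sub_sq_le {U : Euc N → ℝ} {A B : Set (Euc N)}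
    (hB : IsOpen B) (hU : ContDiffOn ℝ 1 U B) {y : Euc N}
    (hy : ∀ x ∈ A, ∀ t ∈ Set.Icc (0 : ℝ) 1, x - t • y ∈ B) (hA : MeasurableSet A) :
    ∫⁻ x in A, ‖U (x - y) - U x‖ₑ ^ 2 ≤ ‖y‖ₑ ^ 2 * ∫⁻ x in B, ‖fderiv ℝ U x‖ₑ ^ 2 := by
  have hfm : Measurable (fderiv ℝ U) := measurable_fderiv ℝ U
  set ν := (volume : Measure ℝ).restrict (Set.Ioc 0 1)
  have hν : IsProbabilityMeasure ν := ⟨by simp [ν]⟩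
  have hpt : ∀ x ∈ A, ‖U (x - y) - U x‖ₑ ^ 2 ≤ ∫⁻ t, (‖fderiv ℝ U (x - t • y)‖ₑ * ‖y‖ₑ) ^ 2 ∂ν := by
    intro x hx
    have hline : ContinuousOn (fun t : ℝ => fderiv ℝ U (x - t • y)) (Set.uIcc 0 1) := by
      refine (hU.continuousOn_fderiv_of_isOpen hB le_rfl).comp (by fun_prop) fun t ht => ?_
      rw [Set.uIcc_of_le zero_le_one] at ht
      exact hy x hx t ht
    have hd : ∀ t ∈ Set.uIcc (0 : ℝ) 1, HasDerivAt (fun t : ℝ => U (x - t • y))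
        (fderiv ℝ U (x - t • y) (-y)) t := by
      intro t ht
      rw [Set.uIcc_of_le zero_le_one] at ht
      have h1 : HasFDerivAt U (fderiv ℝ U (x - t • y)) (x - t • y) :=
        ((hU.contDiffAt (hB.mem_nhds (hy x hx t ht))).differentiableAt (by simp)).hasFDerivAt
      have h2 : HasDerivAt (fun t : ℝ => x - t • y) (-y) t := by
        simpa using ((hasDerivAt_id t).smul_const y).const_sub x
      exact h1.comp_hasDerivAt t h2
    have hint := intervalIntegral.integral_eq_sub_of_hasDerivAt hd
      (hline.clm_apply continuousOn_const).intervalIntegrable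
    simp only [one_smul, zero_smul, sub_zero] at hint
    rw [← hint, intervalIntegral.integral_of_le zero_le_one]
    calc _ ≤ (∫⁻ t, ‖fderiv ℝ U (x - t • y) (-y)‖ₑ ∂ν) ^ 2 := by
          gcongr
          exact enorm_integral_le_lintegral_enorm _
      _ ≤ (∫⁻ t, ‖fderiv ℝ U (x - t • y)‖ₑ * ‖y‖ₑ ∂ν) ^ 2 := by
          gcongr with t
          rw [← enorm_neg y]
          exact ContinuousLinearMap.le_opENorm _ _
      _ ≤ _ := by
          refine sq_lintegral_le ν ?_
          exact ((hfm.comp (by fun_prop)).enorm.mul_const _).aemeasurable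
  calc ∫⁻ x in A, ‖U (x - y) - U x‖ₑ ^ 2
      ≤ ∫⁻ x in A, ∫⁻ t, (‖fderiv ℝ U (x - t • y)‖ₑ * ‖y‖ₑ) ^ 2 ∂ν :=
        setLIntegral_mono' hA hpt
    _ = ∫⁻ t, (∫⁻ x in A, (‖fderiv ℝ U (x - t • y)‖ₑ * ‖y‖ₑ) ^ 2) ∂ν := by
        refine lintegral_lintegral_swap ?_
        refine Measurable.aemeasurable ?_
        exact ((hfm.comp (show Measurable fun p : Euc N × ℝ => p.1 - p.2 • y by
          fun_prop)).enorm.mul_const _).pow_const 2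
    _ ≤ ∫⁻ _, (‖y‖ₑ ^ 2 * ∫⁻ x in B, ‖fderiv ℝ U x‖ₑ ^ 2) ∂ν := by
        refine lintegral_mono_ae ?_
        filter_upwards [ae_restrict_mem measurableSet_Ioc] with t ht
        simp_rw [mul_pow]
        rw [lintegral_mul_const' _ _ (ENNReal.pow_ne_top enorm_ne_top), mul_comm]
        refine mul_le_mul_right ?_ _
        have hmp := measurePreserving_sub_right (volume : Measure (Euc N)) (t • y)
        have h1 := (hmp.restrict_preimage hB.measurableSet).lintegral_comp
          (hfm.enorm.pow_const 2)
        rw [← h1]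
        refine lintegral_mono_set fun x hx => hy x hx t ⟨ht.1.le, ht.2⟩
    _ = _ := by simp

lemma enorm_sub_sq_le (a b : ℝ) : ‖a - b‖ₑ ^ 2 ≤ 2 * (‖a‖ₑ ^ 2 + ‖b‖ₑ ^ 2) := by
  have h : ‖a - b‖ₑ ≤ ‖a‖ₑ + ‖b‖ₑ := enorm_sub_le
  have h2 := ENNReal.rpow_add_le_mul_rpow_add_rpow ‖a‖ₑ ‖b‖ₑ (p := 2) (by norm_num)
  norm_num at h2
  exact (pow_le_pow_left₀ zero_le h 2).trans h2

variable {ψ : Sph N → ℝ}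

lemma exists_bound_radialExt (hψ : IsTestOn Set.univ ψ) : ∃ C, ∀ x, |radialExt ψ x| ≤ C := by
  obtain ⟨C, hC⟩ := isCompact_univ.exists_bound_of_continuousOn hψ.continuous.continuousOn
  refine ⟨max C 0, fun x => ?_⟩
  unfold radialExt
  split_ifs
  · exact (hC _ (Set.mem_univ _)).trans (le_max_left _ _)
  · simp

lemma locallyIntegrable_radialExt (hψ : IsTestOn Set.univ ψ) : LocallyIntegrable (radialExt ψ) := by
  obtain ⟨C, hC⟩ := exists_bound_radialExt hψ
  exact (locallyIntegrable_const C).mono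
    (measurable_radialExt hψ.continuous.measurable).aestronglyMeasurable
    (Eventually.of_forall fun x => (hC x).trans (le_abs_self C))

lemma lintegral_radialExt_sq_le (hN : 0 < N) (hψ : Measurable ψ) {a b : ℝ} (ha : 0 ≤ a) :
    ∫⁻ x in annulus N a b, ‖radialExt ψ x‖ₑ ^ 2 ≤
      (∫⁻ θ, ‖ψ θ‖ₑ ^ 2 ∂surf N) * (1 * radMeas N (Set.Ioo a b)) := by
  refine lintegral_annulus_le hN ((measurable_radialExt hψ).enorm.pow_const 2)
    (hψ.enorm.pow_const 2) fun θ r hr => ?_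
  rw [radialExt_smul ψ θ (ha.trans_lt hr), mul_one]

lemma lintegral_fderiv_radialExt_sq_le (hN : 0 < N) (hψ : IsTestOn Set.univ ψ) {a b : ℝ}
    (ha : 0 < a) :
    ∫⁻ x in annulus N a b, ‖fderiv ℝ (radialExt ψ) x‖ₑ ^ 2 ≤
      (∫⁻ θ, ‖sphGrad ψ θ‖ₑ ^ 2 ∂surf N) *
        (ENNReal.ofReal (a⁻¹ ^ 2) * radMeas N (Set.Ioo a b)) := by
  refine lintegral_annulus_le hN ((measurable_fderiv ℝ _).enorm.pow_const 2)
    (hψ.continuous_sphGrad.measurable.enorm.pow_const 2) fun θ r hr => ?_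
  have hr0 : 0 < r := ha.trans hr
  rw [fderiv_radialExt_smul hψ.1 (sph_ne_zero θ) hr0, fderiv_radialExt_eq, enorm_smul, mul_pow,
    mul_comm, Real.enorm_of_nonneg (by positivity), ← ENNReal.ofReal_pow (by positivity)]
  have : ‖innerSL ℝ (sphGrad ψ θ)‖ₑ = ‖sphGrad ψ θ‖ₑ := by
    rw [← ofReal_norm, ← ofReal_norm, innerSL_apply_norm]
  rw [this]
  gcongr

/-- A bounded sequence in `L²` has a subsequence that converges weakly. -/
lemma exists_weakly_convergent_subseq {α : Type*} [MeasurableSpace α]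
    [MeasurableSpace.CountablyGenerated α] {μ : Measure α} [SFinite μ]
    (f : ℕ → Lp ℝ 2 μ) {R : ℝ} (hf : ∀ n, ‖f n‖ ≤ R) :
    ∃ σ : ℕ → ℕ, StrictMono σ ∧ ∀ h : Lp ℝ 2 μ, ∃ l : ℝ,
      Tendsto (fun n => ⟪f (σ n), h⟫_ℝ) atTop (𝓝 l) := by
  have : Fact ((2 : ℝ≥0∞) ≠ ⊤) := ⟨by norm_num⟩
  have hsep : TopologicalSpace.SeparableSpace (Lp ℝ 2 μ) := inferInstance
  let x : ℕ → WeakDual ℝ (Lp ℝ 2 μ) := fun n => StrongDual.toWeakDual (innerSL ℝ (f n))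
  have hx : ∀ n, x n ∈ WeakDual.toStrongDual ⁻¹' Metric.closedBall (0 : StrongDual ℝ (Lp ℝ 2 μ)) R := by
    intro n
    rw [Set.mem_preimage, mem_closedBall_zero_iff]
    change ‖innerSL ℝ (f n)‖ ≤ R
    rw [innerSL_apply_norm]
    exact hf n
  -- Sequential Banach–Alaoglu, with the functions viewed as functionals on a separable space.
  obtain ⟨a, -, σ, hσ, hlim⟩ := WeakDual.isSeqCompact_closedBall ℝ (Lp ℝ 2 μ) 0 R hx
  exact ⟨σ, hσ, fun h => ⟨a h, ((WeakDual.eval_continuous h).tendsto a).comp hlim⟩⟩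

lemma annulus_measure_lt_top (a b : ℝ) : volume (annulus N a b) < ⊤ :=
  (measure_mono fun x hx => by
    rw [mem_closedBall_zero_iff]; exact hx.2.le).trans_lt
      (measure_closedBall_lt_top (x := (0 : Euc N)) (r := b))

lemma eLpNorm_two_le {α F : Type*} [MeasurableSpace α] [NormedAddCommGroup F] {μ : Measure α}
    {f : α → F} {C : ℝ≥0∞} (h : ∫⁻ x, ‖f x‖ₑ ^ 2 ∂μ ≤ C) :
    eLpNorm f 2 μ ≤ C ^ (1 / 2 : ℝ) := by
  rw [eLpNorm_eq_lintegral_rpow_enorm_toReal (by norm_num) (by norm_num)]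
  simp only [ENNReal.toReal_ofNat, ENNReal.rpow_ofNat]
  gcongr

/-- Rellich's theorem on the sphere, for sequences of smooth functions. -/
theorem exists_L2_cauchy_subseq (hN : 0 < N) {ψ : ℕ → Sph N → ℝ}
    (hψ : ∀ n, IsTestOn Set.univ (ψ n)) {C : ℝ≥0∞} (hC : C ≠ ⊤)
    (h1 : ∀ n, ∫⁻ θ, ‖ψ n θ‖ₑ ^ 2 ∂surf N ≤ C) (h2 : ∀ n, ∫⁻ θ, ‖sphGrad (ψ n) θ‖ₑ ^ 2 ∂surf N ≤ C) :
    ∃ σ : ℕ → ℕ, StrictMono σ ∧ ∀ ε : ℝ≥0∞, 0 < ε → ∃ n₀, ∀ m ≥ n₀, ∀ n ≥ n₀,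
      ∫⁻ θ, ‖ψ (σ m) θ - ψ (σ n) θ‖ₑ ^ 2 ∂surf N ≤ ε := by
  -- Estimates are made on `A`, using the extensions on `B`; translates of `A` by vectors of length
  -- at most `1 / 2` stay in `B`.
  set A := annulus N 1 2
  set B := annulus N (1 / 2) 3
  have hAm : MeasurableSet A := (isOpen_annulus 1 2).measurableSet
  have hBo : IsOpen B := isOpen_annulus _ _
  have hBm : MeasurableSet B := hBo.measurableSet
  have hBfin : IsFiniteMeasure (volume.restrict B) := ⟨by simpa using annulus_measure_lt_top _ _⟩
  have hAfin : IsFiniteMeasure (volume.restrict A) := ⟨by simpa using annulus_measure_lt_top _ _⟩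
  let U : ℕ → Euc N → ℝ := fun n => radialExt (ψ n)
  have hUm : ∀ n, Measurable (U n) := fun n => measurable_radialExt (hψ n).continuous.measurable
  have hUl : ∀ n, LocallyIntegrable (U n) := fun n => locallyIntegrable_radialExt (hψ n)
  have hUs : ∀ n, ContDiffOn ℝ 1 (U n) B := fun n =>
    ((hψ n).1.of_le (by simp)).mono fun x hx => by
      have : (1 / 2 : ℝ) < ‖x‖ := hx.1
      intro h0
      rw [Set.mem_singleton_iff.1 h0, norm_zero] at this
      norm_num at this
  set C₂ := C * (1 * radMeas N (Set.Ioo (1 / 2) 3))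
  have hC₂ : C₂ ≠ ⊤ := ENNReal.mul_ne_top hC
    (ENNReal.mul_ne_top ENNReal.one_ne_top (radMeas_Ioo_lt_top _ _).ne)
  set C₃ := C * (ENNReal.ofReal ((1 / 2 : ℝ)⁻¹ ^ 2) * radMeas N (Set.Ioo (1 / 2) 3))
  have hC₃ : C₃ ≠ ⊤ := ENNReal.mul_ne_top hC
    (ENNReal.mul_ne_top ENNReal.ofReal_ne_top (radMeas_Ioo_lt_top _ _).ne)
  have hU2 : ∀ n, ∫⁻ x in B, ‖U n x‖ₑ ^ 2 ≤ C₂ := fun n =>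
    (lintegral_radialExt_sq_le hN (hψ n).continuous.measurable (by norm_num)).trans
      (mul_le_mul_left (h1 n) _)
  have hU3 : ∀ n, ∫⁻ x in B, ‖fderiv ℝ (U n) x‖ₑ ^ 2 ≤ C₃ := fun n =>
    (lintegral_fderiv_radialExt_sq_le hN (hψ n) (by norm_num)).trans (mul_le_mul_left (h2 n) _)
  have hUL : ∀ n, MemLp (U n) 2 (volume.restrict B) := fun n => by
    obtain ⟨c, hc⟩ := exists_bound_radialExt (hψ n)
    exact MemLp.of_bound (hUm n).aestronglyMeasurable c (Eventually.of_forall hc)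
  let f : ℕ → Lp ℝ 2 (volume.restrict B) := fun n => (hUL n).toLp (U n)
  have hf : ∀ n, ‖f n‖ ≤ (C₂ ^ (1 / 2 : ℝ)).toReal := fun n => by
    rw [Lp.norm_toLp]
    exact ENNReal.toReal_mono (ENNReal.rpow_ne_top_of_nonneg (by norm_num) hC₂)
      (eLpNorm_two_le (hU2 n))
  obtain ⟨σ, hσ, hweak⟩ := exists_weakly_convergent_subseq f hf
  let k : ℕ → Euc N → ℝ := molSeq N (1 / 2) (by norm_num)
  have hk : ∀ j, IsMollifier (k j) ((1 / 2) / (j + 1)) := isMollifier_molSeq N (1 / 2) (by norm_num)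
  have hkr : ∀ j : ℕ, (1 / 2 : ℝ) / (j + 1) ≤ 1 / 2 := radius_le (by norm_num)
  -- translates of the annulus
  have hmem : ∀ x ∈ A, ∀ y : Euc N, ‖y‖ ≤ 1 / 2 → x - y ∈ B := by
    intro x hx y hy
    have h3 := norm_sub_norm_le x y
    have h4 := norm_sub_le x y
    have hx1 : 1 < ‖x‖ := hx.1
    have hx2 : ‖x‖ < 2 := hx.2
    exact ⟨by linarith, by linarith⟩
  -- The uniform gradient bound makes the mollification error small uniformly in `n`.
  have hmol : ∀ j n, ∫⁻ x in A, ‖mol (k j) (U n) x - U n x‖ₑ ^ 2 ≤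
      ENNReal.ofReal ((1 / 2) / (j + 1)) ^ 2 * C₃ := by
    intro j n
    refine (hk j).lintegral_mol_sub_sq_le_of_translate (hUl n) fun y hy => ?_
    refine (lintegral_translate_sub_sq_le hBo (hUs n) (fun x hx t ht => ?_) hAm).trans ?_
    · refine hmem x hx _ ?_
      rw [norm_smul, Real.norm_of_nonneg ht.1]
      nlinarith [ht.2, norm_nonneg y, hy.trans (hkr j)]
    · gcongr
      · rw [← ofReal_norm]
        exact ENNReal.ofReal_le_ofReal hy
      · exact hU3 n
  -- mollifications as inner products
  have hkb : ∀ j, ∃ b, 0 ≤ b ∧ ∀ x, ‖k j x‖ ≤ b := fun j => by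
    obtain ⟨b, hb⟩ := (hk j).compact.exists_bound_of_continuous (hk j).smooth.continuous
    exact ⟨max b 0, le_max_right _ _, fun x => (hb x).trans (le_max_left _ _)⟩
  have hkL : ∀ j x, MemLp (fun z => k j (x - z)) 2 (volume.restrict B) := fun j x => by
    obtain ⟨b, -, hb⟩ := hkb j
    exact MemLp.of_bound ((hk j).smooth.continuous.comp (by fun_prop)).aestronglyMeasurable b
      (Eventually.of_forall fun z => hb _)
  have hinner : ∀ j n, ∀ x ∈ A, mol (k j) (U n) x = ⟪f n, (hkL j x).toLp _⟫_ℝ := by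
    intro j n x hx
    rw [mol_apply, L2.inner_def]
    have e : ∫ z, k j (x - z) • U n z = ∫ z in B, k j (x - z) • U n z := by
      rw [setIntegral_eq_integral_of_forall_compl_eq_zero]
      intro z hz
      have : k j (x - z) = 0 := by
        refine (hk j).eq_zero ?_
        by_contra! h
        refine hz ?_
        have := hmem x hx (x - z) (h.trans (hkr j))
        rwa [sub_sub_cancel] at this
      rw [this, zero_smul]
    rw [e]
    refine integral_congr_ae ?_
    filter_upwards [(hUL n).coeFn_toLp, (hkL j x).coeFn_toLp] with z hz1 hz2
    rw [hz1, hz2]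
    simp [RCLike.inner_apply]
  have hWb : ∀ j, ∃ b : ℝ, ∀ n, ∀ x ∈ A, ‖mol (k j) (U n) x‖ ≤ b := by
    intro j
    obtain ⟨b, hb0, hb⟩ := hkb j
    refine ⟨(C₂ ^ (1 / 2 : ℝ)).toReal *
      (measureUnivNNReal (volume.restrict B) ^ (2 : ℝ≥0∞).toReal⁻¹ * b), fun n x hx => ?_⟩
    rw [hinner j n x hx]
    refine (norm_inner_le_norm _ _).trans ?_
    have h4 : ‖(hkL j x).toLp _‖ ≤ measureUnivNNReal (volume.restrict B) ^ (2 : ℝ≥0∞).toReal⁻¹ * b := by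
      refine Lp.norm_le_of_ae_bound hb0 ?_
      filter_upwards [(hkL j x).coeFn_toLp] with z hz
      rw [hz]
      exact hb _
    exact mul_le_mul (hf n) h4 (norm_nonneg _) ENNReal.toReal_nonneg
  have hlim : ∀ j x, ∃ l, x ∈ A → Tendsto (fun n => mol (k j) (U (σ n)) x) atTop (𝓝 l) := by
    intro j x
    by_cases hx : x ∈ A
    · obtain ⟨l, hl⟩ := hweak ((hkL j x).toLp _)
      exact ⟨l, fun _ => hl.congr fun n => (hinner j (σ n) x hx).symm⟩
    · exact ⟨0, fun h => absurd h hx⟩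
  choose W hW using hlim
  have hmc : ∀ j n, Continuous (mol (k j) (U n)) := fun j n =>
    (contDiff_mol (hk j).smooth (hk j).compact (hUl n)).continuous
  have hWm : ∀ j, AEMeasurable (W j) (volume.restrict A) := fun j =>
    aemeasurable_of_tendsto_metrizable_ae atTop (fun n => (hmc j (σ n)).measurable.aemeasurable)
      ((ae_restrict_mem hAm).mono fun x hx => hW j x hx)
  -- For a fixed kernel, weak convergence gives pointwise convergence of the mollifications on `A`.
  -- They are uniformly bounded there, so the convergence is strong by dominated convergence.
  have hconv : ∀ j, Tendsto (fun n => ∫⁻ x in A, ‖mol (k j) (U (σ n)) x - W j x‖ₑ ^ 2) atTop (𝓝 0) := by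
    intro j
    obtain ⟨b, hb⟩ := hWb j
    have h5 : Tendsto (fun n => ∫⁻ x in A, ‖mol (k j) (U (σ n)) x - W j x‖ₑ ^ 2) atTop
        (𝓝 (∫⁻ x in A, 0)) := by
      refine tendsto_lintegral_of_dominated_convergence' (fun _ => ENNReal.ofReal (b + b) ^ 2)
        (fun n => (((hmc j (σ n)).measurable.aemeasurable.sub (hWm j)).enorm.pow_const 2))
        (fun n => ?_) ?_ ?_
      · filter_upwards [ae_restrict_mem hAm] with x hx
        have h6 : ‖W j x‖ ≤ b := le_of_tendsto' (hW j x hx).norm fun n => hb (σ n) x hx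
        gcongr
        rw [← ofReal_norm]
        exact ENNReal.ofReal_le_ofReal ((norm_sub_le _ _).trans (add_le_add (hb (σ n) x hx) h6))
      · rw [lintegral_const]
        exact ENNReal.mul_ne_top (ENNReal.pow_ne_top ENNReal.ofReal_ne_top) (measure_ne_top _ _)
      · filter_upwards [ae_restrict_mem hAm] with x hx
        have h7 := ((hW j x hx).sub_const (W j x)).enorm
        rw [sub_self, enorm_zero] at h7
        simpa using ENNReal.Tendsto.pow (n := 2) h7
    simpa using h5
  refine ⟨σ, hσ, fun ε hε => ?_⟩
  have hrad : Tendsto (fun j : ℕ => ENNReal.ofReal ((1 / 2) / (j + 1)) ^ 2 * C₃) atTop (𝓝 0) := by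
    have h8 := ENNReal.tendsto_ofReal (tendsto_radius (1 / 2))
    rw [ENNReal.ofReal_zero] at h8
    have h9 := ENNReal.Tendsto.mul_const (ENNReal.Tendsto.pow (n := 2) h8) (Or.inr hC₃)
    simpa using h9
  -- The difference splits into four terms, each of size `ε / 16` in square, and squaring a sum of
  -- four costs a factor `4`.
  have hε16 : 0 < ε / 16 := ENNReal.div_pos hε.ne' (by norm_num)
  obtain ⟨j, hj⟩ := (ENNReal.tendsto_nhds_zero.1 hrad (ε / 16) hε16).exists
  obtain ⟨n₀, hn₀⟩ := eventually_atTop.1 (ENNReal.tendsto_nhds_zero.1 (hconv j) (ε / 16) hε16)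
  refine ⟨n₀, fun m hm n hn => ?_⟩
  have hfin : ∫⁻ x in A, ‖U (σ m) x - U (σ n) x‖ₑ ^ 2 ≤ ε := by
    have hpt : ∀ x, ‖U (σ m) x - U (σ n) x‖ₑ ^ 2 ≤
        4 * ((‖mol (k j) (U (σ m)) x - W j x‖ₑ ^ 2 + ‖mol (k j) (U (σ n)) x - W j x‖ₑ ^ 2) +
          (‖mol (k j) (U (σ m)) x - U (σ m) x‖ₑ ^ 2 +
            ‖mol (k j) (U (σ n)) x - U (σ n) x‖ₑ ^ 2)) := by
      intro x
      set a := mol (k j) (U (σ m)) x - W j x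
      set b := mol (k j) (U (σ n)) x - W j x
      set c := mol (k j) (U (σ m)) x - U (σ m) x
      set d := mol (k j) (U (σ n)) x - U (σ n) x
      have e : U (σ m) x - U (σ n) x = (a - b) - (c - d) := by simp only [a, b, c, d]; ring
      rw [e]
      calc ‖(a - b) - (c - d)‖ₑ ^ 2 ≤ 2 * (‖a - b‖ₑ ^ 2 + ‖c - d‖ₑ ^ 2) := enorm_sub_sq_le _ _
        _ ≤ 2 * (2 * (‖a‖ₑ ^ 2 + ‖b‖ₑ ^ 2) + 2 * (‖c‖ₑ ^ 2 + ‖d‖ₑ ^ 2)) := by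
          gcongr <;> exact enorm_sub_sq_le _ _
        _ = _ := by ring
    have hm1 : ∀ i, AEMeasurable (fun x => ‖mol (k j) (U i) x - W j x‖ₑ ^ 2) (volume.restrict A) :=
      fun i => ((hmc j i).measurable.aemeasurable.sub (hWm j)).enorm.pow_const 2
    have hm2 : ∀ i, AEMeasurable (fun x => ‖mol (k j) (U i) x - U i x‖ₑ ^ 2) (volume.restrict A) :=
      fun i => ((hmc j i).measurable.sub (hUm i)).aemeasurable.enorm.pow_const 2
    have hm3 : AEMeasurable (fun x => ‖mol (k j) (U (σ m)) x - W j x‖ₑ ^ 2 +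
        ‖mol (k j) (U (σ n)) x - W j x‖ₑ ^ 2) (volume.restrict A) := (hm1 _).add (hm1 _)
    calc _ ≤ ∫⁻ x in A, 4 * ((‖mol (k j) (U (σ m)) x - W j x‖ₑ ^ 2 +
            ‖mol (k j) (U (σ n)) x - W j x‖ₑ ^ 2) +
          (‖mol (k j) (U (σ m)) x - U (σ m) x‖ₑ ^ 2 +
            ‖mol (k j) (U (σ n)) x - U (σ n) x‖ₑ ^ 2)) := lintegral_mono hpt
      _ ≤ 4 * ((ε / 16 + ε / 16) + (ε / 16 + ε / 16)) := by
          rw [lintegral_const_mul' _ _ (by norm_num), lintegral_add_left' hm3,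
            lintegral_add_left' (hm1 _), lintegral_add_left' (hm2 _)]
          gcongr
          · exact hn₀ m hm
          · exact hn₀ n hn
          · exact (hmol j _).trans hj
          · exact (hmol j _).trans hj
      _ = ε := by
          rw [show (4 : ℝ≥0∞) * ((ε / 16 + ε / 16) + (ε / 16 + ε / 16)) = 16 * (ε / 16) by ring]
          exact ENNReal.mul_div_cancel (by norm_num) (by norm_num)
  have hlow := le_lintegral_annulus hN (a := 1) (b := 2)
    (G := fun x => ‖U (σ m) x - U (σ n) x‖ₑ ^ 2)
    (g := fun θ => ‖ψ (σ m) θ - ψ (σ n) θ‖ₑ ^ 2)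
    ((((hUm _).sub (hUm _)).enorm).pow_const 2)
    ((((hψ _).continuous.sub (hψ _).continuous).measurable.enorm).pow_const 2) fun θ r hr => by
      simp only [U]
      rw [radialExt_smul _ _ (zero_lt_one.trans hr), radialExt_smul _ _ (zero_lt_one.trans hr)]
  calc _ = (∫⁻ θ, ‖ψ (σ m) θ - ψ (σ n) θ‖ₑ ^ 2 ∂surf N) * 1 := (mul_one _).symm
    _ ≤ _ := mul_le_mul_right one_le_radMeas_Ioo _
    _ ≤ _ := hlow
    _ ≤ ε := hfin

end Rellich
-- Pairings and bounded multipliers in `L²`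
section L2

variable {α F : Type*} [MeasurableSpace α] {μ : Measure α} [NormedAddCommGroup F]
  [InnerProductSpace ℝ F]

lemma inner_toLp {f g : α → F} (hf : MemLp f 2 μ) (hg : MemLp g 2 μ) :
    ⟪hf.toLp f, hg.toLp g⟫_ℝ = ∫ x, ⟪f x, g x⟫_ℝ ∂μ := by
  rw [L2.inner_def]
  refine integral_congr_ae ?_
  filter_upwards [hf.coeFn_toLp, hg.coeFn_toLp] with x h1 h2
  rw [h1, h2]

lemma inner_toLp_real {f g : α → ℝ} (hf : MemLp f 2 μ) (hg : MemLp g 2 μ) :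
    ⟪hf.toLp f, hg.toLp g⟫_ℝ = ∫ x, f x * g x ∂μ := by
  rw [inner_toLp]
  simp [RCLike.inner_apply, mul_comm]

lemma norm_toLp_sq {f : α → F} (hf : MemLp f 2 μ) :
    ‖hf.toLp f‖ ^ 2 = ∫ x, ‖f x‖ ^ 2 ∂μ := by
  rw [← real_inner_self_eq_norm_sq, inner_toLp]
  simp

lemma integrable_inner_of_memLp {f g : α → F} (hf : MemLp f 2 μ) (hg : MemLp g 2 μ) :
    Integrable (fun x => ⟪f x, g x⟫_ℝ) μ := by
  refine (L2.integrable_inner (𝕜 := ℝ) (hf.toLp f) (hg.toLp g)).congr ?_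
  filter_upwards [hf.coeFn_toLp, hg.coeFn_toLp] with x h1 h2
  rw [h1, h2]

lemma memLp_bdd_mul {V f : α → ℝ} (hV : Measurable V) {M : ℝ} (hM : ∀ x, |V x| ≤ M)
    (hf : MemLp f 2 μ) : MemLp (fun x => V x * f x) 2 μ := by
  refine hf.of_le_mul (c := M) (hV.aestronglyMeasurable.mul hf.1) (Eventually.of_forall fun x => ?_)
  rw [norm_mul]
  exact mul_le_mul_of_nonneg_right (hM x) (norm_nonneg _)

lemma tendsto_toLp_iff {E : Type*} [NormedAddCommGroup E] {f : ℕ → α → E}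
    (hf : ∀ n, MemLp (f n) 2 μ) {g : α → E} (hg : MemLp g 2 μ) :
    Tendsto (fun n => (hf n).toLp (f n)) atTop (𝓝 (hg.toLp g)) ↔
      Tendsto (fun n => eLpNorm (fun x => f n x - g x) 2 μ) atTop (𝓝 0) :=
  Lp.tendsto_Lp_iff_tendsto_eLpNorm'' f hf g hg

lemma tendsto_bdd_mul {V : α → ℝ} (hV : Measurable V) {M : ℝ} (hM : ∀ x, |V x| ≤ M)
    {f : ℕ → α → ℝ} (hf : ∀ n, MemLp (f n) 2 μ) {g : α → ℝ} (hg : MemLp g 2 μ)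
    (h : Tendsto (fun n => (hf n).toLp (f n)) atTop (𝓝 (hg.toLp g))) :
    Tendsto (fun n => (memLp_bdd_mul hV hM (hf n)).toLp _) atTop
      (𝓝 ((memLp_bdd_mul hV hM hg).toLp _)) := by
  rw [tendsto_toLp_iff] at h ⊢
  have h2 := ENNReal.Tendsto.const_mul (a := ENNReal.ofReal M) h (Or.inr ENNReal.ofReal_ne_top)
  rw [mul_zero] at h2
  refine tendsto_of_tendsto_of_tendsto_of_le_of_le tendsto_const_nhds h2 (fun n => zero_le) fun n => ?_
  refine eLpNorm_le_mul_eLpNorm_of_ae_le_mul (Eventually.of_forall fun x => ?_) 2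
  rw [← mul_sub, norm_mul]
  exact mul_le_mul_of_nonneg_right (hM x) (norm_nonneg _)

end L2

/-! ### The Rayleigh quotient on test functions -/

section GroundState

variable {N : ℕ} {Ω : Set (Sph N)} {V : Sph N → ℝ} {M : ℝ}

/-- The quadratic form of `-Δ - V`. -/
def energy (Ω : Set (Sph N)) (V ψ : Sph N → ℝ) : ℝ :=
  (∫ θ in Ω, ‖sphGrad ψ θ‖ ^ 2 ∂surf N) - ∫ θ in Ω, V θ * ψ θ * ψ θ ∂surf N

/-- The squared `L²` norm. -/
def mass (Ω : Set (Sph N)) (ψ : Sph N → ℝ) : ℝ := ∫ θ in Ω, ψ θ * ψ θ ∂surf N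

/-- The bilinear form of `-Δ - V`. -/
def bilin (Ω : Set (Sph N)) (V ψ χ : Sph N → ℝ) : ℝ :=
  (∫ θ in Ω, ⟪sphGrad ψ θ, sphGrad χ θ⟫_ℝ ∂surf N) - ∫ θ in Ω, V θ * ψ θ * χ θ ∂surf N

lemma mass_nonneg (ψ : Sph N → ℝ) : 0 ≤ mass Ω ψ :=
  integral_nonneg fun _ => mul_self_nonneg _

lemma integrable_test_mul {ψ χ : Sph N → ℝ} (hψ : IsTestOn Ω ψ) (hχ : IsTestOn Ω χ) :
    Integrable (fun θ => ψ θ * χ θ) ((surf N).restrict Ω) :=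
  (hψ.memLp 2 Ω).integrable_mul (hχ.memLp 2 Ω)

lemma integrable_bdd_test_mul (hV : Measurable V) (hM : ∀ θ, |V θ| ≤ M) {ψ χ : Sph N → ℝ}
    (hψ : IsTestOn Ω ψ) (hχ : IsTestOn Ω χ) :
    Integrable (fun θ => V θ * ψ θ * χ θ) ((surf N).restrict Ω) :=
  (memLp_bdd_mul hV hM (hψ.memLp 2 Ω)).integrable_mul (hχ.memLp 2 Ω)

lemma integrable_test_grad {ψ χ : Sph N → ℝ} (hψ : IsTestOn Ω ψ) (hχ : IsTestOn Ω χ) :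
    Integrable (fun θ => ⟪sphGrad ψ θ, sphGrad χ θ⟫_ℝ) ((surf N).restrict Ω) :=
  integrable_inner_of_memLp (hψ.memLp_sphGrad 2 Ω) (hχ.memLp_sphGrad 2 Ω)

lemma bilin_self (ψ : Sph N → ℝ) : bilin Ω V ψ ψ = energy Ω V ψ := by
  simp [bilin, energy]

lemma energy_linear (hV : Measurable V) (hM : ∀ θ, |V θ| ≤ M) {ψ χ : Sph N → ℝ}
    (hψ : IsTestOn Ω ψ) (hχ : IsTestOn Ω χ) (a b : ℝ) :
    energy Ω V (fun θ => a * ψ θ + b * χ θ) =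
      a ^ 2 * energy Ω V ψ + 2 * a * b * bilin Ω V ψ χ + b ^ 2 * energy Ω V χ := by
  rw [← bilin_self, ← bilin_self, ← bilin_self]
  simp only [bilin]
  have i1 := integrable_test_grad hψ hψ
  have i2 := integrable_test_grad hψ hχ
  have i3 := integrable_test_grad hχ hχ
  have j1 := integrable_bdd_test_mul hV hM hψ hψ
  have j2 := integrable_bdd_test_mul hV hM hψ hχ
  have j3 := integrable_bdd_test_mul hV hM hχ hχ
  have e1 : ∫ θ in Ω, ⟪sphGrad (fun θ => a * ψ θ + b * χ θ) θ,
      sphGrad (fun θ => a * ψ θ + b * χ θ) θ⟫_ℝ ∂surf N =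
      a ^ 2 * (∫ θ in Ω, ⟪sphGrad ψ θ, sphGrad ψ θ⟫_ℝ ∂surf N) +
      2 * a * b * (∫ θ in Ω, ⟪sphGrad ψ θ, sphGrad χ θ⟫_ℝ ∂surf N) +
      b ^ 2 * ∫ θ in Ω, ⟪sphGrad χ θ, sphGrad χ θ⟫_ℝ ∂surf N := by
    rw [← integral_const_mul, ← integral_const_mul, ← integral_const_mul,
      ← integral_add (i1.const_mul _) (i2.const_mul _),
      ← integral_add (by exact (i1.const_mul _).add (i2.const_mul _)) (i3.const_mul _)]
    refine integral_congr_ae (Eventually.of_forall fun θ => ?_)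
    dsimp only
    rw [hψ.sphGrad_linear hχ]
    simp only [inner_add_left, inner_add_right, real_inner_smul_left, real_inner_smul_right]
    rw [real_inner_comm (sphGrad ψ θ) (sphGrad χ θ)]
    ring
  have e2 : ∫ θ in Ω, V θ * (a * ψ θ + b * χ θ) * (a * ψ θ + b * χ θ) ∂surf N =
      a ^ 2 * (∫ θ in Ω, V θ * ψ θ * ψ θ ∂surf N) +
      2 * a * b * (∫ θ in Ω, V θ * ψ θ * χ θ ∂surf N) +
      b ^ 2 * ∫ θ in Ω, V θ * χ θ * χ θ ∂surf N := by
    rw [← integral_const_mul, ← integral_const_mul, ← integral_const_mul,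
      ← integral_add (j1.const_mul _) (j2.const_mul _),
      ← integral_add (by exact (j1.const_mul _).add (j2.const_mul _)) (j3.const_mul _)]
    refine integral_congr_ae (Eventually.of_forall fun θ => ?_)
    dsimp only
    ring
  rw [e1, e2]
  ring

lemma abs_integral_mul_sq_le (hV : Measurable V) (hM : ∀ θ, |V θ| ≤ M) {ψ : Sph N → ℝ}
    (hψ : IsTestOn Ω ψ) : |∫ θ in Ω, V θ * ψ θ * ψ θ ∂surf N| ≤ M * mass Ω ψ := by
  rw [mass, ← integral_const_mul, ← Real.norm_eq_abs]
  refine (norm_integral_le_integral_norm _).trans ?_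
  refine integral_mono (integrable_bdd_test_mul hV hM hψ hψ).norm
    ((integrable_test_mul hψ hψ).const_mul M) fun θ => ?_
  dsimp only
  rw [norm_mul, norm_mul, Real.norm_eq_abs, Real.norm_eq_abs, mul_assoc, abs_mul_abs_self]
  exact mul_le_mul_of_nonneg_right (hM θ) (mul_self_nonneg _)

/-- Bounds the Rayleigh quotient below, so that the infimum in `bottom` is a genuine one. -/
lemma neg_mul_mass_le_energy (hV : Measurable V) (hM : ∀ θ, |V θ| ≤ M) {ψ : Sph N → ℝ}
    (hψ : IsTestOn Ω ψ) : -M * mass Ω ψ ≤ energy Ω V ψ := by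
  have h1 := (abs_le.1 (abs_integral_mul_sq_le hV hM hψ)).2
  have h2 : 0 ≤ ∫ θ in Ω, ‖sphGrad ψ θ‖ ^ 2 ∂surf N := integral_nonneg fun θ => sq_nonneg _
  rw [energy]
  linarith

lemma mass_smul (ψ : Sph N → ℝ) (a : ℝ) : mass Ω (fun θ => a * ψ θ) = a ^ 2 * mass Ω ψ := by
  rw [mass, mass, ← integral_const_mul]
  congr 1
  ext θ
  ring

lemma IsTestOn.smul {ψ : Sph N → ℝ} (hψ : IsTestOn Ω ψ) (a : ℝ) :
    IsTestOn Ω (fun θ => a * ψ θ) := by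
  simpa using hψ.linear hψ a 0

lemma energy_smul (hV : Measurable V) (hM : ∀ θ, |V θ| ≤ M) {ψ : Sph N → ℝ} (hψ : IsTestOn Ω ψ)
    (a : ℝ) : energy Ω V (fun θ => a * ψ θ) = a ^ 2 * energy Ω V ψ := by
  have := energy_linear hV hM hψ hψ a 0
  simpa using this

/-- The bottom of the spectrum, as the infimum of the Rayleigh quotient over test functions. -/
def bottom (Ω : Set (Sph N)) (V : Sph N → ℝ) : ℝ :=
  sInf {l | ∃ ψ, IsTestOn Ω ψ ∧ mass Ω ψ = 1 ∧ energy Ω V ψ = l}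

/-- The infimum in `bottom` is over a nonempty set; for an empty one `sInf` would return the default
value `0`. -/
lemma exists_test_mass_one (hΩ : IsOpen Ω) (hne : Ω.Nonempty) :
    ∃ ψ, IsTestOn Ω ψ ∧ mass Ω ψ = 1 := by
  obtain ⟨θ₀, hθ₀⟩ := hne
  obtain ⟨ψ, hψ, hψ0⟩ := exists_isTestOn_ne_zero hΩ hθ₀
  have hpos : 0 < mass Ω ψ := by
    have hs : mass Ω ψ = ∫ θ, ψ θ * ψ θ ∂surf N := by
      refine setIntegral_eq_integral_of_forall_compl_eq_zero fun θ hθ => ?_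
      rw [image_eq_zero_of_notMem_tsupport fun h => hθ (hψ.2 h), mul_zero]
    rw [hs]
    refine (hψ.continuous.mul hψ.continuous).integral_pos_of_hasCompactSupport_nonneg_nonzero
      (HasCompactSupport.of_compactSpace _) (fun θ => mul_self_nonneg _) (x := θ₀) ?_
    exact mul_ne_zero hψ0 hψ0
  refine ⟨fun θ => (√(mass Ω ψ))⁻¹ * ψ θ, hψ.smul _, ?_⟩
  rw [mass_smul, inv_pow, Real.sq_sqrt hpos.le, inv_mul_cancel₀ hpos.ne']

lemma bottom_mul_mass_le (hV : Measurable V) (hM : ∀ θ, |V θ| ≤ M) {ψ : Sph N → ℝ}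
    (hψ : IsTestOn Ω ψ) : bottom Ω V * mass Ω ψ ≤ energy Ω V ψ := by
  -- A function of zero mass cannot be normalised; there the lower bound by `-M * mass` already
  -- gives the claim.
  rcases (mass_nonneg (Ω := Ω) ψ).eq_or_lt with h | hpos
  · have := neg_mul_mass_le_energy hV hM hψ
    rw [← h, mul_zero] at this ⊢
    exact this
  · have h1 : bottom Ω V ≤ energy Ω V (fun θ => (√(mass Ω ψ))⁻¹ * ψ θ) := by
      refine csInf_le ⟨-M, ?_⟩ ⟨_, hψ.smul _, ?_, rfl⟩
      · rintro l ⟨χ, hχ, hχ1, rfl⟩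
        have := neg_mul_mass_le_energy hV hM hχ
        rwa [hχ1, mul_one] at this
      · rw [mass_smul, inv_pow, Real.sq_sqrt hpos.le, inv_mul_cancel₀ hpos.ne']
    rw [energy_smul hV hM hψ, inv_pow, Real.sq_sqrt hpos.le] at h1
    calc bottom Ω V * mass Ω ψ ≤ (mass Ω ψ)⁻¹ * energy Ω V ψ * mass Ω ψ := by gcongr
      _ = _ := by field_simp

lemma exists_energy_lt (hΩ : IsOpen Ω) (hne : Ω.Nonempty) {ε : ℝ} (hε : 0 < ε) :
    ∃ ψ, IsTestOn Ω ψ ∧ mass Ω ψ = 1 ∧ energy Ω V ψ < bottom Ω V + ε := by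
  obtain ⟨ψ₀, h0, h1⟩ := exists_test_mass_one hΩ hne
  obtain ⟨l, ⟨ψ, hψ, hm, rfl⟩, hl⟩ := Real.lt_sInf_add_pos
    (s := {l | ∃ ψ, IsTestOn Ω ψ ∧ mass Ω ψ = 1 ∧ energy Ω V ψ = l}) ⟨_, ψ₀, h0, h1, rfl⟩ hε
  exact ⟨ψ, hψ, hm, hl⟩

/-- A smooth approximation of the absolute value. -/
def sabs (ε t : ℝ) : ℝ := √(t ^ 2 + ε ^ 2) - ε

lemma contDiff_sabs {ε : ℝ} (hε : 0 < ε) : ContDiff ℝ ∞ (sabs ε) := by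
  unfold sabs
  refine ContDiff.sub (ContDiff.sqrt (by fun_prop) fun t => by positivity) contDiff_const

lemma sabs_zero {ε : ℝ} (hε : 0 < ε) : sabs ε 0 = 0 := by
  simp [sabs, Real.sqrt_sq hε.le]

lemma sabs_nonneg (ε t : ℝ) : 0 ≤ sabs ε t := by
  have : ε ≤ √(t ^ 2 + ε ^ 2) := Real.le_sqrt_of_sq_le (by linarith [sq_nonneg t])
  rw [sabs]; linarith

lemma sabs_le {ε : ℝ} (hε : 0 < ε) (t : ℝ) : sabs ε t ≤ |t| := by
  have : √(t ^ 2 + ε ^ 2) ≤ |t| + ε := by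
    rw [Real.sqrt_le_left (by positivity)]
    nlinarith [abs_nonneg t, sq_abs t]
  rw [sabs]; linarith

lemma abs_deriv_sabs_le {ε : ℝ} (hε : 0 < ε) (t : ℝ) : |deriv (sabs ε) t| ≤ 1 := by
  have hp : 0 < t ^ 2 + ε ^ 2 := by positivity
  have h : HasDerivAt (sabs ε) (2 * t / (2 * √(t ^ 2 + ε ^ 2))) t := by
    have h1 : HasDerivAt (fun t : ℝ => t ^ 2 + ε ^ 2) (2 * t) t := by
      simpa using (hasDerivAt_pow 2 t).add_const (ε ^ 2)
    exact (h1.sqrt hp.ne').sub_const ε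
  rw [h.deriv, mul_div_mul_left _ _ two_ne_zero, abs_div, abs_of_pos (Real.sqrt_pos.2 hp),
    div_le_one (Real.sqrt_pos.2 hp)]
  exact Real.le_sqrt_of_sq_le (by rw [sq_abs]; nlinarith)

lemma tendsto_sabs (t : ℝ) : Tendsto (fun n : ℕ => sabs (1 / ((n : ℝ) + 1)) t) atTop (𝓝 |t|) := by
  have h1 : Tendsto (fun n : ℕ => (1 : ℝ) / ((n : ℝ) + 1)) atTop (𝓝 0) := tendsto_radius 1
  have hc : Continuous fun ε : ℝ => sabs ε t := by unfold sabs; fun_prop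
  have h : sabs 0 t = |t| := by simp [sabs, Real.sqrt_sq_eq_abs]
  rw [← h]
  exact (hc.tendsto 0).comp h1

/-- Replace a near-minimiser `ψ` by `sabs ε ψ`. The gradient does not grow because `sabs` is
1-Lipschitz, while mass and potential term converge as `ε → 0`. The mass is left unnormalised: a
lower bound of `1 / 2` is enough to keep the limit nonzero. -/
lemma exists_nonneg_energy_lt (hΩ : IsOpen Ω) (hne : Ω.Nonempty) (hV : Measurable V)
    (hM : ∀ θ, |V θ| ≤ M) {ε : ℝ} (hε : 0 < ε) :
    ∃ ψ, IsTestOn Ω ψ ∧ (∀ θ, 0 ≤ ψ θ) ∧ 1 / 2 ≤ mass Ω ψ ∧ mass Ω ψ ≤ 1 ∧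
      energy Ω V ψ - bottom Ω V * mass Ω ψ < ε := by
  obtain ⟨ψ, hψ, hm, hE⟩ := exists_energy_lt (V := V) hΩ hne hε
  have hp : ∀ n : ℕ, 0 < (1 : ℝ) / ((n : ℝ) + 1) := fun n => by positivity
  let f : ℕ → Sph N → ℝ := fun n θ => sabs (1 / ((n : ℝ) + 1)) (ψ θ)
  have hf : ∀ n, IsTestOn Ω (f n) := fun n => hψ.comp (contDiff_sabs (hp n)) (sabs_zero (hp n))
  have hf0 : ∀ n θ, 0 ≤ f n θ := fun n θ => sabs_nonneg _ _
  have hfle : ∀ n θ, f n θ * f n θ ≤ ψ θ * ψ θ := fun n θ => by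
    rw [← abs_mul_abs_self (ψ θ)]
    have := sabs_le (hp n) (ψ θ)
    exact mul_self_le_mul_self (hf0 n θ) this
  have hlim : ∀ θ, Tendsto (fun n => f n θ * f n θ) atTop (𝓝 (ψ θ * ψ θ)) := fun θ => by
    rw [← abs_mul_abs_self (ψ θ)]
    exact (tendsto_sabs _).mul (tendsto_sabs _)
  have hmass : Tendsto (fun n => mass Ω (f n)) atTop (𝓝 (mass Ω ψ)) := by
    refine tendsto_integral_of_dominated_convergence (fun θ => ψ θ * ψ θ)
      (fun n => (integrable_test_mul (hf n) (hf n)).aestronglyMeasurable) (integrable_test_mul hψ hψ)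
      (fun n => Eventually.of_forall fun θ => ?_) (Eventually.of_forall hlim)
    rw [Real.norm_of_nonneg (mul_self_nonneg _)]
    exact hfle n θ
  have hpot : Tendsto (fun n => ∫ θ in Ω, V θ * f n θ * f n θ ∂surf N) atTop
      (𝓝 (∫ θ in Ω, V θ * ψ θ * ψ θ ∂surf N)) := by
    refine tendsto_integral_of_dominated_convergence (fun θ => M * (ψ θ * ψ θ))
      (fun n => (integrable_bdd_test_mul hV hM (hf n) (hf n)).aestronglyMeasurable)
      ((integrable_test_mul hψ hψ).const_mul M)
      (fun n => Eventually.of_forall fun θ => ?_) (Eventually.of_forall fun θ => ?_)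
    · rw [mul_assoc, norm_mul, Real.norm_of_nonneg (mul_self_nonneg (f n θ))]
      exact mul_le_mul (hM θ) (hfle n θ) (mul_self_nonneg _) ((abs_nonneg _).trans (hM θ))
    · simp_rw [mul_assoc]
      exact (hlim θ).const_mul _
  have hgrad : ∀ n, ∫ θ in Ω, ‖sphGrad (f n) θ‖ ^ 2 ∂surf N ≤ ∫ θ in Ω, ‖sphGrad ψ θ‖ ^ 2 ∂surf N := by
    intro n
    refine integral_mono (by simpa using integrable_test_grad (hf n) (hf n))
      (by simpa using integrable_test_grad hψ hψ) fun θ => ?_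
    simp only [f]
    rw [hψ.sphGrad_comp (contDiff_sabs (hp n)) (sabs_zero (hp n)), norm_smul, mul_pow]
    have h1 := abs_deriv_sabs_le (hp n) (ψ θ)
    have h2 : ‖deriv (sabs (1 / ((n : ℝ) + 1))) (ψ θ)‖ ^ 2 ≤ 1 := by
      rw [Real.norm_eq_abs]; exact pow_le_one₀ (abs_nonneg _) h1
    exact mul_le_of_le_one_left (sq_nonneg _) h2
  have hup : Tendsto (fun n => (∫ θ in Ω, ‖sphGrad ψ θ‖ ^ 2 ∂surf N) -
      (∫ θ in Ω, V θ * f n θ * f n θ ∂surf N) - bottom Ω V * mass Ω (f n)) atTop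
      (𝓝 (energy Ω V ψ - bottom Ω V * mass Ω ψ)) :=
    (tendsto_const_nhds.sub hpot).sub (hmass.const_mul _)
  rw [hm] at hup hmass
  obtain ⟨n, h1, h2⟩ := ((hup.eventually_lt_const (u := ε) (by linarith)).and
    (hmass.eventually_const_lt (u := 1 / 2) (by norm_num))).exists
  refine ⟨f n, hf n, hf0 n, h2.le, ?_, ?_⟩
  · rw [← hm]
    exact integral_mono (integrable_test_mul (hf n) (hf n)) (integrable_test_mul hψ hψ) (hfle n)
  · have := hgrad n
    rw [energy]
    linarith

/-- Cauchy–Schwarz for a nonnegative form, from the discriminant of `t ↦ energy (ψ + t χ)`. -/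
lemma bilin_sq_le (hV : Measurable V) (hM : ∀ θ, |V θ| ≤ M) {ψ χ : Sph N → ℝ}
    (hψ : IsTestOn Ω ψ) (hχ : IsTestOn Ω χ) (h0 : ∀ ξ, IsTestOn Ω ξ → 0 ≤ energy Ω V ξ) :
    bilin Ω V ψ χ ^ 2 ≤ energy Ω V ψ * energy Ω V χ := by
  have h := discrim_le_zero (a := energy Ω V χ) (b := 2 * bilin Ω V ψ χ) (c := energy Ω V ψ)
    fun t => by
      have := h0 _ (hψ.linear hχ 1 t)
      rw [energy_linear hV hM hψ hχ] at this
      linarith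
  rw [discrim] at h
  nlinarith

end GroundState

/-! ### Limits of sequences of `L²` functions -/

section Limits

variable {α F : Type*} [MeasurableSpace α] {μ : Measure α} [NormedAddCommGroup F]
  [InnerProductSpace ℝ F]

lemma cauchySeq_toLp {f : ℕ → α → F} (hf : ∀ n, MemLp (f n) 2 μ)
    (h : ∀ ε > 0, ∃ n₀, ∀ m ≥ n₀, ∀ n ≥ n₀, ∫ x, ‖f m x - f n x‖ ^ 2 ∂μ ≤ ε) :
    CauchySeq fun n => (hf n).toLp (f n) := by
  rw [Metric.cauchySeq_iff]
  intro ε hε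
  obtain ⟨n₀, hn⟩ := h ((ε / 2) ^ 2) (by positivity)
  refine ⟨n₀, fun m hm n hn' => ?_⟩
  rw [dist_eq_norm, ← MemLp.toLp_sub]
  have h1 : ‖((hf m).sub (hf n)).toLp (f m - f n)‖ ^ 2 ≤ (ε / 2) ^ 2 := by
    rw [norm_toLp_sq]
    exact hn m hm n hn'
  have := (sq_le_sq₀ (norm_nonneg _) (by positivity)).1 h1
  linarith

lemma exists_limit_of_cauchy {E : Type*} [NormedAddCommGroup E] [CompleteSpace E]
    {f : ℕ → α → E} (hf : ∀ n, MemLp (f n) 2 μ)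
    (h : CauchySeq fun n => (hf n).toLp (f n)) :
    ∃ g : α → E, StronglyMeasurable g ∧ ∃ hg : MemLp g 2 μ,
      Tendsto (fun n => (hf n).toLp (f n)) atTop (𝓝 (hg.toLp g)) := by
  obtain ⟨L, hL⟩ := cauchySeq_tendsto_of_complete h
  exact ⟨L, Lp.stronglyMeasurable L, Lp.memLp L, by rwa [Lp.toLp_coeFn]⟩

lemma tendsto_integral_inner {f k : ℕ → α → F} (hf : ∀ n, MemLp (f n) 2 μ)
    (hk : ∀ n, MemLp (k n) 2 μ) {g l : α → F} (hg : MemLp g 2 μ) (hl : MemLp l 2 μ)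
    (h1 : Tendsto (fun n => (hf n).toLp (f n)) atTop (𝓝 (hg.toLp g)))
    (h2 : Tendsto (fun n => (hk n).toLp (k n)) atTop (𝓝 (hl.toLp l))) :
    Tendsto (fun n => ∫ x, ⟪f n x, k n x⟫_ℝ ∂μ) atTop (𝓝 (∫ x, ⟪g x, l x⟫_ℝ ∂μ)) := by
  have := h1.inner (𝕜 := ℝ) h2
  simpa only [inner_toLp] using this

lemma tendsto_integral_mul {f k : ℕ → α → ℝ} (hf : ∀ n, MemLp (f n) 2 μ)
    (hk : ∀ n, MemLp (k n) 2 μ) {g l : α → ℝ} (hg : MemLp g 2 μ) (hl : MemLp l 2 μ)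
    (h1 : Tendsto (fun n => (hf n).toLp (f n)) atTop (𝓝 (hg.toLp g)))
    (h2 : Tendsto (fun n => (hk n).toLp (k n)) atTop (𝓝 (hl.toLp l))) :
    Tendsto (fun n => ∫ x, f n x * k n x ∂μ) atTop (𝓝 (∫ x, g x * l x ∂μ)) := by
  have := h1.inner (𝕜 := ℝ) h2
  simpa only [inner_toLp_real] using this

/-- An `L²` limit is an almost everywhere limit along a subsequence. -/
lemma ae_nonneg_of_tendsto {f : ℕ → α → ℝ} (hf : ∀ n, MemLp (f n) 2 μ) {g : α → ℝ}
    (hg : MemLp g 2 μ) (h0 : ∀ n x, 0 ≤ f n x)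
    (h : Tendsto (fun n => (hf n).toLp (f n)) atTop (𝓝 (hg.toLp g))) : ∀ᵐ x ∂μ, 0 ≤ g x := by
  rw [tendsto_toLp_iff] at h
  obtain ⟨σ, -, hσ⟩ := (tendstoInMeasure_of_tendsto_eLpNorm (by norm_num)
    (fun n => (hf n).1) hg.1 h).exists_seq_tendsto_ae
  filter_upwards [hσ] with x hx
  exact ge_of_tendsto' hx fun n => h0 _ x

end Limits

/-! ### The ground state and the principal eigenvalue -/

section GroundState

variable {N : ℕ} {Ω : Set (Sph N)} {V : Sph N → ℝ} {M : ℝ}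

lemma energy_add_const (hV : Measurable V) (hM : ∀ θ, |V θ| ≤ M) {ψ : Sph N → ℝ}
    (hψ : IsTestOn Ω ψ) (c : ℝ) :
    energy Ω (fun θ => V θ + c) ψ = energy Ω V ψ - c * mass Ω ψ := by
  have h : ∫ θ in Ω, (V θ + c) * ψ θ * ψ θ ∂surf N =
      (∫ θ in Ω, V θ * ψ θ * ψ θ ∂surf N) + c * mass Ω ψ := by
    rw [mass, ← integral_const_mul, ← integral_add (integrable_bdd_test_mul hV hM hψ hψ)
      ((integrable_test_mul hψ hψ).const_mul c)]
    congr 1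
    ext θ
    ring
  rw [energy, energy, h]
  ring

/-- Shifting the potential by `bottom` moves the bottom of the spectrum to zero, where the
parallelogram and Cauchy–Schwarz inequalities for the form apply. -/
lemma energy_bottom_nonneg (hV : Measurable V) (hM : ∀ θ, |V θ| ≤ M) {ψ : Sph N → ℝ}
    (hψ : IsTestOn Ω ψ) : 0 ≤ energy Ω (fun θ => V θ + bottom Ω V) ψ := by
  rw [energy_add_const hV hM hψ]
  linarith [bottom_mul_mass_le hV hM hψ]

lemma integral_grad_le (hV : Measurable V) (hM : ∀ θ, |V θ| ≤ M) {ψ : Sph N → ℝ}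
    (hψ : IsTestOn Ω ψ) :
    ∫ θ in Ω, ‖sphGrad ψ θ‖ ^ 2 ∂surf N ≤ energy Ω V ψ + M * mass Ω ψ := by
  have := (abs_le.1 (abs_integral_mul_sq_le hV hM hψ)).2
  rw [energy]
  linarith

/-- The parallelogram law, with the nonnegative energy of the sum dropped. -/
lemma energy_sub_le (hV : Measurable V) (hM : ∀ θ, |V θ| ≤ M)
    (h0 : ∀ ξ, IsTestOn Ω ξ → 0 ≤ energy Ω V ξ) {ψ χ : Sph N → ℝ}
    (hψ : IsTestOn Ω ψ) (hχ : IsTestOn Ω χ) :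
    energy Ω V (fun θ => 1 * ψ θ + -1 * χ θ) ≤ 2 * energy Ω V ψ + 2 * energy Ω V χ := by
  have h1 := h0 _ (hψ.linear hχ 1 1)
  rw [energy_linear hV hM hψ hχ] at h1 ⊢
  linarith

lemma lintegral_enorm_sq_eq {F : Type*} [NormedAddCommGroup F] [InnerProductSpace ℝ F]
    {f : Sph N → F} (hf : MemLp f 2 ((surf N).restrict Ω)) (h0 : ∀ θ ∉ Ω, f θ = 0) :
    ∫⁻ θ, ‖f θ‖ₑ ^ 2 ∂surf N = ENNReal.ofReal (∫ θ in Ω, ‖f θ‖ ^ 2 ∂surf N) := by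
  rw [ofReal_integral_eq_lintegral_ofReal
    (by simpa using integrable_inner_of_memLp hf hf) (Eventually.of_forall fun θ => sq_nonneg _),
    ← setLIntegral_eq_of_support_subset (s := Ω)]
  · refine lintegral_congr fun θ => ?_
    rw [ENNReal.ofReal_pow (norm_nonneg _), ofReal_norm]
  · intro θ hθ
    by_contra h
    exact hθ (by simp [h0 θ h])

lemma IsTestOn.eq_zero {ψ : Sph N → ℝ} (hψ : IsTestOn Ω ψ) {θ : Sph N} (hθ : θ ∉ Ω) : ψ θ = 0 :=
  image_eq_zero_of_notMem_tsupport fun h => hθ (hψ.2 h)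

/-- Mass and energy together bound the gradients, so Rellich's theorem extracts an `L²`-Cauchy
subsequence from nonnegative near-minimisers. -/
lemma exists_minimizing (hN : 0 < N) (hΩ : IsOpen Ω) (hne : Ω.Nonempty) (hV : Measurable V)
    (hM : ∀ θ, |V θ| ≤ M) :
    ∃ ψ : ℕ → Sph N → ℝ, (∀ n, IsTestOn Ω (ψ n)) ∧ (∀ n θ, 0 ≤ ψ n θ) ∧
      (∀ n, 1 / 2 ≤ mass Ω (ψ n)) ∧
      Tendsto (fun n => energy Ω (fun θ => V θ + bottom Ω V) (ψ n)) atTop (𝓝 0) ∧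
      ∀ ε > 0, ∃ n₀, ∀ m ≥ n₀, ∀ n ≥ n₀, ∫ θ in Ω, ‖ψ m θ - ψ n θ‖ ^ 2 ∂surf N ≤ ε := by
  have hU : Measurable fun θ => V θ + bottom Ω V := hV.add_const _
  have hMU : ∀ θ, |V θ + bottom Ω V| ≤ M + |bottom Ω V| := fun θ =>
    (abs_add_le _ _).trans (by gcongr; exact hM θ)
  have hM0 : 0 ≤ M + |bottom Ω V| := by
    obtain ⟨θ, -⟩ := hne
    exact (abs_nonneg _).trans (hMU θ)
  choose ψ hψ hψ0 hm1 hm2 hE using fun n : ℕ =>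
    exists_nonneg_energy_lt hΩ hne hV hM (ε := 1 / ((n : ℝ) + 1)) (by positivity)
  have hE' : ∀ n, energy Ω (fun θ => V θ + bottom Ω V) (ψ n) < 1 / ((n : ℝ) + 1) := fun n => by
    rw [energy_add_const hV hM (hψ n)]
    exact hE n
  have hlim : Tendsto (fun n => energy Ω (fun θ => V θ + bottom Ω V) (ψ n)) atTop (𝓝 0) :=
    squeeze_zero (fun n => energy_bottom_nonneg hV hM (hψ n)) (fun n => (hE' n).le)
      (tendsto_radius 1)
  have hgr : ∀ n, ∫ θ in Ω, ‖sphGrad (ψ n) θ‖ ^ 2 ∂surf N ≤ 1 + (M + |bottom Ω V|) := fun n => by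
    refine (integral_grad_le hU hMU (hψ n)).trans ?_
    have h1 : (1 : ℝ) / ((n : ℝ) + 1) ≤ 1 := by
      rw [div_le_one (by positivity)]
      linarith [n.cast_nonneg (α := ℝ)]
    have h2 := mul_le_mul_of_nonneg_left (hm2 n) hM0
    have h3 := hE' n
    linarith
  obtain ⟨σ, hσ, hc⟩ := exists_L2_cauchy_subseq hN (fun n => (hψ n).mono (Set.subset_univ Ω))
    (C := ENNReal.ofReal (1 + (M + |bottom Ω V|))) ENNReal.ofReal_ne_top
    (fun n => by
      rw [lintegral_enorm_sq_eq ((hψ n).memLp 2 Ω) fun θ hθ => (hψ n).eq_zero hθ]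
      refine ENNReal.ofReal_le_ofReal ?_
      have := hm2 n
      simp only [mass] at this
      simp only [pow_two, Real.norm_eq_abs, abs_mul_abs_self]
      linarith)
    (fun n => by
      rw [lintegral_enorm_sq_eq ((hψ n).memLp_sphGrad 2 Ω) fun θ hθ =>
        sphGrad_eq_zero fun h => hθ ((hψ n).2 h)]
      exact ENNReal.ofReal_le_ofReal (hgr n))
  refine ⟨fun n => ψ (σ n), fun n => hψ _, fun n => hψ0 _, fun n => hm1 _,
    hlim.comp hσ.tendsto_atTop, fun ε hε => ?_⟩
  obtain ⟨n₀, hn⟩ := hc (ENNReal.ofReal ε) (by simpa using hε)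
  refine ⟨n₀, fun m hm n hn' => ?_⟩
  have h := hn m hm n hn'
  rw [lintegral_enorm_sq_eq (f := fun θ => ψ (σ m) θ - ψ (σ n) θ)
    (((hψ _).memLp 2 Ω).sub ((hψ _).memLp 2 Ω)) fun θ hθ => by
      rw [(hψ _).eq_zero hθ, (hψ _).eq_zero hθ, sub_zero]] at h
  exact (ENNReal.ofReal_le_ofReal_iff hε.le).1 h

/-- Existence of a nonnegative ground state. -/
theorem exists_ground_state (hN : 0 < N) (hΩ : IsOpen Ω) (hne : Ω.Nonempty) (hV : Measurable V)
    (hM : ∀ θ, |V θ| ≤ M) :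
    ∃ (φ : Sph N → ℝ) (g : Sph N → Euc N), StronglyMeasurable φ ∧ StronglyMeasurable g ∧
      IsH10 Ω φ g ∧ (∀ᵐ θ ∂(surf N).restrict Ω, 0 ≤ φ θ) ∧
      ¬ (∀ᵐ θ ∂(surf N).restrict Ω, φ θ = 0) ∧
      ∀ χ : Sph N → ℝ, IsTestOn Ω χ →
        (∫ θ in Ω, ⟪g θ, sphGrad χ θ⟫_ℝ ∂surf N) - ∫ θ in Ω, V θ * φ θ * χ θ ∂surf N
          = bottom Ω V * ∫ θ in Ω, φ θ * χ θ ∂surf N := by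
  have hU : Measurable fun θ => V θ + bottom Ω V := hV.add_const _
  have hMU : ∀ θ, |V θ + bottom Ω V| ≤ M + |bottom Ω V| := fun θ =>
    (abs_add_le _ _).trans (by gcongr; exact hM θ)
  have hM0 : 0 ≤ M + |bottom Ω V| := by
    obtain ⟨θ, -⟩ := hne
    exact (abs_nonneg _).trans (hMU θ)
  have h0 : ∀ ξ, IsTestOn Ω ξ → 0 ≤ energy Ω (fun θ => V θ + bottom Ω V) ξ :=
    fun ξ hξ => energy_bottom_nonneg hV hM hξ
  obtain ⟨ψ, hψ, hψ0, hm, hE, hc⟩ := exists_minimizing hN hΩ hne hV hM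
  have hL : ∀ n, MemLp (ψ n) 2 ((surf N).restrict Ω) := fun n => (hψ n).memLp 2 Ω
  have hG : ∀ n, MemLp (sphGrad (ψ n)) 2 ((surf N).restrict Ω) := fun n =>
    (hψ n).memLp_sphGrad 2 Ω
  obtain ⟨φ, hφm, hφ, hlim⟩ := exists_limit_of_cauchy hL (cauchySeq_toLp hL hc)
  -- Upgrades `L²` convergence to `H¹`: the shifted energy of a difference is small by the
  -- parallelogram inequality, and the gradient term is that energy plus a multiple of the mass.
  have hgc : ∀ ε > 0, ∃ n₀, ∀ m ≥ n₀, ∀ n ≥ n₀,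
      ∫ θ in Ω, ‖sphGrad (ψ m) θ - sphGrad (ψ n) θ‖ ^ 2 ∂surf N ≤ ε := by
    intro ε hε
    -- Half of `ε` is for the mass term; energies below `ε / 8` account for the other half. The `+
    -- 1` keeps the divisor positive.
    obtain ⟨n₁, h1⟩ := hc (ε / 2 / (M + |bottom Ω V| + 1)) (by positivity)
    obtain ⟨n₂, h2⟩ := eventually_atTop.1 (hE.eventually_lt_const (u := ε / 8) (by positivity))
    refine ⟨max n₁ n₂, fun m hm' n hn => ?_⟩
    have e1 := h1 m (le_of_max_le_left hm') n (le_of_max_le_left hn)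
    have e2 := h2 m (le_of_max_le_right hm')
    have e3 := h2 n (le_of_max_le_right hn)
    have e4 := energy_sub_le hU hMU h0 (hψ m) (hψ n)
    have e5 := integral_grad_le hU hMU ((hψ m).linear (hψ n) 1 (-1))
    have e6 : ∫ θ in Ω, ‖sphGrad (ψ m) θ - sphGrad (ψ n) θ‖ ^ 2 ∂surf N =
        ∫ θ in Ω, ‖sphGrad (fun θ => 1 * ψ m θ + -1 * ψ n θ) θ‖ ^ 2 ∂surf N := by
      congr 1
      ext θ
      rw [(hψ m).sphGrad_linear (hψ n)]
      simp [sub_eq_add_neg]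
    have e7 : mass Ω (fun θ => 1 * ψ m θ + -1 * ψ n θ) =
        ∫ θ in Ω, ‖ψ m θ - ψ n θ‖ ^ 2 ∂surf N := by
      rw [mass]
      congr 1
      ext θ
      rw [Real.norm_eq_abs, sq_abs]
      ring
    rw [e7] at e5
    have e8 : (M + |bottom Ω V|) * ∫ θ in Ω, ‖ψ m θ - ψ n θ‖ ^ 2 ∂surf N ≤ ε / 2 := by
      refine (mul_le_mul_of_nonneg_left e1 hM0).trans ?_
      rw [← mul_div_assoc, div_le_iff₀ (by positivity)]
      nlinarith
    rw [e6]
    linarith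
  obtain ⟨g, hgm, hg, hglim⟩ := exists_limit_of_cauchy hG (cauchySeq_toLp hG hgc)
  have hmφ : 1 / 2 ≤ ∫ θ in Ω, φ θ * φ θ ∂surf N :=
    ge_of_tendsto' (tendsto_integral_mul hL hL hφ hφ hlim hlim) hm
  refine ⟨φ, g, hφm, hgm, ⟨hφ, hg, ψ, hψ, (tendsto_toLp_iff hL hφ).1 hlim,
    (tendsto_toLp_iff hG hg).1 hglim⟩, ae_nonneg_of_tendsto hL hφ hψ0 hlim, fun hz => ?_,
    fun χ hχ => ?_⟩
  · have : ∫ θ in Ω, φ θ * φ θ ∂surf N = 0 := by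
      rw [← integral_zero (Sph N) ℝ (μ := (surf N).restrict Ω)]
      refine integral_congr_ae ?_
      filter_upwards [hz] with θ hθ
      rw [hθ, mul_zero]
    rw [this] at hmφ
    norm_num at hmφ
  · have hχL := hχ.memLp 2 Ω
    have hb : Tendsto (fun n => bilin Ω (fun θ => V θ + bottom Ω V) (ψ n) χ) atTop
        (𝓝 ((∫ θ in Ω, ⟪g θ, sphGrad χ θ⟫_ℝ ∂surf N) -
          ∫ θ in Ω, (V θ + bottom Ω V) * φ θ * χ θ ∂surf N)) :=
      (tendsto_integral_inner hG (fun _ => hχ.memLp_sphGrad 2 Ω) hg _ hglim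
        tendsto_const_nhds).sub (tendsto_integral_mul (fun n => memLp_bdd_mul hU hMU (hL n))
        (fun _ => hχL) (memLp_bdd_mul hU hMU hφ) hχL (tendsto_bdd_mul hU hMU hL hφ hlim)
        tendsto_const_nhds)
    -- By Cauchy–Schwarz, a minimising sequence makes the form against any fixed `χ` tend to zero.
    -- This is the Euler–Lagrange equation in the limit.
    have hb0 : Tendsto (fun n => bilin Ω (fun θ => V θ + bottom Ω V) (ψ n) χ ^ 2) atTop
        (𝓝 0) := by
      have := hE.mul_const (energy Ω (fun θ => V θ + bottom Ω V) χ)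
      rw [zero_mul] at this
      exact squeeze_zero (fun n => sq_nonneg _) (fun n => bilin_sq_le hU hMU (hψ n) hχ h0) this
    have hz := tendsto_nhds_unique (hb.pow 2) hb0
    have hz' := pow_eq_zero_iff (two_ne_zero) |>.1 hz
    have hsplit : ∫ θ in Ω, (V θ + bottom Ω V) * φ θ * χ θ ∂surf N =
        (∫ θ in Ω, V θ * φ θ * χ θ ∂surf N) + bottom Ω V * ∫ θ in Ω, φ θ * χ θ ∂surf N := by
      rw [← integral_const_mul, ← integral_add (by exact (memLp_bdd_mul hV hM hφ).integrable_mul hχL)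
        (by exact (hφ.integrable_mul hχL).const_mul _)]
      congr 1
      ext θ
      ring
    rw [hsplit] at hz'
    linarith

/-- Testing the eigenvalue equation with the approximations of the eigenfunction identifies its form
with `l` times its mass; the Rayleigh bound passes to the same limit. -/
lemma bottom_le_of_isDirichletEigenvalue (hV : Measurable V) (hM : ∀ θ, |V θ| ≤ M) {l : ℝ}
    (h : IsDirichletEigenvalue Ω V l) : bottom Ω V ≤ l := by
  obtain ⟨φ, g, ⟨hφ, hg, ψ, hψ, hlim, hglim⟩, hne, hweak⟩ := h
  have hL : ∀ n, MemLp (ψ n) 2 ((surf N).restrict Ω) := fun n => (hψ n).memLp 2 Ω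
  have hG : ∀ n, MemLp (sphGrad (ψ n)) 2 ((surf N).restrict Ω) := fun n =>
    (hψ n).memLp_sphGrad 2 Ω
  rw [← tendsto_toLp_iff hL hφ] at hlim
  rw [← tendsto_toLp_iff hG hg] at hglim
  have h1 := (tendsto_integral_inner (fun _ => hg) hG hg hg tendsto_const_nhds hglim).sub
    (tendsto_integral_mul (fun _ => memLp_bdd_mul hV hM hφ) hL (memLp_bdd_mul hV hM hφ) hφ
      tendsto_const_nhds hlim)
  have h2 := (tendsto_integral_mul (fun _ => hφ) hL hφ hφ tendsto_const_nhds hlim).const_mul l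
  have e1 := tendsto_nhds_unique h1 (h2.congr fun n => (hweak _ (hψ n)).symm)
  have h3 := (tendsto_integral_inner hG hG hg hg hglim hglim).sub
    (tendsto_integral_mul (fun n => memLp_bdd_mul hV hM (hL n)) hL (memLp_bdd_mul hV hM hφ) hφ
      (tendsto_bdd_mul hV hM hL hφ hlim) hlim)
  have h4 := (tendsto_integral_mul hL hL hφ hφ hlim hlim).const_mul (bottom Ω V)
  have e2 := le_of_tendsto_of_tendsto' h4 h3 fun n => by
    have := bottom_mul_mass_le hV hM (hψ n)
    rwa [← bilin_self] at this
  rw [e1] at e2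
  refine le_of_mul_le_mul_right e2 ?_
  refine lt_of_le_of_ne (integral_nonneg fun θ => mul_self_nonneg _) fun h0 => hne ?_
  have := (integral_eq_zero_iff_of_nonneg (fun θ => mul_self_nonneg (φ θ))
    (hφ.integrable_mul hφ)).1 h0.symm
  filter_upwards [this] with θ hθ
  exact mul_self_eq_zero.1 hθ

/-- The ground state shows that `bottom` is an eigenvalue, hence that the infimum is attained. -/
theorem principalEigenvalue_eq_bottom (hN : 0 < N) (hΩ : IsOpen Ω) (hne : Ω.Nonempty)
    (hV : Measurable V) (hM : ∀ θ, |V θ| ≤ M) : principalEigenvalue Ω V = bottom Ω V := by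
  obtain ⟨φ, g, -, -, hφ, -, hnz, hweak⟩ := exists_ground_state hN hΩ hne hV hM
  have hmem : IsDirichletEigenvalue Ω V (bottom Ω V) := ⟨φ, g, hφ, hnz, hweak⟩
  refine le_antisymm (csInf_le ⟨bottom Ω V, fun l hl => ?_⟩ hmem)
    (le_csInf ⟨_, hmem⟩ fun l hl => ?_)
  all_goals exact bottom_le_of_isDirichletEigenvalue hV hM hl

end GroundState

/-! ### Necessity: products of radial and angular test functions -/

section Necessity

variable {N : ℕ} {Ω : Set (Sph N)} {ρ : ℝ}

lemma hasFDerivAt_norm_smul (θ : Sph N) {r : ℝ} (hr : 0 < r) :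
    HasFDerivAt (fun x : Euc N => ‖x‖) (innerSL ℝ (θ : Euc N)) (r • (θ : Euc N)) := by
  have hn : ‖r • (θ : Euc N)‖ = r := by rw [norm_smul, norm_sph, mul_one, Real.norm_of_nonneg hr.le]
  have h1 : HasFDerivAt (fun x : Euc N => ‖x‖ ^ 2) (2 • innerSL ℝ (r • (θ : Euc N)))
      (r • (θ : Euc N)) := (hasStrictFDerivAt_norm_sq _).hasFDerivAt
  have h2 := h1.sqrt (by rw [hn]; positivity)
  simp only [Real.sqrt_sq (norm_nonneg _), hn, Real.sqrt_sq hr.le] at h2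
  refine h2.congr_fderiv ?_
  ext v
  simp
  field_simp

/-- The gradient of a product of a radial and an angular function, in polar coordinates. -/
lemma hasFDerivAt_radial_mul {ψ : Sph N → ℝ} (hψ : IsTestOn Ω ψ) {f : ℝ → ℝ} {f' r : ℝ}
    (hr : 0 < r) (hf : HasDerivAt f f' r) (θ : Sph N) :
    HasFDerivAt (fun x : Euc N => f ‖x‖ * radialExt ψ x)
      (innerSL ℝ ((f' * ψ θ) • (θ : Euc N) + (f r * r⁻¹) • sphGrad ψ θ)) (r • (θ : Euc N)) := by
  have hn : ‖r • (θ : Euc N)‖ = r := by rw [norm_smul, norm_sph, mul_one, Real.norm_of_nonneg hr.le]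
  have h1 : HasFDerivAt (fun x : Euc N => f ‖x‖) (f' • innerSL ℝ (θ : Euc N)) (r • (θ : Euc N)) :=
    HasDerivAt.comp_hasFDerivAt (r • (θ : Euc N)) (by rwa [hn]) (hasFDerivAt_norm_smul θ hr)
  refine (h1.mul (hasFDerivAt_radialExt hψ.1 (sph_smul_ne_zero θ hr))).congr_fderiv ?_
  rw [hn, radialExt_smul _ _ hr, fderiv_radialExt_smul hψ.1 (sph_ne_zero θ) hr,
    fderiv_radialExt_eq]
  ext v
  simp only [add_apply, smul_apply, innerSL_apply_apply,
    smul_eq_mul, inner_add_left, real_inner_smul_left]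
  ring

lemma gradient_radial_mul {ψ : Sph N → ℝ} (hψ : IsTestOn Ω ψ) {f : ℝ → ℝ} {f' r : ℝ}
    (hr : 0 < r) (hf : HasDerivAt f f' r) (θ : Sph N) :
    gradient (fun x : Euc N => f ‖x‖ * radialExt ψ x) (r • (θ : Euc N)) =
      (f' * ψ θ) • (θ : Euc N) + (f r * r⁻¹) • sphGrad ψ θ := by
  refine ext_inner_left ℝ fun v => ?_
  rw [inner_gradient_right, (hasFDerivAt_radial_mul hψ hr hf θ).fderiv, innerSL_apply_apply,
    real_inner_comm]

/-- Pythagoras, since the spherical gradient is tangent and `θ` is a unit normal. -/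
lemma norm_sq_radial_grad {ψ : Sph N → ℝ} (hψ : IsTestOn Ω ψ) (θ : Sph N) (a b : ℝ) :
    ‖a • (θ : Euc N) + b • sphGrad ψ θ‖ ^ 2 = a ^ 2 + b ^ 2 * ‖sphGrad ψ θ‖ ^ 2 := by
  rw [norm_add_sq_real, real_inner_smul_left, real_inner_smul_right, real_inner_comm,
    inner_sphGrad_self hψ.1, norm_smul, norm_smul, norm_sph, mul_pow, mul_pow, Real.norm_eq_abs,
    Real.norm_eq_abs, sq_abs, sq_abs]
  ring

/-- The radial factor vanishes near `0`, where the norm and the extension of `ψ` are not smooth, and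
outside a shell whose inner radius exceeds `ρ`. -/
lemma isTestIn_radial_mul (hρ : 0 ≤ ρ) {ψ : Sph N → ℝ} (hψ : IsTestOn Ω ψ) {f : ℝ → ℝ}
    (hf : ContDiffOn ℝ ∞ f (Set.Ioi 0)) {r₁ r₂ : ℝ} (hr : ρ < r₁)
    (h0 : ∀ r, 0 ≤ r → r ∉ Set.Icc r₁ r₂ → f r = 0) :
    IsTestIn (cone Ω ρ) fun x => f ‖x‖ * radialExt ψ x := by
  have hr0 : 0 < r₁ := hρ.trans_lt hr
  have hK : IsCompact (pol '' (tsupport ψ ×ˢ Set.Icc r₁ r₂)) :=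
    ((isClosed_tsupport ψ).isCompact.prod isCompact_Icc).image continuous_pol
  have hs : Function.support (fun x : Euc N => f ‖x‖ * radialExt ψ x) ⊆
      pol '' (tsupport ψ ×ˢ Set.Icc r₁ r₂) := by
    intro x hx
    obtain ⟨hx1, hx2⟩ := mul_ne_zero_iff.1 (Function.mem_support.1 hx)
    have hx0 : x ≠ 0 := by
      rintro rfl
      exact hx2 (by simp [radialExt])
    obtain ⟨θ, hθ⟩ := exists_eq_smul hx0
    rw [hθ, radialExt_smul _ _ (norm_pos_iff.2 hx0)] at hx2
    refine ⟨(θ, ‖x‖), ⟨subset_tsupport _ hx2, ?_⟩, hθ.symm⟩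
    by_contra h
    exact hx1 (h0 _ (norm_nonneg _) h)
  refine ⟨contDiff_iff_contDiffAt.2 fun x => ?_,
    HasCompactSupport.of_support_subset_isCompact hK hs,
    (closure_minimal hs hK.isClosed).trans ?_⟩
  · rcases eq_or_ne x 0 with rfl | hx
    · refine (contDiffAt_const (c := (0 : ℝ))).congr_of_eventuallyEq ?_
      filter_upwards [Metric.ball_mem_nhds (0 : Euc N) hr0] with x hx
      rw [h0 _ (norm_nonneg _), zero_mul]
      intro h
      rw [mem_ball_zero_iff] at hx
      linarith [h.1]
    · exact ((hf.contDiffAt (Ioi_mem_nhds (norm_pos_iff.2 hx))).comp x (contDiffAt_norm ℝ hx)).mul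
        (contDiffAt_radialExt hψ.1 hx)
  · rintro _ ⟨⟨θ, r⟩, ⟨h1, h2⟩, rfl⟩
    exact ⟨r, hr.trans_le h2.1, θ, hψ.2 h1, rfl⟩

lemma integrableOn_radMeas_of_continuousOn (hρ : 0 ≤ ρ) {F : ℝ → ℝ}
    (hF : ContinuousOn F (Set.Ioi 0)) {r₁ r₂ : ℝ} (hr : ρ < r₁)
    (h0 : ∀ r, ρ < r → r ∉ Set.Icc r₁ r₂ → F r = 0) :
    IntegrableOn F (Set.Ioi ρ) (radMeas N) := by
  rw [integrableOn_radMeas_iff hρ]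
  refine IntegrableOn.of_forall_sdiff_eq_zero (s := Set.Icc r₁ r₂) ?_ measurableSet_Ioi
    fun r hr' => by rw [h0 r hr'.1 hr'.2, mul_zero]
  refine ContinuousOn.integrableOn_compact isCompact_Icc ?_
  exact ((continuous_pow _).continuousOn.mul hF).mono fun r hr' =>
    (hρ.trans_lt hr).trans_le hr'.1

/-- Polar coordinates for integrals over a cone. -/
lemma setIntegral_cone (hN : 0 < N) (hΩ : IsOpen Ω) (hρ : 0 ≤ ρ) {F : Euc N → ℝ}
    (hF : AEStronglyMeasurable F (volume.restrict (cone Ω ρ))) :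
    ∫ x in cone Ω ρ, F x =
      ∫ p, F (pol p) ∂((surf N).restrict Ω).prod ((radMeas N).restrict (Set.Ioi ρ)) := by
  have h := measurePreserving_pol_cone hN hΩ hρ
  rw [← h.map_eq, integral_map h.measurable.aemeasurable (by rwa [h.map_eq])]

lemma ae_prod_lt (hρ : 0 ≤ ρ) :
    ∀ᵐ p ∂((surf N).restrict Ω).prod ((radMeas N).restrict (Set.Ioi ρ)), 0 < p.2 ∧ ρ < p.2 := by
  have : ∀ᵐ r ∂(radMeas N).restrict (Set.Ioi ρ), 0 < r ∧ ρ < r := by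
    filter_upwards [ae_restrict_mem measurableSet_Ioi] with r hr
    exact ⟨hρ.trans_lt hr, hr⟩
  exact Measure.quasiMeasurePreserving_snd.ae this

lemma measurable_conePotential {V : Sph N → ℝ} (hV : Measurable V) :
    Measurable (conePotential V) := by
  unfold conePotential
  exact (measurable_radialExt hV).div (measurable_norm.pow_const 2)

lemma abs_conePotential_le {V : Sph N → ℝ} {M : ℝ} (hM : ∀ θ, |V θ| ≤ M) (hρ : 0 < ρ)
    {x : Euc N} (hx : x ∈ cone Ω ρ) : |conePotential V x| ≤ M / ρ ^ 2 := by
  obtain ⟨r, hr, θ, -, rfl⟩ := hx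
  have hr0 := hρ.trans hr
  rw [conePotential_smul _ _ hr0, abs_div, abs_of_pos (by positivity : 0 < r ^ 2)]
  exact div_le_div₀ ((abs_nonneg _).trans (hM θ)) (hM θ) (by positivity)
    (pow_le_pow_left₀ hρ.le hr.le 2)

/-- The quadratic form inequality for `f(r) ψ(ω)`. The squared gradient is `f'² ψ² + r⁻² f² |∇ψ|²`
and the potential term has the same weight `r⁻² f²`, so every integral factors in polar coordinates.
-/
lemma radial_hardy (hN : 0 < N) (hΩ : IsOpen Ω) (hρ : 0 < ρ) {V : Sph N → ℝ} {M : ℝ}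
    (hV : Measurable V) (hM : ∀ θ, |V θ| ≤ M) (h : HasPositiveSuperSolution Ω ρ V)
    {ψ : Sph N → ℝ} (hψ : IsTestOn Ω ψ) {f : ℝ → ℝ}
    (hf : ContDiffOn ℝ ∞ f (Set.Ioi 0)) {r₁ r₂ : ℝ} (hr : ρ < r₁)
    (h0 : ∀ r, 0 ≤ r → r ∉ Set.Icc r₁ r₂ → f r = 0) :
    0 ≤ mass Ω ψ * (∫ r in Set.Ioi ρ, deriv f r ^ 2 ∂radMeas N) +
      energy Ω V ψ * ∫ r in Set.Ioi ρ, (f r * r⁻¹) ^ 2 ∂radMeas N := by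
  -- A point of the sphere is needed only to read off `0 ≤ M`.
  rcases isEmpty_or_nonempty (Sph N) with hE | ⟨⟨θ₀⟩⟩
  · have : (surf N).restrict Ω = 0 := Subsingleton.elim _ _
    simp [mass, energy, this]
  have hM0 : 0 ≤ M := (abs_nonneg _).trans (hM θ₀)
  obtain ⟨v, hv, hpos⟩ := h
  have hη := isTestIn_radial_mul hρ.le hψ hf hr h0
  have hd : ∀ r : ℝ, 0 < r → HasDerivAt f (deriv f r) r := fun r hr' =>
    ((hf.contDiffAt (Ioi_mem_nhds hr')).differentiableAt (by simp)).hasDerivAt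
  have hmain : ∫ x in cone Ω ρ, conePotential V x * (f ‖x‖ * radialExt ψ x) ^ 2 ≤
      ∫ x, ‖gradient (fun x : Euc N => f ‖x‖ * radialExt ψ x) x‖ ^ 2 := by
    refine integral_potential_mul_sq_le (isOpen_cone hΩ hρ.le) (u := v) (fun K hK hKc => ?_) hpos
      (measurable_conePotential hV).aestronglyMeasurable (M := M / ρ ^ 2) (by positivity)
      (fun x hx => abs_conePotential_le hM hρ hx) hv.distSuper hη
    obtain ⟨g, hg, -⟩ := hv
    exact hg.integrableOn hKc hK
  have hsupp : ∫ x, ‖gradient (fun x : Euc N => f ‖x‖ * radialExt ψ x) x‖ ^ 2 =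
      ∫ x in cone Ω ρ, ‖gradient (fun x : Euc N => f ‖x‖ * radialExt ψ x) x‖ ^ 2 := by
    refine (setIntegral_eq_integral_of_forall_compl_eq_zero fun x hx => ?_).symm
    have h1 : fderiv ℝ (fun x : Euc N => f ‖x‖ * radialExt ψ x) x = 0 := by
      by_contra hne
      exact hx (hη.sub (support_fderiv_subset ℝ hne))
    simp [gradient, h1]
  have hc1 : ContinuousOn (deriv f) (Set.Ioi 0) := hf.continuousOn_deriv_of_isOpen isOpen_Ioi (by simp)
  have hz1 : ∀ r, ρ < r → r ∉ Set.Icc r₁ r₂ → deriv f r = 0 := fun r hr1 hr2 => by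
    have : f =ᶠ[𝓝 r] fun _ => 0 := by
      filter_upwards [isClosed_Icc.isOpen_compl.mem_nhds hr2, lt_mem_nhds (hρ.trans hr1)]
        with s hs1 hs2 using h0 s hs2.le hs1
    rw [this.deriv_eq, deriv_const]
  have hi1 : IntegrableOn (fun r => deriv f r ^ 2) (Set.Ioi ρ) (radMeas N) :=
    integrableOn_radMeas_of_continuousOn hρ.le (hc1.pow 2) hr fun r hr1 hr2 => by
      rw [hz1 r hr1 hr2]; simp
  have hi2 : IntegrableOn (fun r => (f r * r⁻¹) ^ 2) (Set.Ioi ρ) (radMeas N) :=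
    integrableOn_radMeas_of_continuousOn hρ.le
      ((hf.continuousOn.mul (continuousOn_id.inv₀ fun r hr' => ne_of_gt hr')).pow 2) hr
      fun r hr1 hr2 => by rw [h0 r (hρ.trans hr1).le hr2]; simp
  have e1 : ∫ x in cone Ω ρ, conePotential V x * (f ‖x‖ * radialExt ψ x) ^ 2 =
      (∫ θ in Ω, V θ * ψ θ * ψ θ ∂surf N) * ∫ r in Set.Ioi ρ, (f r * r⁻¹) ^ 2 ∂radMeas N := by
    rw [setIntegral_cone hN hΩ hρ.le (by exact ((measurable_conePotential hV).mul
      (hη.smooth.continuous.measurable.pow_const 2)).aestronglyMeasurable), ← integral_prod_mul]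
    refine integral_congr_ae ?_
    filter_upwards [ae_prod_lt hρ.le] with p hp
    rw [pol, conePotential_smul _ _ hp.1, radialExt_smul _ _ hp.1, norm_smul, norm_sph, mul_one,
      Real.norm_of_nonneg hp.1.le]
    field_simp
  have e2 : ∫ x in cone Ω ρ, ‖gradient (fun x : Euc N => f ‖x‖ * radialExt ψ x) x‖ ^ 2 =
      mass Ω ψ * (∫ r in Set.Ioi ρ, deriv f r ^ 2 ∂radMeas N) +
      (∫ θ in Ω, ‖sphGrad ψ θ‖ ^ 2 ∂surf N) *
        ∫ r in Set.Ioi ρ, (f r * r⁻¹) ^ 2 ∂radMeas N := by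
    rw [setIntegral_cone hN hΩ hρ.le
      (by exact ((continuous_gradient hη.smooth).norm.pow 2).aestronglyMeasurable), mass,
      ← integral_prod_mul, ← integral_prod_mul, ← integral_add
        ((integrable_test_mul hψ hψ).mul_prod hi1)
        ((show Integrable (fun θ => ‖sphGrad ψ θ‖ ^ 2) ((surf N).restrict Ω) by
          simpa using integrable_test_grad hψ hψ).mul_prod hi2)]
    refine integral_congr_ae ?_
    filter_upwards [ae_prod_lt hρ.le] with p hp
    rw [pol, gradient_radial_mul hψ hp.1 (hd _ hp.1), norm_sq_radial_grad hψ]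
    ring
  rw [hsupp, e1, e2] at hmain
  rw [energy]
  linarith

lemma integral_Ioi_comp_log (F : ℝ → ℝ) :
    ∫ r in Set.Ioi (0 : ℝ), r⁻¹ * F (Real.log r) = ∫ s, F s := by
  have h := integral_image_eq_integral_abs_deriv_smul (s := Set.univ) MeasurableSet.univ
    (fun x _ => (Real.hasDerivAt_exp x).hasDerivWithinAt) Real.exp_injective.injOn
    fun r => r⁻¹ * F (Real.log r)
  rw [Set.image_univ, Real.range_exp] at h
  rw [h, setIntegral_univ]
  refine integral_congr_ae (Eventually.of_forall fun s => ?_)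
  simp only [Real.log_exp, abs_of_pos (Real.exp_pos s), smul_eq_mul]
  rw [← mul_assoc, mul_inv_cancel₀ (Real.exp_pos s).ne', one_mul]

/-- The exponent is chosen so that its square contributes `r ^ (-N)`, which turns the weight `r ^ (N
- 1)` into `r⁻¹`, that is, into Lebesgue measure in `log r`. -/
lemma integral_radMeas_log (hN : 0 < N) (hρ : 0 ≤ ρ) (F : ℝ → ℝ)
    (h0 : ∀ r, 0 < r → r ≤ ρ → F (Real.log r) = 0) :
    ∫ r in Set.Ioi ρ, (r ^ (-((N : ℝ) - 2) / 2 - 1) * F (Real.log r)) ^ 2 ∂radMeas N =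
      ∫ s, F s ^ 2 := by
  rw [integral_radMeas _ hρ, ← integral_Ioi_comp_log fun s => F s ^ 2]
  have hz : ∀ r ∈ Set.Ioi (0 : ℝ) \ Set.Ioi ρ,
      r ^ (N - 1) * (r ^ (-((N : ℝ) - 2) / 2 - 1) * F (Real.log r)) ^ 2 = 0 := fun r hr => by
    rw [h0 r hr.1 (not_lt.1 hr.2)]
    simp
  rw [← setIntegral_eq_of_subset_of_forall_sdiff_eq_zero measurableSet_Ioi (Set.Ioi_subset_Ioi hρ) hz]
  refine setIntegral_congr_fun measurableSet_Ioi fun r hr => ?_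
  have hr0 : (0 : ℝ) < r := hr
  have : r ^ (N - 1) * (r ^ (-((N : ℝ) - 2) / 2 - 1)) ^ 2 = r⁻¹ := by
    rw [← Real.rpow_natCast, ← Real.rpow_mul_natCast hr0.le, ← Real.rpow_add hr0,
      ← Real.rpow_neg_one, Nat.cast_sub hN]
    congr 1
    push_cast
    ring
  rw [mul_pow, ← mul_assoc, this]

lemma integral_mul_deriv_eq_zero {h : ℝ → ℝ} (hh : ContDiff ℝ ∞ h) (hc : HasCompactSupport h) :
    ∫ s, h s * deriv h s = 0 := by
  have hd := hh.continuous_deriv (by simp)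
  have e := integral_mul_deriv_eq_deriv_mul_of_integrable (u := h) (v := h) (u' := deriv h)
    (v' := deriv h) (fun x _ => ((hh.differentiable (by simp)) x).hasDerivAt)
    (fun x _ => ((hh.differentiable (by simp)) x).hasDerivAt)
    ((hh.continuous.mul hd).integrable_of_hasCompactSupport hc.mul_right)
    ((hd.mul hh.continuous).integrable_of_hasCompactSupport hc.mul_left)
    ((hh.continuous.mul hh.continuous).integrable_of_hasCompactSupport hc.mul_right)
  have e2 : ∫ s, deriv h s * h s = ∫ s, h s * deriv h s := by simp_rw [mul_comm]
  rw [e2] at e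
  linarith

/-- The cross term is half the derivative of `h²` and integrates to zero. -/
lemma integral_sq_add_deriv {h : ℝ → ℝ} (hh : ContDiff ℝ ∞ h) (hc : HasCompactSupport h)
    (a : ℝ) : ∫ s, (a * h s + deriv h s) ^ 2 = a ^ 2 * (∫ s, h s ^ 2) + ∫ s, deriv h s ^ 2 := by
  have hd := hh.continuous_deriv (by simp)
  have i1 : Integrable fun s => h s ^ 2 := by
    simp_rw [pow_two]
    exact (hh.continuous.mul hh.continuous).integrable_of_hasCompactSupport hc.mul_right
  have i2 : Integrable fun s => h s * deriv h s :=
    (hh.continuous.mul hd).integrable_of_hasCompactSupport hc.mul_right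
  have i3 : Integrable fun s => deriv h s ^ 2 := by
    simp_rw [pow_two]
    exact (hd.mul hd).integrable_of_hasCompactSupport hc.deriv.mul_right
  have e : ∀ s, (a * h s + deriv h s) ^ 2 =
      a ^ 2 * h s ^ 2 + 2 * a * (h s * deriv h s) + deriv h s ^ 2 := fun s => by ring
  simp_rw [e]
  rw [integral_add (by exact (i1.const_mul _).add (i2.const_mul _)) i3,
    integral_add (i1.const_mul _) (i2.const_mul _), integral_const_mul, integral_const_mul,
    integral_mul_deriv_eq_zero hh hc, mul_zero, add_zero]

/-- For `f(r) = r ^ a k(log r)` one has `f' = r ^ (a - 1) (a k + k')`. With `a = -(N - 2) / 2` the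
radial integrals become integrals in `s = log r`, and `a²` is the Hardy constant. -/
lemma log_hardy (hN : 0 < N) (hΩ : IsOpen Ω) (hρ : 0 < ρ) {V : Sph N → ℝ} {M : ℝ}
    (hV : Measurable V) (hM : ∀ θ, |V θ| ≤ M) (h : HasPositiveSuperSolution Ω ρ V)
    {ψ : Sph N → ℝ} (hψ : IsTestOn Ω ψ) (hm : mass Ω ψ = 1) {k : ℝ → ℝ} (hk : ContDiff ℝ ∞ k)
    {s₁ s₂ : ℝ} (hs0 : 0 < s₁) (hs : Real.log ρ < s₁) (h0 : ∀ s, s ∉ Set.Icc s₁ s₂ → k s = 0) :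
    0 ≤ (hardyConst N + energy Ω V ψ) * (∫ s, k s ^ 2) + ∫ s, deriv k s ^ 2 := by
  have hc : HasCompactSupport k := HasCompactSupport.intro isCompact_Icc h0
  have hdz : ∀ s, s ∉ Set.Icc s₁ s₂ → deriv k s = 0 := fun s hs' => by
    have : k =ᶠ[𝓝 s] fun _ => 0 := by
      filter_upwards [isClosed_Icc.isOpen_compl.mem_nhds hs'] with t ht using h0 t ht
    rw [this.deriv_eq, deriv_const]
  have hlog : ∀ r, 0 < r → r ≤ ρ → Real.log r ∉ Set.Icc s₁ s₂ := fun r hr1 hr2 hr3 => by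
    have := Real.log_le_log hr1 hr2
    linarith [hr3.1]
  set a : ℝ := -((N : ℝ) - 2) / 2 with ha
  let f : ℝ → ℝ := fun r => r ^ a * k (Real.log r)
  have hf : ContDiffOn ℝ ∞ f (Set.Ioi 0) := by
    intro r hr
    have hr0 : r ≠ 0 := ne_of_gt hr
    exact ((Real.contDiffAt_rpow_const_of_ne hr0).mul
      (hk.contDiffAt.comp r (Real.contDiffAt_log.2 hr0))).contDiffWithinAt
  have hd : ∀ r, 0 < r →
      deriv f r = r ^ (a - 1) * (a * k (Real.log r) + deriv k (Real.log r)) := fun r hr => by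
    have h1 := (Real.hasDerivAt_rpow_const (p := a) (Or.inl hr.ne')).mul
      (((hk.differentiable (by simp)) (Real.log r)).hasDerivAt.comp r (Real.hasDerivAt_log hr.ne'))
    refine h1.deriv.trans ?_
    have : r ^ a = r ^ (a - 1) * r := by
      rw [← Real.rpow_add_one hr.ne', sub_add_cancel]
    simp only [Function.comp_apply, this]
    field_simp
  have hfz : ∀ r, 0 ≤ r → r ∉ Set.Icc (Real.exp s₁) (Real.exp s₂) → f r = 0 := fun r hr0 hr => by
    have : k (Real.log r) = 0 := by
      refine h0 _ fun hl => hr ?_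
      -- At the origin `Real.log 0 = 0`, a value excluded by `0 < s₁`.
      rcases hr0.eq_or_lt with rfl | hr0
      · rw [Real.log_zero] at hl
        linarith [hl.1]
      · exact ⟨(Real.le_log_iff_exp_le hr0).1 hl.1, (Real.log_le_iff_le_exp hr0).1 hl.2⟩
    simp only [f, this, mul_zero]
  have hmain := radial_hardy hN hΩ hρ hV hM h hψ hf ((Real.log_lt_iff_lt_exp hρ).1 hs) hfz
  have e1 : ∫ r in Set.Ioi ρ, deriv f r ^ 2 ∂radMeas N = ∫ s, (a * k s + deriv k s) ^ 2 := by
    rw [← integral_radMeas_log hN hρ.le (fun s => a * k s + deriv k s) fun r hr1 hr2 => by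
      rw [h0 _ (hlog r hr1 hr2), hdz _ (hlog r hr1 hr2)]; simp]
    refine integral_congr_ae ?_
    filter_upwards [ae_restrict_mem measurableSet_Ioi] with r hr
    rw [hd r (hρ.trans hr)]
  have e2 : ∫ r in Set.Ioi ρ, (f r * r⁻¹) ^ 2 ∂radMeas N = ∫ s, k s ^ 2 := by
    rw [← integral_radMeas_log hN hρ.le k fun r hr1 hr2 => h0 _ (hlog r hr1 hr2)]
    refine integral_congr_ae ?_
    filter_upwards [ae_restrict_mem measurableSet_Ioi] with r hr
    have hr0 : 0 < r := hρ.trans hr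
    simp only [f]
    rw [Real.rpow_sub_one hr0.ne']
    ring
  rw [e1, e2, hm, integral_sq_add_deriv hk hc] at hmain
  have hH : a ^ 2 = hardyConst N := by rw [ha, hardyConst]; ring
  rw [hH] at hmain
  linarith

/-- The energy bound forced by a positive super-solution. -/
theorem neg_hardyConst_le_energy (hN : 0 < N) (hΩ : IsOpen Ω) (hρ : 0 < ρ) {V : Sph N → ℝ} {M : ℝ}
    (hV : Measurable V) (hM : ∀ θ, |V θ| ≤ M) (h : HasPositiveSuperSolution Ω ρ V)
    {ψ : Sph N → ℝ} (hψ : IsTestOn Ω ψ) (hm : mass Ω ψ = 1) :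
    0 ≤ hardyConst N + energy Ω V ψ := by
  -- Supported in `[1, 3]`, away from zero, so its dilations `χ(ε s)` live beyond `1 / ε` and
  -- eventually beyond `log ρ`.
  let χ : ContDiffBump (2 : ℝ) := ⟨1 / 2, 1, by norm_num, by norm_num⟩
  have hχ0 : ∀ s, s ∉ Set.Icc (1 : ℝ) 3 → χ s = 0 := fun s hs => by
    have : s ∉ Function.support χ := fun h' => hs (by
      rw [χ.support_eq, Real.ball_eq_Ioo] at h'
      have h1 : (2 : ℝ) - 1 < s := h'.1
      have h2 : s < 2 + 1 := h'.2
      exact ⟨by linarith, by linarith⟩)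
    simpa using this
  have hA : 0 < ∫ s, χ s ^ 2 := by
    have hcont : Continuous fun s => χ s ^ 2 := χ.continuous.pow 2
    refine hcont.integral_pos_of_hasCompactSupport_nonneg_nonzero
      (HasCompactSupport.intro isCompact_Icc fun s hs => by rw [hχ0 s hs]; simp)
      (fun s => sq_nonneg _) (x := 2) ?_
    rw [χ.one_of_mem_closedBall (Metric.mem_closedBall_self (by norm_num))]
    norm_num
  have hε : ∀ᶠ ε : ℝ in 𝓝[>] 0, 0 ≤ (hardyConst N + energy Ω V ψ) * (∫ s, χ s ^ 2) +
      ε ^ 2 * ∫ s, deriv χ s ^ 2 := by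
    have hl : ∀ᶠ ε : ℝ in 𝓝[>] 0, ε * Real.log ρ < 1 := by
      have : Tendsto (fun ε : ℝ => ε * Real.log ρ) (𝓝[>] 0) (𝓝 (0 * Real.log ρ)) :=
        (tendsto_id.mono_left nhdsWithin_le_nhds).mul_const _
      rw [zero_mul] at this
      exact this.eventually_lt_const one_pos
    filter_upwards [hl, self_mem_nhdsWithin] with ε h1 h2
    have hε : 0 < ε := h2
    have hmain := log_hardy hN hΩ hρ hV hM h hψ hm (k := fun s => χ (ε * s))
      (χ.contDiff.comp (contDiff_const.mul contDiff_id)) (s₁ := 1 / ε) (s₂ := 3 / ε)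
      (by positivity) (by rw [lt_div_iff₀ hε, mul_comm]; exact h1) fun s hs => hχ0 _ fun hs' => hs
        ⟨by rw [div_le_iff₀ hε, mul_comm]; exact hs'.1, by rw [le_div_iff₀ hε, mul_comm]; exact hs'.2⟩
    have hd : ∀ s, deriv (fun s => χ (ε * s)) s = ε * deriv χ (ε * s) := fun s => by
      have := deriv_comp_mul_left ε (χ : ℝ → ℝ) s
      simpa using this
    simp_rw [hd, mul_pow] at hmain
    rw [integral_const_mul, Measure.integral_comp_mul_left (fun s => χ s ^ 2),
      Measure.integral_comp_mul_left (fun s => deriv χ s ^ 2), abs_of_pos (inv_pos.2 hε),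
      smul_eq_mul, smul_eq_mul] at hmain
    -- Dilation multiplies both integrals by `ε⁻¹` and the derivative term by a further `ε²`;
    -- multiplying by `ε` leaves only the latter depending on `ε`.
    have h3 := mul_nonneg hε.le hmain
    refine h3.trans_eq ?_
    field_simp
  have hlim : Tendsto (fun ε : ℝ => (hardyConst N + energy Ω V ψ) * (∫ s, χ s ^ 2) +
      ε ^ 2 * ∫ s, deriv χ s ^ 2) (𝓝[>] 0)
      (𝓝 ((hardyConst N + energy Ω V ψ) * (∫ s, χ s ^ 2) + 0 ^ 2 * ∫ s, deriv χ s ^ 2)) :=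
    tendsto_const_nhds.add (((tendsto_id.mono_left nhdsWithin_le_nhds).pow 2).mul_const _)
  have := ge_of_tendsto hlim hε
  rw [zero_pow two_ne_zero, zero_mul, add_zero] at this
  exact nonneg_of_mul_nonneg_left this hA

theorem hardyConst_add_bottom_nonneg (hN : 0 < N) (hΩ : IsOpen Ω) (hne : Ω.Nonempty) (hρ : 0 < ρ)
    {V : Sph N → ℝ} {M : ℝ} (hV : Measurable V) (hM : ∀ θ, |V θ| ≤ M)
    (h : HasPositiveSuperSolution Ω ρ V) : 0 ≤ hardyConst N + bottom Ω V := by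
  obtain ⟨ψ₀, h0, h1⟩ := exists_test_mass_one hΩ hne
  have : -hardyConst N ≤ bottom Ω V := by
    refine le_csInf ⟨_, ψ₀, h0, h1, rfl⟩ ?_
    rintro l ⟨ψ, hψ, hm, rfl⟩
    linarith [neg_hardyConst_le_energy hN hΩ hρ hV hM h hψ hm]
  linarith

end Necessity

/-! ### Approximation of compactly supported Sobolev functions by test functions -/

section Density

variable {N : ℕ} {G : Set (Euc N)}

/-- Test functions supported in `G \ K` do not see `φ`, so the gradient integrates to zero against
all of them. -/
lemma HasWeakGradOn.ae_grad_eq_zero (hG : IsOpen G) {φ : Euc N → ℝ} {h : Euc N → Euc N}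
    (hw : HasWeakGradOn G φ h) (hh : MemLp h 2 (volume.restrict G)) {K : Set (Euc N)}
    (hK : IsClosed K) (h0 : ∀ᵐ x ∂volume.restrict G, x ∉ K → φ x = 0) :
    ∀ᵐ x ∂volume.restrict G, x ∉ K → h x = 0 := by
  have hloc : LocallyIntegrable h (volume.restrict G) := hh.locallyIntegrable (by norm_num)
  have hi : ∀ i : Fin N, ∀ᵐ x ∂volume.restrict G, x ∈ G \ K → h x i = 0 := by
    intro i
    have hc : LocallyIntegrable (fun x => h x i) (volume.restrict G) := fun x => by
      obtain ⟨s, hs, hs'⟩ := hloc x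
      exact ⟨s, hs, (EuclideanSpace.proj i : Euc N →L[ℝ] ℝ).integrable_comp hs'⟩
    refine (hG.sdiff hK).ae_eq_zero_of_integral_contDiff_smul_eq_zero (hc.locallyIntegrableOn _)
      fun k hk hkc hks => ?_
    have h1 := hw k hk hkc (hks.trans Set.sdiff_subset) (EuclideanSpace.single i 1)
    have h2 : ∫ x in G, φ x * fderiv ℝ k x (EuclideanSpace.single i 1) = 0 := by
      rw [← integral_zero (Euc N) ℝ (μ := volume.restrict G)]
      refine integral_congr_ae ?_
      filter_upwards [h0] with x hx
      by_cases hxK : x ∈ K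
      · have : fderiv ℝ k x = 0 := by
          by_contra hne
          exact (hks (support_fderiv_subset ℝ hne)).2 hxK
        simp [this]
      · rw [hx hxK, zero_mul]
    rw [h2] at h1
    simp only [inner_single_right'] at h1
    simp_rw [smul_eq_mul, mul_comm (k _)]
    linarith
  filter_upwards [ae_all_iff.2 hi, ae_restrict_mem hG.measurableSet] with x hx hxG hxK
  ext i
  simpa using hx i ⟨hxG, hxK⟩

/-- Being one near `K`, not merely on it, keeps derivatives of the cutoff from appearing on `K`. -/
lemma exists_smooth_cutoff {K : Set (Euc N)} (hK : IsCompact K) {δ : ℝ} (hδ : 0 < δ) :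
    ∃ χ : Euc N → ℝ, ContDiff ℝ ∞ χ ∧ (∀ x ∈ K, χ =ᶠ[𝓝 x] fun _ => 1) ∧
      tsupport χ ⊆ Metric.cthickening δ K := by
  have hsub : K ⊆ interior (Metric.cthickening δ K) :=
    (Metric.self_subset_thickening hδ K).trans
      (Metric.isOpen_thickening.subset_interior_iff.2 (Metric.thickening_subset_cthickening δ K))
  obtain ⟨f, h1, h0, -⟩ := exists_contMDiffMap_one_nhds_of_subset_interior
    (modelWithCornersSelf ℝ (Euc N)) (n := (⊤ : ℕ∞)) hK.isClosed hsub
  refine ⟨f, f.contMDiff.contDiff, fun x hx => ?_,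
    closure_minimal (fun x hx => ?_) Metric.isClosed_cthickening⟩
  · exact h1.filter_mono (nhds_le_nhdsSet hx)
  · by_contra h
    exact hx (h0 x h)

lemma fderiv_mul_cutoff {χ k : Euc N → ℝ} {x : Euc N} (h : χ =ᶠ[𝓝 x] fun _ => 1) :
    fderiv ℝ (fun y => χ y * k y) x = fderiv ℝ k x := by
  refine Filter.EventuallyEq.fderiv_eq ?_
  filter_upwards [h] with y hy
  rw [hy, one_mul]

/-- Extension by zero of a compactly supported Sobolev function. -/
lemma HasWeakGradOn.extend (hG : IsOpen G) {φ : Euc N → ℝ} {h : Euc N → Euc N}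
    (hw : HasWeakGradOn G φ h) {K : Set (Euc N)} (hK : IsCompact K) (hKG : K ⊆ G)
    (h0 : ∀ᵐ x ∂volume.restrict G, x ∉ K → φ x = 0)
    (h1 : ∀ᵐ x ∂volume.restrict G, x ∉ K → h x = 0) {k : Euc N → ℝ} (hk : ContDiff ℝ ∞ k)
    (hkc : HasCompactSupport k) (e : Euc N) :
    ∫ x, K.indicator φ x * fderiv ℝ k x e = -∫ x, ⟪K.indicator h x, e⟫_ℝ * k x := by
  obtain ⟨δ, hδ, hδG⟩ := hK.exists_cthickening_subset_open hG hKG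
  obtain ⟨χ, hχ, hχ1, hχs⟩ := exists_smooth_cutoff hK hδ
  -- An arbitrary test function is multiplied by the cutoff to bring its support into `G`. On `K`
  -- this changes neither its value nor its derivative, and off `K` both `φ` and `h` vanish.
  have e1 : ∫ x, K.indicator φ x * fderiv ℝ k x e =
      ∫ x in G, φ x * fderiv ℝ (fun y => χ y * k y) x e := by
    rw [← setIntegral_eq_integral_of_forall_compl_eq_zero (s := G) fun x hx => by
      rw [Set.indicator_of_notMem fun hxK => hx (hKG hxK), zero_mul]]
    refine integral_congr_ae ?_
    filter_upwards [h0] with x hx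
    by_cases hxK : x ∈ K
    · rw [Set.indicator_of_mem hxK, fderiv_mul_cutoff (hχ1 x hxK)]
    · rw [Set.indicator_of_notMem hxK, hx hxK, zero_mul, zero_mul]
  have e2 : ∫ x, ⟪K.indicator h x, e⟫_ℝ * k x = ∫ x in G, ⟪h x, e⟫_ℝ * (χ x * k x) := by
    rw [← setIntegral_eq_integral_of_forall_compl_eq_zero (s := G) fun x hx => by
      rw [Set.indicator_of_notMem fun hxK => hx (hKG hxK), inner_zero_left, zero_mul]]
    refine integral_congr_ae ?_
    filter_upwards [h1] with x hx
    by_cases hxK : x ∈ K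
    · rw [Set.indicator_of_mem hxK, (hχ1 x hxK).eq_of_nhds, one_mul]
    · rw [Set.indicator_of_notMem hxK, hx hxK, inner_zero_left, zero_mul, zero_mul]
  rw [e1, e2]
  exact hw _ (hχ.mul hk) hkc.mul_left ((tsupport_mul_subset_left.trans hχs).trans hδG) e

/-- Using `z ↦ k (x - z)` as the test function moves the derivative from the kernel to `φ`. -/
lemma gradient_mol_of_weak {φ : Euc N → ℝ} {h : Euc N → Euc N} (hφ : LocallyIntegrable φ)
    (hh : LocallyIntegrable h)
    (hw : ∀ k : Euc N → ℝ, ContDiff ℝ ∞ k → HasCompactSupport k → ∀ e : Euc N,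
      ∫ x, φ x * fderiv ℝ k x e = -∫ x, ⟪h x, e⟫_ℝ * k x)
    {k : Euc N → ℝ} (hk : ContDiff ℝ ∞ k) (hkc : HasCompactSupport k) (x : Euc N) :
    gradient (mol k φ) x = mol k h x := by
  refine ext_inner_left ℝ fun e => ?_
  rw [inner_gradient_right, fderiv_mol hk hkc hφ, mol_apply, mol_apply]
  have hd : ∀ z, fderiv ℝ (fun z => k (x - z)) z e = -fderiv ℝ k (x - z) e := fun z => by
    have h1 : HasFDerivAt (fun z => k (x - z)) ((fderiv ℝ k (x - z)).comp
        (-ContinuousLinearMap.id ℝ (Euc N))) z :=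
      ((hk.differentiable (by simp)) (x - z)).hasFDerivAt.comp z ((hasFDerivAt_id z).const_sub x)
    rw [h1.fderiv]
    simp
  have hc : HasCompactSupport fun z => k (x - z) :=
    hkc.comp_homeomorph (Homeomorph.subLeft x)
  have h2 := hw (fun z => k (x - z)) (hk.comp (contDiff_const.sub contDiff_id)) hc e
  simp only [hd] at h2
  have h3 : ∫ z, fderiv ℝ k (x - z) e • φ z = -∫ z, φ z * -fderiv ℝ k (x - z) e := by
    rw [← integral_neg]
    refine integral_congr_ae (Eventually.of_forall fun z => ?_)
    simp only [smul_eq_mul]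
    ring
  rw [h3, h2, neg_neg, ← integral_inner (integrable_mol hk.continuous hkc hh x)]
  refine integral_congr_ae (Eventually.of_forall fun z => ?_)
  simp only [real_inner_smul_right]
  rw [real_inner_comm, mul_comm]

lemma tendsto_eLpNorm_two {α F : Type*} [MeasurableSpace α] [NormedAddCommGroup F] {μ : Measure α}
    {f : ℕ → α → F} (h : Tendsto (fun n => ∫⁻ x, ‖f n x‖ₑ ^ 2 ∂μ) atTop (𝓝 0)) :
    Tendsto (fun n => eLpNorm (f n) 2 μ) atTop (𝓝 0) := by
  have h2 := (ENNReal.continuous_rpow_const (y := (1 / 2 : ℝ))).tendsto 0 |>.comp h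
  rw [ENNReal.zero_rpow_of_pos (by norm_num)] at h2
  exact tendsto_of_tendsto_of_tendsto_of_le_of_le tendsto_const_nhds h2 (fun n => zero_le)
    fun n => eLpNorm_two_le le_rfl

/-- Approximation of compactly supported Sobolev functions by test functions. -/
lemma IsH1cBdd.exists_approx (hG : IsOpen G) {φ : Euc N → ℝ} {h : Euc N → Euc N}
    (hφ : IsH1cBdd G φ h) :
    ∃ K ⊆ G, IsCompact K ∧ (∀ᵐ x ∂volume.restrict G, x ∉ K → φ x = 0) ∧
      (∀ᵐ x ∂volume.restrict G, x ∉ K → h x = 0) ∧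
      ∃ η : ℕ → Euc N → ℝ, (∀ n, IsTestIn G (η n)) ∧ (∀ n, tsupport (η n) ⊆ K) ∧
        Tendsto (fun n => eLpNorm (fun x => η n x - φ x) 2 (volume.restrict K)) atTop (𝓝 0) ∧
        Tendsto (fun n => eLpNorm (fun x => gradient (η n) x - h x) 2 (volume.restrict K))
          atTop (𝓝 0) := by
  obtain ⟨K, hKG, hK, h0⟩ := hφ.support
  have h1 := hφ.hasWeakGradOn.ae_grad_eq_zero hG hφ.memLp_grad hK.isClosed h0
  obtain ⟨δ, hδ, hδG⟩ := hK.exists_cthickening_subset_open hG hKG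
  have hKc : IsCompact (Metric.cthickening δ K) := hK.cthickening
  have hle : volume.restrict K ≤ volume.restrict G := Measure.restrict_mono hKG le_rfl
  have hL1 : MemLp (K.indicator φ) 2 volume :=
    (memLp_indicator_iff_restrict hK.measurableSet).2 (hφ.memLp.mono_measure hle)
  have hL2 : MemLp (K.indicator h) 2 volume :=
    (memLp_indicator_iff_restrict hK.measurableSet).2 (hφ.memLp_grad.mono_measure hle)
  have hl1 := hL1.locallyIntegrable (by norm_num)
  have hl2 := hL2.locallyIntegrable (by norm_num)
  let k := molSeq N δ hδ
  have hk : ∀ n, IsMollifier (k n) δ := isMollifier_molSeq' N δ hδ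
  have hs : ∀ n, tsupport (mol (k n) (K.indicator φ)) ⊆ Metric.cthickening δ K := fun n => by
    refine closure_minimal (fun x hx => ?_) Metric.isClosed_cthickening
    by_contra hxn
    refine hx ?_
    rw [mol_apply]
    refine integral_eq_zero_of_ae (Eventually.of_forall fun z => ?_)
    by_cases hz : z ∈ K
    · have : δ < ‖x - z‖ := by
        by_contra hle
        rw [not_lt, ← dist_eq_norm] at hle
        exact hxn (Metric.mem_cthickening_of_dist_le x z δ K hz hle)
      simp [(hk n).eq_zero this]
    · simp [Set.indicator_of_notMem hz]
  -- Extended by zero, `φ` has a weak gradient on the whole space, so mollification commutes with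
  -- the gradient right up to the edge of `K`.
  have hw := fun k hk hkc e => hφ.hasWeakGradOn.extend hG hK hKG h0 h1 (k := k) hk hkc e
  have hgr : ∀ n x, gradient (mol (k n) (K.indicator φ)) x = mol (k n) (K.indicator h) x :=
    fun n x => gradient_mol_of_weak hl1 hl2 hw (hk n).smooth (hk n).compact x
  have hae1 : ∀ᵐ x ∂volume.restrict (Metric.cthickening δ K), K.indicator φ x = φ x := by
    filter_upwards [ae_restrict_of_ae_restrict_of_subset hδG h0] with x hx
    by_cases hxK : x ∈ K
    · rw [Set.indicator_of_mem hxK]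
    · rw [Set.indicator_of_notMem hxK, hx hxK]
  have hae2 : ∀ᵐ x ∂volume.restrict (Metric.cthickening δ K), K.indicator h x = h x := by
    filter_upwards [ae_restrict_of_ae_restrict_of_subset hδG h1] with x hx
    by_cases hxK : x ∈ K
    · rw [Set.indicator_of_mem hxK]
    · rw [Set.indicator_of_notMem hxK, hx hxK]
  refine ⟨Metric.cthickening δ K, hδG, hKc,
    h0.mono fun x hx hx' => hx fun h' => hx' (Metric.self_subset_cthickening K h'),
    h1.mono fun x hx hx' => hx fun h' => hx' (Metric.self_subset_cthickening K h'),
    fun n => mol (k n) (K.indicator φ), fun n => ⟨contDiff_mol (hk n).smooth (hk n).compact hl1,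
      HasCompactSupport.of_support_subset_isCompact hKc ((subset_tsupport _).trans (hs n)),
      (hs n).trans hδG⟩, hs, tendsto_eLpNorm_two ?_, tendsto_eLpNorm_two ?_⟩
  · refine tendsto_of_tendsto_of_tendsto_of_le_of_le tendsto_const_nhds (tendsto_mol_L2 hδ hL1)
      (fun n => zero_le) fun n => ?_
    refine le_trans (le_of_eq ?_) (setLIntegral_le_lintegral (Metric.cthickening δ K) _)
    refine lintegral_congr_ae ?_
    filter_upwards [hae1] with x hx
    rw [hx]
  · refine tendsto_of_tendsto_of_tendsto_of_le_of_le tendsto_const_nhds (tendsto_mol_L2 hδ hL2)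
      (fun n => zero_le) fun n => ?_
    refine le_trans (le_of_eq ?_) (setLIntegral_le_lintegral (Metric.cthickening δ K) _)
    refine lintegral_congr_ae ?_
    filter_upwards [hae2] with x hx
    rw [hx, hgr]

/-- A weak equation that holds for test functions extends to compactly supported Sobolev
functions. -/
lemma IsH1Loc.integral_eq_of_isTestIn (hG : IsOpen G) {u W : Euc N → ℝ} {g : Euc N → Euc N}
    (hu : IsH1Loc G u g) (hW : Measurable W) {M : ℝ} (hWM : ∀ x ∈ G, |W x| ≤ M)
    (heq : ∀ k, IsTestIn G k → ∫ x in G, ⟪g x, gradient k x⟫_ℝ = ∫ x in G, W x * u x * k x)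
    {φ : Euc N → ℝ} {h : Euc N → Euc N} (hφ : IsH1cBdd G φ h) :
    Integrable (fun x => u x * φ x) (volume.restrict G) ∧
      ∫ x in G, ⟪g x, h x⟫_ℝ = ∫ x in G, W x * u x * φ x := by
  obtain ⟨K, hKG, hK, h0, h1, η, hη, hηK, hl1, hl2⟩ := hφ.exists_approx hG
  have hle : volume.restrict K ≤ volume.restrict G := Measure.restrict_mono hKG le_rfl
  have hη1 : ∀ n, MemLp (η n) 2 (volume.restrict K) := fun n => (hη n).isH1cBdd.memLp.mono_measure hle
  have hη2 : ∀ n, MemLp (gradient (η n)) 2 (volume.restrict K) := fun n =>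
    (hη n).isH1cBdd.memLp_grad.mono_measure hle
  have hφ1 := hφ.memLp.mono_measure hle
  have hφ2 := hφ.memLp_grad.mono_measure hle
  have hu1 := hu.memLp K hKG hK
  have hu2 := hu.memLp_grad K hKG hK
  have hWu : MemLp (fun x => W x * u x) 2 (volume.restrict K) := by
    refine hu1.of_le_mul (c := M) (hW.aestronglyMeasurable.mul hu1.1) ?_
    filter_upwards [ae_restrict_mem hK.measurableSet] with x hx
    rw [norm_mul]
    exact mul_le_mul_of_nonneg_right (hWM x (hKG hx)) (norm_nonneg _)
  -- Reduces integrals over `G` to the compact `K`, the only place where `u` and `g` are known to be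
  -- square integrable.
  have hcut : ∀ F : Euc N → ℝ, (∀ᵐ x ∂volume.restrict G, x ∉ K → F x = 0) →
      ∫ x in G, F x = ∫ x in K, F x := fun F hF => by
    refine setIntegral_eq_of_subset_of_ae_sdiff_eq_zero hG.measurableSet.nullMeasurableSet hKG ?_
    filter_upwards [(ae_restrict_iff' hG.measurableSet).1 hF] with x hx hx'
    exact hx hx'.1 hx'.2
  rw [← tendsto_toLp_iff hη1 hφ1] at hl1
  rw [← tendsto_toLp_iff hη2 hφ2] at hl2
  have t1 := tendsto_integral_inner (fun _ => hu2) hη2 hu2 hφ2 tendsto_const_nhds hl2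
  have t2 := tendsto_integral_mul (fun _ => hWu) hη1 hWu hφ1 tendsto_const_nhds hl1
  refine ⟨?_, ?_⟩
  · have hi : IntegrableOn (fun x => u x * φ x) K := hu1.integrable_mul hφ1
    refine hi.of_ae_sdiff_eq_zero hG.measurableSet.nullMeasurableSet ?_
    filter_upwards [(ae_restrict_iff' hG.measurableSet).1 h0] with x hx hx'
    rw [hx hx'.1 hx'.2, mul_zero]
  · rw [hcut _ (h1.mono fun x hx hx' => by rw [hx hx', inner_zero_right]),
      hcut _ (h0.mono fun x hx hx' => by rw [hx hx', mul_zero])]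
    refine tendsto_nhds_unique t1 (t2.congr fun n => ?_)
    have h2 : ∀ x ∉ K, fderiv ℝ (η n) x = 0 := fun x hx => by
      by_contra hne
      exact hx (hηK n (support_fderiv_subset ℝ hne))
    rw [← hcut (fun x => W x * u x * η n x) (Eventually.of_forall fun x hx => by
        rw [image_eq_zero_of_notMem_tsupport fun h => hx (hηK n h), mul_zero]),
      ← heq _ (hη n), hcut]
    refine Eventually.of_forall fun x hx => ?_
    rw [inner_gradient_right, h2 x hx, zero_apply]

end Density

/-! ### Homogeneous functions on the cone -/

section ConePower

variable {N : ℕ} {Ω : Set (Sph N)} {ρ : ℝ}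

/-- The extension of a vector field on the sphere that is constant along rays. -/
def vecExt (g : Sph N → Euc N) (x : Euc N) : Euc N :=
  WithLp.toLp 2 fun i => radialExt (fun θ => g θ i) x

lemma vecExt_smul (g : Sph N → Euc N) (θ : Sph N) {r : ℝ} (hr : 0 < r) :
    vecExt g (r • (θ : Euc N)) = g θ := by
  ext i
  simp [vecExt, radialExt_smul _ _ hr]

lemma measurable_vecExt {g : Sph N → Euc N} (hg : Measurable g) : Measurable (vecExt g) := by
  unfold vecExt
  refine (WithLp.measurable_toLp 2 _).comp (measurable_pi_lambda _ fun i => ?_)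
  exact measurable_radialExt ((EuclideanSpace.proj i : Euc N →L[ℝ] ℝ).measurable.comp hg)

/-- The homogeneous function `‖x‖ ^ a φ(x / ‖x‖)`. -/
def conePow (a : ℝ) (φ : Sph N → ℝ) (x : Euc N) : ℝ := ‖x‖ ^ a * radialExt φ x

/-- The gradient of `conePow a φ`, where `g` is the gradient of `φ`. -/
def conePowGrad (a : ℝ) (φ : Sph N → ℝ) (g : Sph N → Euc N) (x : Euc N) : Euc N :=
  ‖x‖ ^ (a - 1) • vecExt (fun θ => g θ + (a * φ θ) • (θ : Euc N)) x

lemma norm_smul_sph (θ : Sph N) {r : ℝ} (hr : 0 < r) : ‖r • (θ : Euc N)‖ = r := by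
  rw [norm_smul, norm_sph, mul_one, Real.norm_of_nonneg hr.le]

lemma conePow_smul (a : ℝ) (φ : Sph N → ℝ) (θ : Sph N) {r : ℝ} (hr : 0 < r) :
    conePow a φ (r • (θ : Euc N)) = r ^ a * φ θ := by
  rw [conePow, norm_smul_sph θ hr, radialExt_smul _ _ hr]

lemma conePowGrad_smul (a : ℝ) (φ : Sph N → ℝ) (g : Sph N → Euc N) (θ : Sph N) {r : ℝ}
    (hr : 0 < r) : conePowGrad a φ g (r • (θ : Euc N)) =
      r ^ (a - 1) • (g θ + (a * φ θ) • (θ : Euc N)) := by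
  rw [conePowGrad, norm_smul_sph θ hr, vecExt_smul _ _ hr]

lemma measurable_conePow (a : ℝ) {φ : Sph N → ℝ} (hφ : Measurable φ) :
    Measurable (conePow a φ) :=
  (measurable_norm.pow_const a).mul (measurable_radialExt hφ)

lemma measurable_conePowGrad (a : ℝ) {φ : Sph N → ℝ} (hφ : Measurable φ) {g : Sph N → Euc N}
    (hg : Measurable g) : Measurable (conePowGrad a φ g) :=
  (measurable_norm.pow_const (a - 1)).smul
    (measurable_vecExt (hg.add ((hφ.const_mul a).smul measurable_subtype_coe)))

lemma gradient_conePow {ψ : Sph N → ℝ} (hψ : IsTestOn Ω ψ) (a : ℝ) (θ : Sph N) {r : ℝ}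
    (hr : 0 < r) : gradient (conePow a ψ) (r • (θ : Euc N)) =
      conePowGrad a ψ (sphGrad ψ) (r • (θ : Euc N)) := by
  have h := gradient_radial_mul hψ hr (Real.hasDerivAt_rpow_const (p := a) (Or.inl hr.ne')) θ
  rw [conePowGrad_smul _ _ _ _ hr]
  refine h.trans ?_
  rw [← div_eq_mul_inv, ← Real.rpow_sub_one hr.ne', smul_add, smul_smul, add_comm]
  congr 2
  ring

lemma contDiffAt_conePow {ψ : Sph N → ℝ} (hψ : IsTestOn Ω ψ) (a : ℝ) {x : Euc N} (hx : x ≠ 0) :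
    ContDiffAt ℝ ∞ (conePow a ψ) x :=
  ((Real.contDiffAt_rpow_const_of_ne (norm_ne_zero_iff.2 hx)).comp x (contDiffAt_norm ℝ hx)).mul
    (contDiffAt_radialExt hψ.1 hx)

lemma integrableOn_indicator_rpow (hρ : 0 < ρ) (b R : ℝ) :
    IntegrableOn ((Set.Iic R).indicator fun r : ℝ => r ^ b) (Set.Ioi ρ) (radMeas N) := by
  rw [integrableOn_radMeas_iff hρ.le]
  refine IntegrableOn.of_forall_sdiff_eq_zero (s := Set.Icc ρ R) ?_ measurableSet_Ioi
    fun r hr => ?_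
  · have hc : ContinuousOn (fun r : ℝ => r ^ (N - 1) * r ^ b) (Set.Icc ρ R) :=
      (continuous_pow _).continuousOn.mul (continuousOn_id.rpow_const fun r hr =>
        Or.inl (hρ.trans_le hr.1).ne')
    refine (hc.integrableOn_compact isCompact_Icc).congr_fun (fun r hr => ?_) measurableSet_Icc
    dsimp only
    rw [Set.indicator_of_mem (show r ∈ Set.Iic R from hr.2)]
  · have : r ∉ Set.Iic R := fun h => hr.2 ⟨(Set.mem_Ioi.1 hr.1).le, h⟩
    rw [Set.indicator_of_notMem this, mul_zero]

/-- The radial factor in the `L²` bound for homogeneous functions on a bounded part of a cone. -/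
def radConst (N : ℕ) (ρ b R : ℝ) : ℝ≥0∞ :=
  ∫⁻ r in Set.Ioi ρ, ENNReal.ofReal ((Set.Iic R).indicator (fun r : ℝ => r ^ (b * 2)) r) ∂radMeas N

lemma radConst_ne_top (hρ : 0 < ρ) (b R : ℝ) : radConst N ρ b R ≠ ⊤ :=
  (integrableOn_indicator_rpow hρ (b * 2) R).lintegral_lt_top.ne

lemma lintegral_enorm_sq {α F : Type*} [MeasurableSpace α] [NormedAddCommGroup F] {μ : Measure α}
    (f : α → F) : ∫⁻ x, ‖f x‖ₑ ^ 2 ∂μ = eLpNorm f 2 μ ^ 2 := by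
  rw [eLpNorm_eq_lintegral_rpow_enorm_toReal (by norm_num) (by norm_num)]
  simp only [ENNReal.toReal_ofNat, ENNReal.rpow_ofNat]
  rw [← ENNReal.rpow_natCast, ← ENNReal.rpow_mul]
  norm_num

/-- A function dominated by `r ^ b` times an angular function has its norm bounded by a product in
polar coordinates. The radial factor is finite for every exponent because `0 < ρ`. Applied to
functions, gradients and their differences alike. -/
lemma eLpNorm_cone_le (hN : 0 < N) (hΩ : IsOpen Ω) (hρ : 0 < ρ) {b : ℝ} (R : ℝ) {E E' : Type*}
    [NormedAddCommGroup E] [MeasurableSpace E] [OpensMeasurableSpace E]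
    [NormedAddCommGroup E'] [MeasurableSpace E'] [OpensMeasurableSpace E']
    {F : Euc N → E} {Φ : Sph N → E'} (hF : Measurable F) (hΦ : Measurable Φ)
    (h : ∀ (θ : Sph N) (r : ℝ), 0 < r → ‖F (r • (θ : Euc N))‖ ≤ r ^ b * ‖Φ θ‖) :
    eLpNorm F 2 (volume.restrict (cone Ω ρ ∩ Metric.closedBall 0 R)) ≤
      radConst N ρ b R ^ (1 / 2 : ℝ) * eLpNorm Φ 2 ((surf N).restrict Ω) := by
  have key : ∫⁻ x in cone Ω ρ ∩ Metric.closedBall 0 R, ‖F x‖ₑ ^ 2 ≤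
      eLpNorm Φ 2 ((surf N).restrict Ω) ^ 2 * radConst N ρ b R := by
    have hm : Measurable fun x => (Metric.closedBall 0 R).indicator (fun x => ‖F x‖ₑ ^ 2) x :=
      (hF.enorm.pow_const 2).indicator Metric.isClosed_closedBall.measurableSet
    rw [Set.inter_comm, ← Measure.restrict_restrict Metric.isClosed_closedBall.measurableSet,
      ← lintegral_indicator Metric.isClosed_closedBall.measurableSet,
      ← (measurePreserving_pol_cone hN hΩ hρ.le).lintegral_comp hm, ← lintegral_enorm_sq, radConst,
      ← lintegral_prod_mul (hΦ.enorm.pow_const 2).aemeasurable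
        (by
          refine (Measurable.ennreal_ofReal ?_).aemeasurable
          exact (measurable_id.pow_const _).indicator measurableSet_Iic)]
    refine lintegral_mono_ae ?_
    filter_upwards [ae_prod_lt hρ.le] with p hp
    have hn := norm_smul_sph p.1 hp.1
    rw [pol]
    by_cases hR : p.2 ≤ R
    · rw [Set.indicator_of_mem (by simpa [hn] using hR), Set.indicator_of_mem (Set.mem_Iic.2 hR),
        Real.rpow_mul hp.1.le, ← ofReal_norm, ← ofReal_norm, ← ENNReal.ofReal_pow (norm_nonneg _),
        ← ENNReal.ofReal_pow (norm_nonneg _), ← ENNReal.ofReal_mul (by positivity)]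
      refine ENNReal.ofReal_le_ofReal ?_
      refine (pow_le_pow_left₀ (norm_nonneg _) (h p.1 p.2 hp.1) 2).trans_eq ?_
      rw [Real.rpow_two]
      ring
    · rw [Set.indicator_of_notMem (by simpa [hn] using hR)]
      exact zero_le
  refine (eLpNorm_two_le key).trans_eq ?_
  rw [ENNReal.mul_rpow_of_nonneg _ _ (by norm_num), ← ENNReal.rpow_natCast, ← ENNReal.rpow_mul,
    mul_comm]
  norm_num

lemma norm_conePow_le (a : ℝ) (φ : Sph N → ℝ) (θ : Sph N) (r : ℝ) (hr : 0 < r) :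
    ‖conePow a φ (r • (θ : Euc N))‖ ≤ r ^ a * ‖φ θ‖ := by
  rw [conePow_smul _ _ _ hr, norm_mul, Real.norm_of_nonneg (Real.rpow_nonneg hr.le _)]

lemma norm_conePowGrad_le (a : ℝ) (φ : Sph N → ℝ) (g : Sph N → Euc N) (θ : Sph N) (r : ℝ)
    (hr : 0 < r) : ‖conePowGrad a φ g (r • (θ : Euc N))‖ ≤
      r ^ (a - 1) * ‖g θ + (a * φ θ) • (θ : Euc N)‖ := by
  rw [conePowGrad_smul _ _ _ _ hr, norm_smul, Real.norm_of_nonneg (Real.rpow_nonneg hr.le _)]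

lemma memLp_smul_sph {μ : Measure (Sph N)} {φ : Sph N → ℝ} (hφ : MemLp φ 2 μ) :
    MemLp (fun θ => φ θ • (θ : Euc N)) 2 μ := by
  refine hφ.of_le (hφ.1.smul continuous_subtype_val.aestronglyMeasurable)
    (Eventually.of_forall fun θ => ?_)
  rw [norm_smul, norm_sph, mul_one]

lemma memLp_conePow (hN : 0 < N) (hΩ : IsOpen Ω) (hρ : 0 < ρ) (a R : ℝ) {φ : Sph N → ℝ}
    (hφm : Measurable φ) (hφ : MemLp φ 2 ((surf N).restrict Ω)) :
    MemLp (conePow a φ) 2 (volume.restrict (cone Ω ρ ∩ Metric.closedBall 0 R)) :=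
  ⟨(measurable_conePow a hφm).aestronglyMeasurable,
    (eLpNorm_cone_le hN hΩ hρ R (measurable_conePow a hφm) hφm (norm_conePow_le a φ)).trans_lt
      (ENNReal.mul_lt_top (ENNReal.rpow_lt_top_of_nonneg (by norm_num) (radConst_ne_top hρ a R))
        hφ.2)⟩

lemma memLp_conePowGrad (hN : 0 < N) (hΩ : IsOpen Ω) (hρ : 0 < ρ) (a R : ℝ) {φ : Sph N → ℝ}
    {g : Sph N → Euc N} (hφm : Measurable φ) (hgm : Measurable g)
    (hφ : MemLp φ 2 ((surf N).restrict Ω)) (hg : MemLp g 2 ((surf N).restrict Ω)) :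
    MemLp (conePowGrad a φ g) 2 (volume.restrict (cone Ω ρ ∩ Metric.closedBall 0 R)) :=
  ⟨(measurable_conePowGrad a hφm hgm).aestronglyMeasurable,
    (eLpNorm_cone_le hN hΩ hρ R (measurable_conePowGrad a hφm hgm)
      (hgm.add ((hφm.const_mul a).smul measurable_subtype_coe)) (norm_conePowGrad_le a φ g)).trans_lt
      (ENNReal.mul_lt_top (ENNReal.rpow_lt_top_of_nonneg (by norm_num) (radConst_ne_top hρ (a - 1) R))
        (hg.add (memLp_smul_sph (hφ.const_mul a))).2)⟩

lemma tendsto_conePow (hN : 0 < N) (hΩ : IsOpen Ω) (hρ : 0 < ρ) (a R : ℝ) {φ : Sph N → ℝ}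
    (hφm : Measurable φ) {ψ : ℕ → Sph N → ℝ} (hψ : ∀ n, IsTestOn Ω (ψ n))
    (h : Tendsto (fun n => eLpNorm (fun θ => ψ n θ - φ θ) 2 ((surf N).restrict Ω)) atTop (𝓝 0)) :
    Tendsto (fun n => eLpNorm (fun x => conePow a (ψ n) x - conePow a φ x) 2
      (volume.restrict (cone Ω ρ ∩ Metric.closedBall 0 R))) atTop (𝓝 0) := by
  have h2 := ENNReal.Tendsto.const_mul (a := radConst N ρ a R ^ (1 / 2 : ℝ)) h
    (Or.inr (ENNReal.rpow_lt_top_of_nonneg (by norm_num) (radConst_ne_top hρ _ _)).ne)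
  rw [mul_zero] at h2
  refine tendsto_of_tendsto_of_tendsto_of_le_of_le tendsto_const_nhds h2 (fun n => zero_le)
    fun n => ?_
  refine eLpNorm_cone_le hN hΩ hρ R ((measurable_conePow a (hψ n).continuous.measurable).sub
    (measurable_conePow a hφm)) ((hψ n).continuous.measurable.sub hφm) fun θ r hr => ?_
  rw [conePow_smul _ _ _ hr, conePow_smul _ _ _ hr, ← mul_sub, norm_mul,
    Real.norm_of_nonneg (Real.rpow_nonneg hr.le _)]

lemma tendsto_conePowGrad (hN : 0 < N) (hΩ : IsOpen Ω) (hρ : 0 < ρ) (a R : ℝ) {φ : Sph N → ℝ}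
    {g : Sph N → Euc N} (hφm : Measurable φ) (hgm : Measurable g)
    (hφ : MemLp φ 2 ((surf N).restrict Ω)) (hg : MemLp g 2 ((surf N).restrict Ω))
    {ψ : ℕ → Sph N → ℝ} (hψ : ∀ n, IsTestOn Ω (ψ n))
    (h : Tendsto (fun n => eLpNorm (fun θ => ψ n θ - φ θ) 2 ((surf N).restrict Ω)) atTop (𝓝 0))
    (h' : Tendsto (fun n => eLpNorm (fun θ => sphGrad (ψ n) θ - g θ) 2 ((surf N).restrict Ω))
      atTop (𝓝 0)) :
    Tendsto (fun n => eLpNorm (fun x => conePowGrad a (ψ n) (sphGrad (ψ n)) x - conePowGrad a φ g x)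
      2 (volume.restrict (cone Ω ρ ∩ Metric.closedBall 0 R))) atTop (𝓝 0) := by
  have h1 := h'.add (ENNReal.Tendsto.const_mul (a := ‖a‖ₑ) h (Or.inr enorm_ne_top))
  have h2 := ENNReal.Tendsto.const_mul (a := radConst N ρ (a - 1) R ^ (1 / 2 : ℝ)) h1
    (Or.inr (ENNReal.rpow_lt_top_of_nonneg (by norm_num) (radConst_ne_top hρ _ _)).ne)
  rw [mul_zero, add_zero, mul_zero] at h2
  refine tendsto_of_tendsto_of_tendsto_of_le_of_le tendsto_const_nhds h2 (fun n => zero_le)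
    fun n => ?_
  have hψm := (hψ n).continuous.measurable
  have hψgm := (hψ n).continuous_sphGrad.measurable
  refine (eLpNorm_cone_le hN hΩ hρ R (b := a - 1)
    (Φ := fun θ => (sphGrad (ψ n) θ - g θ) + (a * (ψ n θ - φ θ)) • (θ : Euc N))
    ((measurable_conePowGrad a hψm hψgm).sub (measurable_conePowGrad a hφm hgm))
    ((hψgm.sub hgm).add (((hψm.sub hφm).const_mul a).smul measurable_subtype_coe))
    fun θ r hr => ?_).trans ?_
  · rw [Pi.sub_apply, conePowGrad_smul _ _ _ _ hr, conePowGrad_smul _ _ _ _ hr, ← smul_sub, norm_smul,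
      Real.norm_of_nonneg (Real.rpow_nonneg hr.le _)]
    refine le_of_eq ?_
    congr 2
    module
  · have hd1 := ((hψ n).memLp_sphGrad 2 Ω).sub hg
    have hd2 := ((hψ n).memLp 2 Ω).sub hφ
    refine mul_le_mul_right ((eLpNorm_add_le hd1.1
      (memLp_smul_sph (hd2.const_mul a)).1 (by norm_num)).trans ?_) _
    refine add_le_add le_rfl ?_
    refine le_trans (eLpNorm_mono (g := fun θ => a * (ψ n θ - φ θ)) fun θ => ?_)
      (eLpNorm_const_smul_le (c := a) (f := fun θ => ψ n θ - φ θ))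
    rw [norm_smul, norm_sph, mul_one]
    rfl

lemma integral_fderiv_eq_zero {k : Euc N → ℝ} (hk : ContDiff ℝ ∞ k) (hc : HasCompactSupport k)
    (e : Euc N) : ∫ x, fderiv ℝ k x e = 0 := by
  simp_rw [fderiv_eq_sum_pd]
  rw [integral_finsetSum]
  · refine Finset.sum_eq_zero fun i _ => ?_
    rw [integral_const_mul, integral_pd_eq_zero hk hc, mul_zero]
  · intro i _
    refine Integrable.const_mul ?_ _
    exact (contDiff_pd hk i).continuous.integrable_of_hasCompactSupport
      (hc.mono' ((subset_tsupport _).trans (tsupport_pd_subset i k)))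

lemma setIntegral_cone_inter_ball (hΩ : IsOpen Ω) (hρ : 0 ≤ ρ) {R : ℝ} {K : Set (Euc N)}
    (hK : K ⊆ Metric.closedBall 0 R) {F : Euc N → ℝ} (hF : ∀ x ∉ K, F x = 0) :
    ∫ x in cone Ω ρ, F x = ∫ x in cone Ω ρ ∩ Metric.closedBall 0 R, F x :=
  setIntegral_eq_of_subset_of_forall_sdiff_eq_zero (isOpen_cone hΩ hρ).measurableSet
    Set.inter_subset_left fun x hx => hF x fun h => hx.2 ⟨hx.1, hK h⟩

lemma fderiv_eq_zero_of_notMem {k : Euc N → ℝ} {x : Euc N} (hx : x ∉ tsupport k) :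
    fderiv ℝ k x = 0 := by
  by_contra hne
  exact hx (support_fderiv_subset ℝ hne)

lemma IsTestIn.hasCompactSupport_gradient {G : Set (Euc N)} {k : Euc N → ℝ} (hk : IsTestIn G k) :
    HasCompactSupport (gradient k) :=
  hk.compact.mono' fun x hx => by
    by_contra h
    exact hx (by simp [gradient, fderiv_eq_zero_of_notMem h])

/-- The product with `η` is smooth on the whole space, as `η` vanishes near the origin, so the
integral of its derivative is zero; the product rule does the rest. -/
lemma weakGrad_conePow_test (hN : 0 < N) (hΩ : IsOpen Ω) (hρ : 0 < ρ) (a : ℝ) {ψ : Sph N → ℝ}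
    (hψ : IsTestOn Ω ψ) : HasWeakGradOn (cone Ω ρ) (conePow a ψ) (conePowGrad a ψ (sphGrad ψ)) := by
  intro η hη hηc hηs e
  obtain ⟨R, hR⟩ := hηc.isCompact.isBounded.subset_closedBall 0
  have hψm := hψ.continuous.measurable
  have hψgm := hψ.continuous_sphGrad.measurable
  have h0 : (0 : Euc N) ∉ tsupport η := fun h => by
    have := norm_lt_of_mem_cone hρ.le (hηs h)
    rw [norm_zero] at this
    linarith
  have hk : ContDiff ℝ ∞ fun x => conePow a ψ x * η x := contDiff_iff_contDiffAt.2 fun x => by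
    rcases eq_or_ne x 0 with rfl | hx
    · refine (contDiffAt_const (c := (0 : ℝ))).congr_of_eventuallyEq ?_
      filter_upwards [(isClosed_tsupport η).isOpen_compl.mem_nhds h0] with x hx
      rw [image_eq_zero_of_notMem_tsupport hx, mul_zero]
    · exact (contDiffAt_conePow hψ a hx).mul hη.contDiffAt
  have hz := integral_fderiv_eq_zero hk hηc.mul_left e
  have hsub : tsupport (fun x => conePow a ψ x * η x) ⊆ tsupport η := tsupport_mul_subset_right
  rw [← setIntegral_eq_integral_of_forall_compl_eq_zero (s := cone Ω ρ) fun x hx => by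
    rw [fderiv_eq_zero_of_notMem fun h => hx (hηs (hsub h)), zero_apply]] at hz
  have hder : ∀ x ∈ cone Ω ρ, fderiv ℝ (fun x => conePow a ψ x * η x) x e =
      conePow a ψ x * fderiv ℝ η x e + ⟪conePowGrad a ψ (sphGrad ψ) x, e⟫_ℝ * η x := by
    rintro _ ⟨r, hr, θ, -, rfl⟩
    have hr0 := hρ.trans hr
    have hx := sph_smul_ne_zero θ hr0
    have h1 := ((contDiffAt_conePow hψ a hx).differentiableAt (by simp)).hasFDerivAt.mul
      ((hη.differentiable (by simp)) (r • (θ : Euc N))).hasFDerivAt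
    refine (congrArg (fun L : Euc N →L[ℝ] ℝ => L e) h1.fderiv).trans ?_
    rw [← gradient_conePow hψ a θ hr0, real_inner_comm, inner_gradient_right]
    simp [mul_comm]
  rw [setIntegral_congr_fun (isOpen_cone hΩ hρ.le).measurableSet hder] at hz
  have hm1 := memLp_conePow hN hΩ hρ a R hψm (hψ.memLp 2 Ω)
  have hm2 := memLp_conePowGrad hN hΩ hρ a R hψm hψgm (hψ.memLp 2 Ω) (hψ.memLp_sphGrad 2 Ω)
  have hd : MemLp (fun x => fderiv ℝ η x e) 2
      (volume.restrict (cone Ω ρ ∩ Metric.closedBall 0 R)) :=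
    (((hη.continuous_fderiv (by simp)).clm_apply continuous_const).memLp_of_hasCompactSupport
      (hηc.fderiv_apply ℝ e)).restrict _
  have hL : MemLp (fun x => η x • e) 2 (volume.restrict (cone Ω ρ ∩ Metric.closedBall 0 R)) :=
    ((hη.continuous.smul continuous_const).memLp_of_hasCompactSupport hηc.smul_right).restrict _
  have hi2 : Integrable (fun x => ⟪conePowGrad a ψ (sphGrad ψ) x, e⟫_ℝ * η x)
      (volume.restrict (cone Ω ρ ∩ Metric.closedBall 0 R)) := by
    refine (integrable_inner_of_memLp hm2 hL).congr (Eventually.of_forall fun x => ?_)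
    simp only [real_inner_smul_right]
    ring
  have hv1 : ∀ x ∉ tsupport η, conePow a ψ x * fderiv ℝ η x e = 0 := fun x hx => by
    rw [fderiv_eq_zero_of_notMem hx, zero_apply, mul_zero]
  have hv2 : ∀ x ∉ tsupport η, ⟪conePowGrad a ψ (sphGrad ψ) x, e⟫_ℝ * η x = 0 := fun x hx => by
    rw [image_eq_zero_of_notMem_tsupport hx, mul_zero]
  rw [setIntegral_cone_inter_ball hΩ hρ.le hR fun x hx => by rw [hv1 x hx, hv2 x hx, add_zero],
    integral_add (by exact hm1.integrable_mul hd) hi2] at hz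
  rw [setIntegral_cone_inter_ball hΩ hρ.le hR hv1, setIntegral_cone_inter_ball hΩ hρ.le hR hv2]
  linarith

/-- The integration by parts formula passes to the limit along the test functions approximating `φ`,
since `H¹` convergence on `Ω` gives convergence on bounded pieces of the cone. -/
lemma isH1Loc_conePow (hN : 0 < N) (hΩ : IsOpen Ω) (hρ : 0 < ρ) (a : ℝ) {φ : Sph N → ℝ}
    {g : Sph N → Euc N} (hφm : Measurable φ) (hgm : Measurable g) (hH : IsH10 Ω φ g) :
    IsH1Loc (cone Ω ρ) (conePow a φ) (conePowGrad a φ g) := by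
  obtain ⟨hφ, hg, ψ, hψ, hl1, hl2⟩ := hH
  have hle : ∀ K ⊆ cone Ω ρ, IsCompact K → ∃ R : ℝ, volume.restrict K ≤
      volume.restrict (cone Ω ρ ∩ Metric.closedBall (0 : Euc N) R) := fun K hK hKc => by
    obtain ⟨R, hR⟩ := hKc.isBounded.subset_closedBall 0
    exact ⟨R, Measure.restrict_mono (Set.subset_inter hK hR) le_rfl⟩
  refine ⟨fun K hK hKc => ?_, fun K hK hKc => ?_, fun η hη hηc hηs e => ?_⟩
  · obtain ⟨R, hR⟩ := hle K hK hKc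
    exact (memLp_conePow hN hΩ hρ a R hφm hφ).mono_measure hR
  · obtain ⟨R, hR⟩ := hle K hK hKc
    exact (memLp_conePowGrad hN hΩ hρ a R hφm hgm hφ hg).mono_measure hR
  · obtain ⟨R, hR⟩ := hηc.isCompact.isBounded.subset_closedBall 0
    have hd : MemLp (fun x => fderiv ℝ η x e) 2
        (volume.restrict (cone Ω ρ ∩ Metric.closedBall 0 R)) :=
      (((hη.continuous_fderiv (by simp)).clm_apply continuous_const).memLp_of_hasCompactSupport
        (hηc.fderiv_apply ℝ e)).restrict _
    have hL : MemLp (fun x => η x • e) 2 (volume.restrict (cone Ω ρ ∩ Metric.closedBall 0 R)) :=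
      ((hη.continuous.smul continuous_const).memLp_of_hasCompactSupport hηc.smul_right).restrict _
    have hm1 := fun n => memLp_conePow hN hΩ hρ a R (hψ n).continuous.measurable
      ((hψ n).memLp 2 Ω)
    have hm2 := fun n => memLp_conePowGrad hN hΩ hρ a R (hψ n).continuous.measurable
      (hψ n).continuous_sphGrad.measurable ((hψ n).memLp 2 Ω) ((hψ n).memLp_sphGrad 2 Ω)
    have t1 := tendsto_integral_mul hm1 (fun _ => hd) (memLp_conePow hN hΩ hρ a R hφm hφ) hd
      ((tendsto_toLp_iff _ _).2 (tendsto_conePow hN hΩ hρ a R hφm hψ hl1)) tendsto_const_nhds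
    have t2 := tendsto_integral_inner hm2 (fun _ => hL)
      (memLp_conePowGrad hN hΩ hρ a R hφm hgm hφ hg) hL
      ((tendsto_toLp_iff _ _).2 (tendsto_conePowGrad hN hΩ hρ a R hφm hgm hφ hg hψ hl1 hl2))
      tendsto_const_nhds
    have hsm : ∀ w : Euc N → Euc N, ∀ x, ⟪w x, η x • e⟫_ℝ = ⟪w x, e⟫_ℝ * η x := fun w x => by
      rw [real_inner_smul_right, mul_comm]
    have hv1 : ∀ w : Euc N → ℝ, ∀ x ∉ tsupport η, w x * fderiv ℝ η x e = 0 := fun w x hx => by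
      rw [fderiv_eq_zero_of_notMem hx, zero_apply, mul_zero]
    have hv2 : ∀ w : Euc N → Euc N, ∀ x ∉ tsupport η, ⟪w x, e⟫_ℝ * η x = 0 := fun w x hx => by
      rw [image_eq_zero_of_notMem_tsupport hx, mul_zero]
    simp_rw [hsm] at t2
    rw [setIntegral_cone_inter_ball hΩ hρ.le hR (hv1 _),
      setIntegral_cone_inter_ball hΩ hρ.le hR (hv2 _)]
    refine tendsto_nhds_unique t1 (t2.neg.congr fun n => ?_)
    rw [← setIntegral_cone_inter_ball hΩ hρ.le hR (hv1 _),
      ← setIntegral_cone_inter_ball hΩ hρ.le hR (hv2 _)]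
    exact (weakGrad_conePow_test hN hΩ hρ a (hψ n) η hη hηc hηs e).symm

end ConePower

/-! ### Sufficiency: a power of the radius times the ground state -/

section Sufficiency

variable {N : ℕ} {Ω : Set (Sph N)} {ρ : ℝ}

lemma ae_cone_iff (hN : 0 < N) (hΩ : IsOpen Ω) (hρ : 0 ≤ ρ) {Q : Euc N → Prop}
    (hQ : MeasurableSet {x | Q x}) :
    (∀ᵐ x ∂volume.restrict (cone Ω ρ), Q x) ↔
      ∀ᵐ p ∂((surf N).restrict Ω).prod ((radMeas N).restrict (Set.Ioi ρ)), Q (pol p) := by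
  have h := measurePreserving_pol_cone hN hΩ hρ
  rw [← h.map_eq, ae_map_iff h.measurable.aemeasurable hQ]

lemma radMeas_Ioi_ne_zero (hρ : 0 ≤ ρ) : (radMeas N).restrict (Set.Ioi ρ) ≠ 0 := by
  intro h
  rw [Measure.restrict_eq_zero, radMeas, withDensity_apply _ measurableSet_Ioi,
    lintegral_eq_zero_iff (measurable_ofReal_pow _), Measure.restrict_restrict measurableSet_Ioi,
    Set.inter_eq_left.2 (Set.Ioi_subset_Ioi hρ)] at h
  have h2 : ∀ᵐ r : ℝ ∂volume.restrict (Set.Ioi ρ), False := by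
    filter_upwards [h, ae_restrict_mem measurableSet_Ioi] with r hr hr'
    have : 0 < r := hρ.trans_lt hr'
    have hp : 0 < r ^ (N - 1) := by positivity
    simp only [Pi.zero_apply, ENNReal.ofReal_eq_zero] at hr
    linarith
  rw [ae_iff] at h2
  simp at h2

/-- Almost every ray carries the property at some radius, because the radial measure is nonzero. -/
lemma ae_of_ae_prod (hρ : 0 ≤ ρ) {Q : Sph N → Prop}
    (h : ∀ᵐ p ∂((surf N).restrict Ω).prod ((radMeas N).restrict (Set.Ioi ρ)), Q p.1) :
    ∀ᵐ θ ∂(surf N).restrict Ω, Q θ := by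
  filter_upwards [Measure.ae_ae_of_ae_prod h] with θ hθ
  have : (ae ((radMeas N).restrict (Set.Ioi ρ))).NeBot := ae_neBot.2 (radMeas_Ioi_ne_zero hρ)
  obtain ⟨-, hr⟩ := hθ.exists
  exact hr

/-- Tangency passes from test functions to the `L²` limit along an almost everywhere convergent
subsequence. It is what allows `sphGrad_restrict` to be used with `g`. -/
lemma IsH10.ae_inner_eq_zero {φ : Sph N → ℝ} {g : Sph N → Euc N} (h : IsH10 Ω φ g) :
    ∀ᵐ θ ∂(surf N).restrict Ω, ⟪g θ, (θ : Euc N)⟫_ℝ = 0 := by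
  obtain ⟨-, hg, ψ, hψ, -, hl⟩ := h
  obtain ⟨σ, -, hσ⟩ := (tendstoInMeasure_of_tendsto_eLpNorm (by norm_num)
    (fun n => ((hψ n).memLp_sphGrad 2 Ω).1) hg.1 hl).exists_seq_tendsto_ae
  filter_upwards [hσ] with θ hθ
  refine tendsto_nhds_unique (hθ.inner tendsto_const_nhds) ?_
  simp_rw [inner_sphGrad_self (hψ _).1]
  exact tendsto_const_nhds

lemma hasDerivAt_ray {η : Euc N → ℝ} (hη : ContDiff ℝ ∞ η) (θ : Sph N) (r : ℝ) :
    HasDerivAt (fun r : ℝ => η (r • (θ : Euc N))) ⟪(θ : Euc N), gradient η (r • (θ : Euc N))⟫_ℝ r := by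
  rw [inner_gradient_right]
  have h1 : HasDerivAt (fun r : ℝ => r • (θ : Euc N)) (θ : Euc N) r := by
    simpa using (hasDerivAt_id r).smul_const (θ : Euc N)
  exact ((hη.differentiable (by simp)) (r • (θ : Euc N))).hasFDerivAt.comp_hasDerivAt r h1

lemma integrableOn_Ioi_of_eq_zero {F : ℝ → ℝ} (hF : ContinuousOn F (Set.Ioi 0)) (hρ : 0 < ρ)
    {R : ℝ} (h0 : ∀ r, ρ < r → R < r → F r = 0) : IntegrableOn F (Set.Ioi ρ) := by
  refine IntegrableOn.of_forall_sdiff_eq_zero (s := Set.Icc ρ R) ?_ measurableSet_Ioi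
    fun r hr => h0 r hr.1 (not_le.1 fun h => hr.2 ⟨(Set.mem_Ioi.1 hr.1).le, h⟩)
  exact (hF.mono fun r hr => hρ.trans_le hr.1).integrableOn_compact isCompact_Icc

lemma pow_mul_rpow (hN : 0 < N) {r : ℝ} (hr : 0 < r) (b : ℝ) :
    r ^ (N - 1) * r ^ b = r ^ (b + N - 1) := by
  rw [← Real.rpow_natCast, ← Real.rpow_add hr, Nat.cast_sub hN]
  congr 1
  push_cast
  ring

/-- Integrate the derivative of `r ^ (a + N - 2) η(r θ)` along a ray; it vanishes at `ρ` because
that point is outside the open cone, and at infinity by compact support. -/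
lemma radial_ibp (hN : 0 < N) (hρ : 0 < ρ) {η : Euc N → ℝ} (hη : IsTestIn (cone Ω ρ) η) (θ : Sph N)
    (a : ℝ) :
    ∫ r in Set.Ioi ρ, r ^ (a - 1) * ⟪(θ : Euc N), gradient η (r • (θ : Euc N))⟫_ℝ ∂radMeas N =
      -(a + N - 2) * ∫ r in Set.Ioi ρ, r ^ (a - 2) * η (r • (θ : Euc N)) ∂radMeas N := by
  obtain ⟨R, hR⟩ := hη.compact.isCompact.isBounded.subset_closedBall 0
  have hout : ∀ r, ρ < r → R < r → r • (θ : Euc N) ∉ tsupport η := fun r h1 h2 h => by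
    have := hR h
    rw [mem_closedBall_zero_iff, norm_smul_sph θ (hρ.trans h1)] at this
    linarith
  have hz1 : ∀ r, ρ < r → R < r → η (r • (θ : Euc N)) = 0 := fun r h1 h2 =>
    image_eq_zero_of_notMem_tsupport (hout r h1 h2)
  have hz2 : ∀ r, ρ < r → R < r → ⟪(θ : Euc N), gradient η (r • (θ : Euc N))⟫_ℝ = 0 :=
    fun r h1 h2 => by
      rw [inner_gradient_right, fderiv_eq_zero_of_notMem (hout r h1 h2), zero_apply]
  have hray : Continuous fun r : ℝ => r • (θ : Euc N) := by fun_prop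
  have hc1 : Continuous fun r : ℝ => η (r • (θ : Euc N)) := hη.smooth.continuous.comp hray
  have hc2 : Continuous fun r : ℝ => ⟪(θ : Euc N), gradient η (r • (θ : Euc N))⟫_ℝ :=
    continuous_const.inner ((continuous_gradient hη.smooth).comp hray)
  have hpc : ∀ b : ℝ, ContinuousOn (fun r : ℝ => r ^ b) (Set.Ioi 0) := fun b =>
    continuousOn_id.rpow_const fun r hr => Or.inl (ne_of_gt hr)
  rw [integral_radMeas _ hρ.le, integral_radMeas _ hρ.le]
  have i1 : IntegrableOn (fun r : ℝ => (a + N - 2) * r ^ (a + N - 2 - 1) * η (r • (θ : Euc N)))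
      (Set.Ioi ρ) := by
    refine integrableOn_Ioi_of_eq_zero (((hpc _).const_mul _).mul hc1.continuousOn) hρ (R := R)
      fun r h1 h2 => ?_
    simp only [hz1 r h1 h2, mul_zero]
  have i2 : IntegrableOn (fun r : ℝ => r ^ (a + N - 2) *
      ⟪(θ : Euc N), gradient η (r • (θ : Euc N))⟫_ℝ) (Set.Ioi ρ) := by
    refine integrableOn_Ioi_of_eq_zero ((hpc _).mul hc2.continuousOn) hρ (R := R)
      fun r h1 h2 => ?_
    simp only [hz2 r h1 h2, mul_zero]
  have hd := integral_Ioi_of_hasDerivAt_of_tendsto' (a := ρ) (m := 0)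
    (f := fun r : ℝ => r ^ (a + N - 2) * η (r • (θ : Euc N)))
    (f' := fun r : ℝ => (a + N - 2) * r ^ (a + N - 2 - 1) * η (r • (θ : Euc N)) +
      r ^ (a + N - 2) * ⟪(θ : Euc N), gradient η (r • (θ : Euc N))⟫_ℝ)
    (fun r hr => (Real.hasDerivAt_rpow_const (Or.inl (hρ.trans_le hr).ne')).mul
      (hasDerivAt_ray hη.smooth θ r)) (i1.add i2)
    (by
      refine tendsto_const_nhds.congr' ?_
      filter_upwards [eventually_gt_atTop ρ, eventually_gt_atTop R] with r h1 h2
      rw [hz1 r h1 h2, mul_zero])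
  have hzρ : η (ρ • (θ : Euc N)) = 0 := by
    refine image_eq_zero_of_notMem_tsupport fun h => ?_
    have := ((pol_mem_cone hρ.le hρ).1 (hη.sub h)).2
    exact lt_irrefl _ this
  rw [integral_add i1 i2, hzρ, mul_zero, sub_zero] at hd
  have e1 : ∫ r in Set.Ioi ρ, (a + N - 2) * r ^ (a + N - 2 - 1) * η (r • (θ : Euc N)) =
      (a + N - 2) * ∫ r in Set.Ioi ρ, r ^ (N - 1) * (r ^ (a - 2) * η (r • (θ : Euc N))) := by
    rw [← integral_const_mul]
    refine setIntegral_congr_fun measurableSet_Ioi fun r hr => ?_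
    rw [← mul_assoc (r ^ (N - 1)), pow_mul_rpow hN (hρ.trans hr),
      show a - 2 + N - 1 = a + N - 2 - 1 by ring]
    ring
  have e2 : ∫ r in Set.Ioi ρ, r ^ (a + N - 2) * ⟪(θ : Euc N), gradient η (r • (θ : Euc N))⟫_ℝ =
      ∫ r in Set.Ioi ρ, r ^ (N - 1) *
        (r ^ (a - 1) * ⟪(θ : Euc N), gradient η (r • (θ : Euc N))⟫_ℝ) := by
    refine setIntegral_congr_fun measurableSet_Ioi fun r hr => ?_
    rw [← mul_assoc (r ^ (N - 1)), pow_mul_rpow hN (hρ.trans hr),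
      show a - 1 + N - 1 = a + N - 2 by ring]
  rw [e1, e2] at hd
  linarith

lemma integrable_prod_of_le (hρ : 0 < ρ) {b R C : ℝ} {T : Sph N × ℝ → ℝ} (hT : Measurable T)
    {Φ : Sph N → ℝ} (hΦ : Integrable Φ ((surf N).restrict Ω))
    (hle : ∀ θ r, 0 < r → |T (θ, r)| ≤ Φ θ * (C * r ^ b)) (h0 : ∀ θ r, 0 < r → R < r → T (θ, r) = 0) :
    Integrable T (((surf N).restrict Ω).prod ((radMeas N).restrict (Set.Ioi ρ))) := by
  refine Integrable.mono' (hΦ.mul_prod ((integrableOn_indicator_rpow hρ b R).const_mul C))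
    hT.aestronglyMeasurable ?_
  filter_upwards [ae_prod_lt hρ.le] with p hp
  by_cases hR : p.2 ≤ R
  · rw [Set.indicator_of_mem (Set.mem_Iic.2 hR)]
    exact hle _ _ hp.1
  · rw [Set.indicator_of_notMem (by simpa using hR), mul_zero, mul_zero]
    rw [show p = (p.1, p.2) from rfl, h0 _ _ hp.1 (not_le.1 hR), norm_zero]

/-- The equation satisfied by a homogeneous function on a cone. -/
lemma cone_equation (hN : 0 < N) (hΩ : IsOpen Ω) (hρ : 0 < ρ) {U : Sph N → ℝ} {M : ℝ}
    (hU : Measurable U) (hM : ∀ θ, |U θ| ≤ M) {φ : Sph N → ℝ} {g : Sph N → Euc N}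
    (hφm : Measurable φ) (hgm : Measurable g) (hH : IsH10 Ω φ g)
    (hweak : ∀ χ, IsTestOn Ω χ →
      ∫ θ in Ω, ⟪g θ, sphGrad χ θ⟫_ℝ ∂surf N = ∫ θ in Ω, U θ * φ θ * χ θ ∂surf N)
    (a : ℝ) {η : Euc N → ℝ} (hη : IsTestIn (cone Ω ρ) η) :
    ∫ x in cone Ω ρ, ⟪conePowGrad a φ g x, gradient η x⟫_ℝ =
      ∫ x in cone Ω ρ, conePotential (fun θ => U θ + -a * (a + N - 2)) x * conePow a φ x * η x := by
  have hφ := hH.1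
  have hg := hH.2.1
  have hηc := hη.smooth.continuous
  have hgc := continuous_gradient hη.smooth
  obtain ⟨R, hR⟩ := hη.compact.isCompact.isBounded.subset_closedBall 0
  obtain ⟨C₁, hC₁⟩ := hηc.bounded_above_of_compact_support hη.compact
  obtain ⟨C₂, hC₂⟩ := hgc.bounded_above_of_compact_support hη.hasCompactSupport_gradient
  have hout : ∀ (θ : Sph N) (r : ℝ), 0 < r → R < r → r • (θ : Euc N) ∉ tsupport η :=
    fun θ r h1 h2 h => by
      have := hR h
      rw [mem_closedBall_zero_iff, norm_smul_sph θ h1] at this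
      linarith
  have hz1 : ∀ (θ : Sph N) (r : ℝ), 0 < r → R < r → η (r • (θ : Euc N)) = 0 := fun θ r h1 h2 =>
    image_eq_zero_of_notMem_tsupport (hout θ r h1 h2)
  have hz2 : ∀ (θ : Sph N) (r : ℝ), 0 < r → R < r → gradient η (r • (θ : Euc N)) = 0 :=
    fun θ r h1 h2 => by simp [gradient, fderiv_eq_zero_of_notMem (hout θ r h1 h2)]
  -- `A` and `B` are the angular and radial parts of the gradient pairing; `A'` and `B'` are the
  -- contributions of `U` and of the constant `-a (a + N - 2)` to the right-hand side.
  let A : Sph N × ℝ → ℝ := fun p => p.2 ^ (a - 1) * ⟪g p.1, gradient η (pol p)⟫_ℝ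
  let B : Sph N × ℝ → ℝ := fun p =>
    a * φ p.1 * (p.2 ^ (a - 1) * ⟪(p.1 : Euc N), gradient η (pol p)⟫_ℝ)
  let A' : Sph N × ℝ → ℝ := fun p => p.2 ^ (a - 2) * (U p.1 * φ p.1 * η (pol p))
  let B' : Sph N × ℝ → ℝ := fun p => -a * (a + N - 2) * φ p.1 * (p.2 ^ (a - 2) * η (pol p))
  have hrm : ∀ b : ℝ, Measurable fun p : Sph N × ℝ => p.2 ^ b := fun b =>
    measurable_snd.pow_const b
  have hgm' : Measurable fun p : Sph N × ℝ => gradient η (pol p) :=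
    hgc.measurable.comp measurable_pol
  have hηm' : Measurable fun p : Sph N × ℝ => η (pol p) := hηc.measurable.comp measurable_pol
  have hφm' : Measurable fun p : Sph N × ℝ => φ p.1 := hφm.comp measurable_fst
  have hUm' : Measurable fun p : Sph N × ℝ => U p.1 := hU.comp measurable_fst
  have iφ : Integrable φ ((surf N).restrict Ω) := hφ.integrable (by norm_num)
  have ig : Integrable g ((surf N).restrict Ω) := hg.integrable (by norm_num)
  have iA : Integrable A (((surf N).restrict Ω).prod ((radMeas N).restrict (Set.Ioi ρ))) := by
    refine integrable_prod_of_le hρ (b := a - 1) (R := R) (C := C₂)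
      ((hrm _).mul ((hgm.comp measurable_fst).inner hgm')) ig.norm (fun θ r hr => ?_)
      fun θ r h1 h2 => ?_
    · simp only [A, pol]
      rw [abs_mul, abs_of_nonneg (Real.rpow_nonneg hr.le _)]
      calc _ ≤ r ^ (a - 1) * (‖g θ‖ * C₂) := by
            gcongr
            exact (abs_real_inner_le_norm _ _).trans (by gcongr; exact hC₂ _)
        _ = _ := by ring
    · simp only [A, pol, hz2 θ r h1 h2, inner_zero_right, mul_zero]
  have iB : Integrable B (((surf N).restrict Ω).prod ((radMeas N).restrict (Set.Ioi ρ))) := by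
    refine integrable_prod_of_le hρ (b := a - 1) (R := R) (C := C₂)
      ((hφm'.const_mul a).mul ((hrm _).mul
        ((measurable_subtype_coe.comp measurable_fst).inner hgm'))) (iφ.const_mul a).abs
      (fun θ r hr => ?_) fun θ r h1 h2 => ?_
    · simp only [B, pol]
      rw [abs_mul, abs_mul (r ^ (a - 1)), abs_of_nonneg (Real.rpow_nonneg hr.le _), mul_comm C₂]
      gcongr
      refine (abs_real_inner_le_norm _ _).trans ?_
      rw [norm_sph, one_mul]
      exact hC₂ _
    · simp only [B, pol, hz2 θ r h1 h2, inner_zero_right, mul_zero]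
  have iA' : Integrable A' (((surf N).restrict Ω).prod ((radMeas N).restrict (Set.Ioi ρ))) := by
    refine integrable_prod_of_le hρ (b := a - 2) (R := R) (C := C₁)
      ((hrm _).mul ((hUm'.mul hφm').mul hηm')) (iφ.norm.const_mul M)
      (fun θ r hr => ?_) fun θ r h1 h2 => ?_
    · simp only [A', pol]
      rw [abs_mul, abs_mul, abs_mul, abs_of_nonneg (Real.rpow_nonneg hr.le _), mul_comm C₁]
      have hM0 : 0 ≤ M := (abs_nonneg _).trans (hM θ)
      calc _ ≤ r ^ (a - 2) * (M * ‖φ θ‖ * C₁) := by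
            gcongr
            · exact hM θ
            · exact le_rfl
            · exact hC₁ _
        _ = _ := by ring
    · simp only [A', pol, hz1 θ r h1 h2, mul_zero]
  have iB' : Integrable B' (((surf N).restrict Ω).prod ((radMeas N).restrict (Set.Ioi ρ))) := by
    refine integrable_prod_of_le hρ (b := a - 2) (R := R) (C := C₁)
      ((hφm'.const_mul _).mul ((hrm _).mul hηm')) (iφ.const_mul (-a * (a + N - 2))).abs
      (fun θ r hr => ?_) fun θ r h1 h2 => ?_
    · simp only [B', pol]
      rw [abs_mul, abs_mul (r ^ (a - 2)), abs_of_nonneg (Real.rpow_nonneg hr.le _), mul_comm C₁]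
      gcongr
      exact hC₁ _
    · simp only [B', pol, hz1 θ r h1 h2, mul_zero]
  -- At a fixed radius `r` this is the spherical equation tested with the slice `η(r ·)`, whose
  -- tangential gradient carries a factor `r`.
  have hA : ∫ p, A p ∂((surf N).restrict Ω).prod ((radMeas N).restrict (Set.Ioi ρ)) =
      ∫ p, A' p ∂((surf N).restrict Ω).prod ((radMeas N).restrict (Set.Ioi ρ)) := by
    rw [integral_prod_symm _ iA, integral_prod_symm _ iA']
    refine integral_congr_ae ?_
    filter_upwards [ae_restrict_mem measurableSet_Ioi] with r hr
    have hr0 : 0 < r := hρ.trans hr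
    simp only [A', pol]
    rw [integral_const_mul, ← hweak _ (isTestOn_restrict hρ.le hη hr0), ← integral_const_mul]
    refine integral_congr_ae ?_
    filter_upwards [hH.ae_inner_eq_zero] with θ hθ
    simp only [A, pol]
    rw [sphGrad_restrict hη.smooth r θ _ hθ, ← mul_assoc, ← Real.rpow_add_one hr0.ne']
    congr 2
    ring
  -- At a fixed direction this is the one-dimensional integration by parts `radial_ibp`.
  have hB : ∫ p, B p ∂((surf N).restrict Ω).prod ((radMeas N).restrict (Set.Ioi ρ)) =
      ∫ p, B' p ∂((surf N).restrict Ω).prod ((radMeas N).restrict (Set.Ioi ρ)) := by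
    rw [integral_prod _ iB, integral_prod _ iB']
    refine integral_congr_ae (Eventually.of_forall fun θ => ?_)
    simp only [B, B', pol]
    rw [integral_const_mul, integral_const_mul, radial_ibp hN hρ hη θ a]
    ring
  have hm1 : Measurable fun x => ⟪conePowGrad a φ g x, gradient η x⟫_ℝ :=
    (measurable_conePowGrad a hφm hgm).inner hgc.measurable
  have hm2 : Measurable fun x =>
      conePotential (fun θ => U θ + -a * (a + N - 2)) x * conePow a φ x * η x :=
    ((measurable_conePotential (hU.add_const _)).mul (measurable_conePow a hφm)).mul hηc.measurable
  rw [setIntegral_cone hN hΩ hρ.le hm1.aestronglyMeasurable,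
    setIntegral_cone hN hΩ hρ.le hm2.aestronglyMeasurable]
  have e1 : ∫ p, ⟪conePowGrad a φ g (pol p), gradient η (pol p)⟫_ℝ
      ∂((surf N).restrict Ω).prod ((radMeas N).restrict (Set.Ioi ρ)) =
      ∫ p, A p + B p ∂((surf N).restrict Ω).prod ((radMeas N).restrict (Set.Ioi ρ)) := by
    refine integral_congr_ae ?_
    filter_upwards [ae_prod_lt hρ.le] with p hp
    simp only [A, B, pol]
    rw [conePowGrad_smul _ _ _ _ hp.1, real_inner_smul_left, inner_add_left, real_inner_smul_left]
    ring
  have e2 : ∫ p, conePotential (fun θ => U θ + -a * (a + N - 2)) (pol p) * conePow a φ (pol p) *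
      η (pol p) ∂((surf N).restrict Ω).prod ((radMeas N).restrict (Set.Ioi ρ)) =
      ∫ p, A' p + B' p ∂((surf N).restrict Ω).prod ((radMeas N).restrict (Set.Ioi ρ)) := by
    refine integral_congr_ae ?_
    filter_upwards [ae_prod_lt hρ.le] with p hp
    simp only [A', B', pol]
    have : p.2 ^ (a - 2) = p.2 ^ a / p.2 ^ 2 := by rw [Real.rpow_sub hp.1, Real.rpow_two]
    rw [conePow_smul _ _ _ hp.1, conePotential_smul _ _ hp.1, this]
    ring
  rw [e1, e2, integral_add iA iB, integral_add iA' iB', hA, hB]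

lemma exists_abs_le_add (V : Sph N → ℝ) {M : ℝ} (hM : ∀ θ, |V θ| ≤ M) (c : ℝ) (θ : Sph N) :
    |V θ + c| ≤ M + |c| :=
  (abs_add_le _ _).trans (by gcongr; exact hM θ)

theorem hasPositiveSuperSolution (hN : 0 < N) (hΩ : IsOpen Ω) (hΩc : IsConnected Ω) (hρ : 0 < ρ)
    {V : Sph N → ℝ} {M : ℝ} (hV : Measurable V) (hM : ∀ θ, |V θ| ≤ M)
    (h : 0 ≤ hardyConst N + bottom Ω V) : HasPositiveSuperSolution Ω ρ V := by
  obtain ⟨φ, g, hφs, hgs, hH, hφ0, hφne, hweak⟩ := exists_ground_state hN hΩ hΩc.nonempty hV hM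
  have hφm := hφs.measurable
  have hgm := hgs.measurable
  set l := bottom Ω V with hl
  set a : ℝ := -((N : ℝ) - 2) / 2 with ha
  have hG := isOpen_cone hΩ hρ.le
  have hUm : Measurable fun θ => V θ + l := hV.add_const _
  have hUM := exists_abs_le_add V hM l
  have hweak' : ∀ χ, IsTestOn Ω χ →
      ∫ θ in Ω, ⟪g θ, sphGrad χ θ⟫_ℝ ∂surf N = ∫ θ in Ω, (V θ + l) * φ θ * χ θ ∂surf N := by
    intro χ hχ
    have e : ∫ θ in Ω, (V θ + l) * φ θ * χ θ ∂surf N =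
        (∫ θ in Ω, V θ * φ θ * χ θ ∂surf N) + l * ∫ θ in Ω, φ θ * χ θ ∂surf N := by
      rw [← integral_const_mul, ← integral_add
        (by exact (memLp_bdd_mul hV hM hH.1).integrable_mul (hχ.memLp 2 Ω))
        (by exact (hH.1.integrable_mul (hχ.memLp 2 Ω)).const_mul _)]
      congr 1
      ext θ
      ring
    rw [e, ← hweak χ hχ]
    ring
  -- The exponent `-(N - 2) / 2` maximises `-a (a + N - 2)`, and the maximum is the Hardy constant.
  have hHa : -a * (a + N - 2) = hardyConst N := by rw [ha, hardyConst]; ring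
  set W : Euc N → ℝ := conePotential fun θ => V θ + l + hardyConst N with hW
  have hWm : Measurable W := measurable_conePotential (hUm.add_const _)
  set c : ℝ := (M + |l| + |hardyConst N|) / ρ ^ 2 with hc
  have hWc : ∀ x ∈ cone Ω ρ, |W x| ≤ c := fun x hx =>
    abs_conePotential_le (exists_abs_le_add _ hUM (hardyConst N)) hρ hx
  have hc0 : 0 ≤ c := by
    obtain ⟨θ, -⟩ := hΩc.nonempty
    have : 0 ≤ M := (abs_nonneg _).trans (hM θ)
    positivity
  have hv := isH1Loc_conePow hN hΩ hρ a hφm hgm hH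
  have heq : ∀ k, IsTestIn (cone Ω ρ) k → ∫ x in cone Ω ρ, ⟪conePowGrad a φ g x, gradient k x⟫_ℝ =
      ∫ x in cone Ω ρ, W x * conePow a φ x * k x := fun k hk => by
    rw [cone_equation hN hΩ hρ hUm hUM hφm hgm hH hweak' a hk, hHa]
  have hv0 : ∀ᵐ x ∂volume.restrict (cone Ω ρ), 0 ≤ conePow a φ x := by
    rw [ae_cone_iff hN hΩ hρ.le (measurableSet_le measurable_const (measurable_conePow a hφm))]
    filter_upwards [ae_prod_lt hρ.le, Measure.quasiMeasurePreserving_fst.ae hφ0] with p hp hp'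
    rw [pol, conePow_smul _ _ _ hp.1]
    exact mul_nonneg (Real.rpow_nonneg hp.1.le _) hp'
  have hWi : ∀ (Y : Euc N → ℝ) {b : ℝ}, Measurable Y → (∀ x ∈ cone Ω ρ, |Y x| ≤ b) →
      ∀ (ξ : Euc N → ℝ), Integrable (fun x => conePow a φ x * ξ x) (volume.restrict (cone Ω ρ)) →
      Integrable (fun x => Y x * conePow a φ x * ξ x) (volume.restrict (cone Ω ρ)) := by
    intro Y b hY hb ξ hξ
    simp_rw [mul_assoc]
    refine hξ.bdd_mul (c := b) hY.aestronglyMeasurable ?_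
    filter_upwards [ae_restrict_mem hG.measurableSet] with x hx
    exact hb x hx
  -- The equation has potential `W ≥ -c` on the cone and the solution is nonnegative, so the minimum
  -- principle applies with the constant `c`.
  have hdist : DistSuper (cone Ω ρ) (fun _ => -c) (conePow a φ) := by
    intro k hk hk0
    have hi := (hv.integral_eq_of_isTestIn hG hWm hWc heq hk.isH1cBdd).1
    have e1 := hv.integral_inner_gradient hk
    rw [heq k hk] at e1
    rw [show ∫ x in cone Ω ρ, conePow a φ x * lap k x =
      -∫ x in cone Ω ρ, W x * conePow a φ x * k x by linarith]
    refine neg_le_neg ?_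
    refine integral_mono_ae (hWi _ (b := c) measurable_const (fun x _ => by
      rw [abs_neg, abs_of_nonneg hc0]) k hi) (hWi W hWm hWc k hi) ?_
    filter_upwards [hv0, ae_restrict_mem hG.measurableSet] with x hx hxG
    rw [mul_assoc, mul_assoc]
    exact mul_le_mul_of_nonneg_right (neg_le_of_abs_le (hWc x hxG)) (mul_nonneg hx (hk0 x))
  refine ⟨conePow a φ, ⟨conePowGrad a φ g, hv, fun ξ k hξ hξ0 => ?_⟩, ?_⟩
  · obtain ⟨hi, he⟩ := hv.integral_eq_of_isTestIn hG hWm hWc heq hξ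
    rw [he, ← integral_sub (hWi W hWm hWc ξ hi) (hWi _ (measurable_conePotential hV)
      (fun x hx => abs_conePotential_le hM hρ hx) ξ hi)]
    -- The two potentials differ by `(l + hardyConst N) / r²`, which is nonnegative by hypothesis.
    refine integral_nonneg_of_ae ?_
    filter_upwards [hv0, hξ0, ae_restrict_mem hG.measurableSet] with x h1 h2 h3
    obtain ⟨r, hr, θ, -, rfl⟩ := h3
    have hr0 := hρ.trans hr
    rw [Pi.zero_apply, hW, conePotential_smul _ _ hr0, conePotential_smul _ _ hr0, ← sub_mul,
      ← sub_mul, ← sub_div]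
    refine mul_nonneg (mul_nonneg (div_nonneg ?_ (sq_nonneg _)) h1) h2
    linarith
  · refine (ae_eq_zero_or_isPositiveOn hG (isPreconnected_cone hΩc.isPreconnected ρ)
      (fun K hK hKc => hv.integrableOn hKc hK) hv0 hc0 hdist).resolve_left fun hz => hφne ?_
    rw [ae_cone_iff hN hΩ hρ.le
      (measurableSet_eq_fun (measurable_conePow a hφm) measurable_const)] at hz
    refine ae_of_ae_prod hρ.le ?_
    filter_upwards [hz, ae_prod_lt hρ.le] with p hp hp'
    rw [pol, conePow_smul _ _ _ hp'.1] at hp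
    exact (mul_eq_zero.1 hp).resolve_left (Real.rpow_pos_of_pos hp'.1 _).ne'

end Sufficiency

/-! ### Null-set changes of the potential, and constant potentials -/

section Congruence

variable {N : ℕ} {Ω : Set (Sph N)} {ρ : ℝ}

/-- An essentially bounded potential agrees almost everywhere with a bounded measurable one. -/
lemma exists_bounded_representative {V : Sph N → ℝ} (hV : MemLp V ∞ ((surf N).restrict Ω)) :
    ∃ (V' : Sph N → ℝ) (M : ℝ), Measurable V' ∧ (∀ θ, |V' θ| ≤ M) ∧
      V =ᵐ[(surf N).restrict Ω] V' := by
  set M := (eLpNormEssSup V ((surf N).restrict Ω)).toReal with hM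
  have hM0 : 0 ≤ M := ENNReal.toReal_nonneg
  -- A measurable modification truncated at plus and minus the essential supremum.
  refine ⟨fun θ => max (-M) (min M (hV.1.mk V θ)), M, measurable_const.max
    (measurable_const.min hV.1.stronglyMeasurable_mk.measurable), fun θ => abs_le.2
    ⟨le_max_left _ _, max_le (by linarith) (min_le_left _ _)⟩, ?_⟩
  filter_upwards [hV.1.ae_eq_mk, ae_le_eLpNormEssSup (f := V) (μ := (surf N).restrict Ω)]
    with θ h1 h2
  have hfin : eLpNormEssSup V ((surf N).restrict Ω) ≠ ⊤ := by
    have := hV.2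
    rw [eLpNorm_exponent_top] at this
    exact this.ne
  have h3 : |V θ| ≤ M := by
    have := ENNReal.toReal_mono hfin h2
    simpa using this
  rw [← h1, min_eq_right (abs_le.1 h3).2, max_eq_right (abs_le.1 h3).1]

lemma principalEigenvalue_congr {V V' : Sph N → ℝ} (h : V =ᵐ[(surf N).restrict Ω] V') :
    principalEigenvalue Ω V = principalEigenvalue Ω V' := by
  have e : ∀ φ ψ : Sph N → ℝ, ∫ θ in Ω, V θ * φ θ * ψ θ ∂surf N =
      ∫ θ in Ω, V' θ * φ θ * ψ θ ∂surf N := fun φ ψ => by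
    refine integral_congr_ae ?_
    filter_upwards [h] with θ hθ
    rw [hθ]
  simp only [principalEigenvalue, IsDirichletEigenvalue, e]

lemma conePotential_congr (hN : 0 < N) (hΩ : IsOpen Ω) (hρ : 0 < ρ) {V V' : Sph N → ℝ}
    (h : V =ᵐ[(surf N).restrict Ω] V') :
    conePotential V =ᵐ[volume.restrict (cone Ω ρ)] conePotential V' := by
  -- The exceptional set is enlarged to a measurable null set so that its indicator can be carried
  -- through polar coordinates.
  obtain ⟨B, hB, hBm, hB0⟩ := exists_measurable_superset_of_null (ae_iff.1 h)
  have hQ : ∀ᵐ x ∂volume.restrict (cone Ω ρ),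
      radialExt (B.indicator fun _ => (1 : ℝ)) x = 0 := by
    rw [ae_cone_iff hN hΩ hρ.le (measurableSet_eq_fun
      (measurable_radialExt (measurable_const.indicator hBm)) measurable_const)]
    have hB' : ∀ᵐ θ ∂(surf N).restrict Ω, θ ∉ B := measure_eq_zero_iff_ae_notMem.1 hB0
    filter_upwards [ae_prod_lt hρ.le, Measure.quasiMeasurePreserving_fst.ae hB'] with p hp hp'
    rw [pol, radialExt_smul _ _ hp.1, Set.indicator_of_notMem hp']
  filter_upwards [hQ, ae_restrict_mem (isOpen_cone hΩ hρ.le).measurableSet] with x hx hxG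
  obtain ⟨r, hr, θ, -, rfl⟩ := hxG
  have hr0 := hρ.trans hr
  rw [radialExt_smul _ _ hr0] at hx
  have hθ : θ ∉ B := fun hθ => by
    rw [Set.indicator_of_mem hθ] at hx
    exact one_ne_zero hx
  have : V θ = V' θ := by
    by_contra hne
    exact hθ (hB hne)
  rw [conePotential_smul _ _ hr0, conePotential_smul _ _ hr0, this]

lemma hasPositiveSuperSolution_congr (hN : 0 < N) (hΩ : IsOpen Ω) (hρ : 0 < ρ) {V V' : Sph N → ℝ}
    (h : V =ᵐ[(surf N).restrict Ω] V') :
    HasPositiveSuperSolution Ω ρ V ↔ HasPositiveSuperSolution Ω ρ V' := by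
  have e : ∀ u φ : Euc N → ℝ, ∫ x in cone Ω ρ, conePotential V x * u x * φ x =
      ∫ x in cone Ω ρ, conePotential V' x * u x * φ x := fun u φ => by
    refine integral_congr_ae ?_
    filter_upwards [conePotential_congr hN hΩ hρ h] with x hx
    rw [hx]
  simp only [HasPositiveSuperSolution, IsSuperSolution, e]

/-- On functions of unit mass, the constant potential lowers the energy by exactly `μ`. -/
lemma bottom_const (hΩ : IsOpen Ω) (hne : Ω.Nonempty) (μ : ℝ) :
    bottom Ω (fun _ => μ) = bottom Ω (fun _ => 0) - μ := by
  have hM0 : ∀ θ : Sph N, |(fun _ => (0 : ℝ)) θ| ≤ (0 : ℝ) := fun θ => by simp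
  have hMμ : ∀ θ : Sph N, |(fun _ => μ) θ| ≤ |μ| := fun θ => le_rfl
  have hE : ∀ ψ, IsTestOn Ω ψ → mass Ω ψ = 1 →
      energy Ω (fun _ => μ) ψ = energy Ω (fun _ => 0) ψ - μ := fun ψ hψ hm => by
    have := energy_add_const measurable_const hM0 hψ μ
    simpa [hm] using this
  obtain ⟨ψ₀, h0, h1⟩ := exists_test_mass_one hΩ hne
  refine le_antisymm ?_ ?_
  · rw [le_sub_iff_add_le]
    refine le_csInf ⟨_, ψ₀, h0, h1, rfl⟩ ?_
    rintro _ ⟨ψ, hψ, hm, rfl⟩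
    have := bottom_mul_mass_le measurable_const hMμ hψ
    rw [hm, mul_one, hE ψ hψ hm] at this
    linarith
  · refine le_csInf ⟨_, ψ₀, h0, h1, rfl⟩ ?_
    rintro _ ⟨ψ, hψ, hm, rfl⟩
    have := bottom_mul_mass_le measurable_const hM0 hψ
    rw [hm, mul_one] at this
    rw [hE ψ hψ hm]
    linarith

theorem hasPositiveSuperSolution_iff_bottom (hN : 0 < N) (hΩ : IsOpen Ω) (hΩc : IsConnected Ω)
    (hρ : 0 < ρ) {V : Sph N → ℝ} {M : ℝ} (hV : Measurable V) (hM : ∀ θ, |V θ| ≤ M) :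
    HasPositiveSuperSolution Ω ρ V ↔ 0 ≤ hardyConst N + bottom Ω V :=
  ⟨hardyConst_add_bottom_nonneg hN hΩ hΩc.nonempty hρ hV hM,
    hasPositiveSuperSolution hN hΩ hΩc hρ hV hM⟩

end Congruence

end ConeHardy

end

theorem corollary3p2 (N : ℕ) (hN : 2 ≤ N) (Ω : Set (ConeHardy.Sph N))
    (hΩ_open : IsOpen Ω) (hΩ_conn : IsConnected Ω) (ρ : ℝ) (hρ : 0 < ρ) :
    (∀ V : ConeHardy.Sph N → ℝ, MemLp V ∞ ((ConeHardy.surf N).restrict Ω) →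
      (ConeHardy.HasPositiveSuperSolution Ω ρ V ↔
        0 ≤ ConeHardy.hardyConst N + ConeHardy.principalEigenvalue Ω V)) ∧
    ∀ μ : ℝ, (ConeHardy.HasPositiveSuperSolution Ω ρ (fun _ => μ) ↔
      μ ≤ ConeHardy.hardyConst N + ConeHardy.principalEigenvalue Ω (fun _ => 0)) := by
  have hN0 : 0 < N := by lia
  refine ⟨fun V hV => ?_, fun μ => ?_⟩
  · obtain ⟨V', M, hV', hM, heq⟩ := ConeHardy.exists_bounded_representative hV
    rw [ConeHardy.hasPositiveSuperSolution_congr hN0 hΩ_open hρ heq,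
      ConeHardy.principalEigenvalue_congr heq,
      ConeHardy.principalEigenvalue_eq_bottom hN0 hΩ_open hΩ_conn.nonempty hV' hM]
    exact ConeHardy.hasPositiveSuperSolution_iff_bottom hN0 hΩ_open hΩ_conn hρ hV' hM
  · rw [ConeHardy.principalEigenvalue_eq_bottom hN0 hΩ_open hΩ_conn.nonempty measurable_const
        (M := 0) (fun θ => by simp),
      ConeHardy.hasPositiveSuperSolution_iff_bottom hN0 hΩ_open hΩ_conn hρ measurable_const
        (M := |μ|) (fun θ => le_rfl),
      ConeHardy.bottom_const hΩ_open hΩ_conn.nonempty μ, ← add_sub_assoc, sub_nonneg]
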